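/- Let $n\ge 2$ be an integer, $\alpha>-1$, and let $|S^n|$ be the surface area of the unit sphere of $\mathbb R^{n+1}$. Put $\Lambda_1:=(n-1)!\,|S^n|$ and $\gamma_n:=\tfrac{(n-1)!}{2}|S^n|$. Let $u$ be a weak solution of $$(-\Delta)^{n/2}u=|x|^{n\alpha}e^{nu}\quad\text{on }\mathbb R^n,\qquad \Lambda:=\int_{\mathbb R^n}|x|^{n\alpha}e^{nu}\,dx<\infty ,$$ in the following sense, with $f:=|x|^{n\alpha}e^{nu}$. If $n$ is even, $u\in L^1_{\rm loc}(\mathbb R^n)$ and $\int u\,(-\Delta)^{n/2}\varphi\,dx=\int f\varphi\,dx$ for all $\varphi\in C_c^\infty(\mathbb R^n)$. If $n$ is odd, $u\in L^1_{\rm loc}(\mathbb R^n)$ with $\int \frac{|u(x)|}{1+|x|^{2n}}\,dx<\infty$, and $\int u\,(-\Delta)^{n/2}\varphi\,dx=\int f\varphi\,dx$ for all Schwartz functions $\varphi$, where $(-\Delta)^{n/2}\varphi:=\mathcal F^{-1}(|\xi|^{n}\mathcal F\varphi)$ and $\mathcal F\varphi(\xi)=(2\pi)^{-n/2}\int\varphi(x)e^{-ix\cdot\xi}dx$.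 Then the integral $$v(x)=\frac1{\gamma_n}\int_{\mathbb R^n}\log\!\left(\frac{1+|y|}{|x-y|}\right)|y|^{n\alpha}e^{nu(y)}\,dy$$ converges absolutely for every $x\in\mathbb R^n$, and there exists a polynomial $p$ on $\mathbb R^n$ of degree at most $n-1$, bounded from above on $\mathbb R^n$, such that $u=v+p$ almost everywhere. Moreover $$\lim_{|x|\to\infty}\frac{v(x)}{\log|x|}=-\frac{\Lambda}{\gamma_n}.$$ Finally, if $p$ is constant, then $\Lambda=\Lambda_1(1+\alpha)$. -/

import Mathlib

open scoped Laplacian FourierTransform SchwartzMap ContDiff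

noncomputable section

namespace QCurv

/-- Euclidean space `ℝⁿ` with the Euclidean norm and Lebesgue measure. -/
abbrev E (n : ℕ) : Type := EuclideanSpace ℝ (Fin n)

/-- The surface area `|S^n|` of the unit sphere of `ℝ^(n+1)`. -/
def sphereArea (n : ℕ) : ℝ :=
  (MeasureTheory.volume : MeasureTheory.Measure (E (n + 1))).toSphere.real Set.univ

/-- `γ_n = (n-1)!/2 * |S^n|`. -/
def gammaConst (n : ℕ) : ℝ := (Nat.factorial (n - 1) : ℝ) / 2 * sphereArea n

/-- `Λ_1 = (n-1)! * |S^n|`. -/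
def lambdaOne (n : ℕ) : ℝ := (Nat.factorial (n - 1) : ℝ) * sphereArea n

/-- The space `L_s(ℝⁿ)`: locally integrable `w` with `∫ |w(x)| / (1 + |x|^(n+2s)) dx < ∞`. -/
def MemLs (n : ℕ) (s : ℝ) (w : E n → ℝ) : Prop :=
  MeasureTheory.LocallyIntegrable w ∧
    MeasureTheory.Integrable (fun x : E n => |w x| / (1 + ‖x‖ ^ ((n : ℝ) + 2 * s)))

/-- The integer power `(-Δ)^k φ`, for smooth `φ`, by iterating the classical operator. -/
def negLaplacianPow (n k : ℕ) (φ : E n → ℝ) : E n → ℝ :=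
  (fun (g : E n → ℝ) (x : E n) => -(Δ g x))^[k] φ

/-- `(-Δ)^(σ/2) φ` of a Schwartz function `φ`, that is the Fourier multiplier operator with symbol
`|ξ|^σ` in terms of the transform `∫ φ(x) e^(-i x·ξ) dx`. Mathlib's `𝓕` is
`∫ φ(x) e^(-2π i x·ξ) dx`, for which the symbol of the same operator is `(2π|ξ|)^σ`. -/
def fracLaplacian (n : ℕ) (σ : ℝ) (φ : 𝓢(E n, ℂ)) : E n → ℂ :=
  𝓕⁻ (fun ξ : E n => (((2 * Real.pi * ‖ξ‖) ^ σ : ℝ) : ℂ) * 𝓕 (fun x : E n => φ x) ξ)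

/-- `u` is a (weak) solution of `(-Δ)^(m/2) u = f` in `ℝⁿ`, for an integrable `f`
(acting on test functions by integration). For even `m`, `u` is in `L¹_loc` and is tested against
`C^∞_c`; for odd `m`, `u` is in `L_(m/2)` and is tested against Schwartz functions. -/
def IsSolution (n m : ℕ) (u f : E n → ℝ) : Prop :=
  (Even m →
    MeasureTheory.LocallyIntegrable u ∧
    ∀ φ : E n → ℝ, ContDiff ℝ ∞ φ → HasCompactSupport φ →
      ∫ x, u x * negLaplacianPow n (m / 2) φ x = ∫ x, f x * φ x) ∧
  (Odd m →
    MemLs n ((m : ℝ) / 2) u ∧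
    ∀ φ : 𝓢(E n, ℂ),
      ∫ x, (u x : ℂ) * fracLaplacian n (m : ℝ) φ x = ∫ x, (f x : ℂ) * φ x)

/-- The right-hand side `|x|^(nα) e^(n u(x))`. -/
def density (n : ℕ) (α : ℝ) (u : E n → ℝ) (x : E n) : ℝ :=
  ‖x‖ ^ ((n : ℝ) * α) * Real.exp ((n : ℝ) * u x)

/-- `u` solves `(-Δ)^(n/2) u = |x|^(nα) e^(nu)` on `ℝⁿ` with `∫ |x|^(nα) e^(nu) dx < ∞`. -/
def SolvesP0 (n : ℕ) (α : ℝ) (u : E n → ℝ) : Prop :=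
  MeasureTheory.Integrable (density n α u) ∧ IsSolution n n u (density n α u)

/-- `Λ = ∫ |x|^(nα) e^(nu) dx`. -/
def totalQ (n : ℕ) (α : ℝ) (u : E n → ℝ) : ℝ := ∫ x, density n α u x

/-- The integrand `y ↦ log((1+|y|)/|x-y|) |y|^(nα) e^(nu(y))` of the potential at `x`. -/
def potentialIntegrand (n : ℕ) (α : ℝ) (u : E n → ℝ) (x y : E n) : ℝ :=
  Real.log ((1 + ‖y‖) / ‖x - y‖) * density n α u y

/-- The logarithmic potential
`v(x) = (1/γ_n) ∫ log((1+|y|)/|x-y|) |y|^(nα) e^(nu(y)) dy`. -/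
def logPotential (n : ℕ) (α : ℝ) (u : E n → ℝ) (x : E n) : ℝ :=
  1 / gammaConst n * ∫ y, potentialIntegrand n α u x y

/-- The polynomial function on `ℝⁿ` given by `p`. -/
def polyFun (n : ℕ) (p : MvPolynomial (Fin n) ℝ) (x : E n) : ℝ :=
  MvPolynomial.eval (fun i => x i) p

end QCurv

end

/-!
Write `f = |x|^(nα) e^(nu)`, and `v` for the logarithmic potential of `f`.

*The polynomial part.* The logarithm is a superposition of Gaussians, and the Fourier transform of
Gaussians turns it into a multiple of `|ξ|^(-n)`; so `log (1/|x|)` is `γ_n` times a fundamental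
solution of `(-Δ)^(n/2)` (`integral_logKernel_smul`), and `v` solves the equation of `u`
(`integral_pot_smul`). The difference `w = u - v` is tempered: for odd `n` by the integrability
assumed of `u`, for even `n` because `w` is polyharmonic and its positive part, controlled by
`f` and `v`, dominates its negative part (`polyharmonic_tempered`). As `(-Δ)^(n/2) w = 0`, the
Fourier transform of `w` is supported at the origin, and `w` is a polynomial `p`
(`ae_eq_polyFun_of_fourier_support`).

*Upper bound and degree.* Since `v ≥ -(Λ/γ_n) log |x|` for `|x| ≥ 1` and `f` is integrable, `e^(np)`
is integrable against a power weight, and `p ≤ A + B log (1 + |x|)` (`polyFun_le_log`). A polynomial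
with such a bound is bounded above (`bddAbove_of_le_log`): the maximizers of its penalizations by
small multiples of a high power sum lie on an algebraic curve, along which `p` would depend
algebraically, not logarithmically, on the parameter. The degree of `p` is at most `n - 1`, for odd
`n` by the weight, and for even `n` because a polynomial that is bounded above and annihilated by
`Δ^(n/2)` has degree less than `n` (`totalDegree_lt_of_bddAbove`): its leading part is nonpositive
and has mean zero for the Gaussian.

*Convergence and asymptotics of `v`.* Now `f ≤ D |x|^(nα) e^(nv)`. On balls of small mass Jensen's
inequality improves this to the integrability of `f` against a small negative power of the distance,
with polynomial dependence on the center (`exists_lintegral_density_mul_rpow_le`). Hence the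
singular part of the potential converges at every point and is at most a constant plus a multiple of
`log |x|` times the mass of `f` near the point (`exists_integral_logSing_mul_le`), that is
`o(log |x|)`; the regular part is asymptotic to `-Λ log |x|` by dominated convergence
(`tendsto_pot_div_log`).

*Constant `p`.* Then `f` is, up to a constant factor, `|x|^(nα) e^(nv)`. By the asymptotics, and
because `f` is integrable, `f` decays faster than `|x|^(-n)`. The mass of `t^n f(t ·)` does not
depend on `t`, while convexity of the exponential bounds its change from below by
`n (1 + α) Λ log t` plus `n/γ_n` times the change of an interaction energy of `f`
(`scaling_inequality`). After symmetrization in its two variables the latter is at least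
`-(Λ²/2) log t - O(|log t|^(3/2))` (`le_integral_prod_dilation`). Letting `t → 1` from both sides
gives `(n/γ_n) Λ = 2n (1 + α)` (`mul_integral_eq_of_solution`), and `Λ_1 = 2γ_n`.
-/

noncomputable section

namespace QCurv

open MeasureTheory Filter Topology Set Metric

/-! ### The logarithmic kernel -/

/-- The kernel `log ((1 + |y|) / |x - y|)` of the logarithmic potential. -/
def logKernel {n : ℕ} (x y : E n) : ℝ := Real.log ((1 + ‖y‖) / ‖x - y‖)

/-- The positive part of `-log |z|`, the singular part of the logarithmic kernel. -/
def logSing {n : ℕ} (z : E n) : ℝ := max 0 (-Real.log ‖z‖)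

lemma logSing_nonneg {n : ℕ} (z : E n) : 0 ≤ logSing z := le_max_left _ _

lemma measurable_logSing {n : ℕ} : Measurable (logSing : E n → ℝ) := by
  unfold logSing; fun_prop

lemma measurable_logKernel {n : ℕ} : Measurable (fun z : E n × E n => logKernel z.1 z.2) := by
  unfold logKernel; fun_prop

lemma measurable_logKernel_left {n : ℕ} (y : E n) : Measurable (fun x : E n => logKernel x y) := by
  unfold logKernel; fun_prop

lemma measurable_logKernel_right {n : ℕ} (x : E n) : Measurable (fun y : E n => logKernel x y) := by
  unfold logKernel; fun_prop

lemma logSing_eq_zero {n : ℕ} {z : E n} (hz : 1 ≤ ‖z‖) : logSing z = 0 := by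
  unfold logSing
  have := Real.log_nonneg hz
  exact max_eq_left (by linarith)

lemma logKernel_self {n : ℕ} (x : E n) : logKernel x x = 0 := by simp [logKernel]

lemma logKernel_eq {n : ℕ} {x y : E n} (h : x ≠ y) :
    logKernel x y = Real.log (1 + ‖y‖) - Real.log ‖x - y‖ := by
  have h1 : ‖x - y‖ ≠ 0 := by simpa [sub_eq_zero] using h
  have h2 : 1 + ‖y‖ ≠ 0 := by positivity
  rw [logKernel, Real.log_div h2 h1]

lemma logKernel_le {n : ℕ} (x y : E n) :
    logKernel x y ≤ Real.log (2 + 2 * ‖x‖) + logSing (x - y) := by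
  have hx := norm_nonneg x
  have hy := norm_nonneg y
  have hl : 0 ≤ Real.log (2 + 2 * ‖x‖) := Real.log_nonneg (by linarith)
  rcases eq_or_ne x y with rfl | h
  · rw [logKernel_self]; have := logSing_nonneg (x - x); linarith
  rw [logKernel_eq h]
  have hpos : 0 < ‖x - y‖ := by simpa [sub_eq_zero] using h
  have hxy : ‖y‖ ≤ ‖x‖ + ‖x - y‖ := by
    have := norm_sub_norm_le y x; rw [norm_sub_rev] at this; linarith
  rcases le_total 1 ‖x - y‖ with h1 | h1
  · have : Real.log (1 + ‖y‖) ≤ Real.log ((2 + 2 * ‖x‖) * ‖x - y‖) :=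
      Real.log_le_log (by positivity) (by nlinarith)
    rw [Real.log_mul (by positivity) hpos.ne'] at this
    have := logSing_nonneg (x - y); linarith
  · have : Real.log (1 + ‖y‖) ≤ Real.log (2 + 2 * ‖x‖) :=
      Real.log_le_log (by positivity) (by nlinarith)
    have : -Real.log ‖x - y‖ ≤ logSing (x - y) := le_max_right _ _
    linarith

lemma neg_log_one_add_le_logKernel {n : ℕ} (x y : E n) : -Real.log (1 + ‖x‖) ≤ logKernel x y := by
  have hx := norm_nonneg x
  have hy := norm_nonneg y
  rcases eq_or_ne x y with rfl | h
  · rw [logKernel_self]; have := Real.log_nonneg (show 1 ≤ 1 + ‖x‖ by linarith); linarith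
  have hpos : 0 < ‖x - y‖ := by simpa [sub_eq_zero] using h
  rw [logKernel_eq h]
  have : Real.log ‖x - y‖ ≤ Real.log ((1 + ‖x‖) * (1 + ‖y‖)) :=
      Real.log_le_log hpos (by nlinarith [norm_sub_le x y])
  rw [Real.log_mul (by positivity) (by positivity)] at this
  linarith

lemma neg_log_norm_le_logKernel {n : ℕ} {x : E n} (hx : 1 ≤ ‖x‖) (y : E n) :
    -Real.log ‖x‖ ≤ logKernel x y := by
  have hy := norm_nonneg y
  rcases eq_or_ne x y with rfl | h
  · rw [logKernel_self]; have := Real.log_nonneg hx; linarith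
  have hpos : 0 < ‖x - y‖ := by simpa [sub_eq_zero] using h
  rw [logKernel_eq h]
  have : Real.log ‖x - y‖ ≤ Real.log (‖x‖ * (1 + ‖y‖)) :=
      Real.log_le_log hpos (by nlinarith [norm_sub_le x y])
  rw [Real.log_mul (by positivity) (by positivity)] at this
  linarith

lemma abs_logKernel_le {n : ℕ} (x y : E n) :
    |logKernel x y| ≤ Real.log (2 + 2 * ‖x‖) + logSing (x - y) := by
  refine abs_le.2 ⟨?_, logKernel_le x y⟩
  have h1 := neg_log_one_add_le_logKernel x y
  have hx := norm_nonneg x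
  have h2 : Real.log (1 + ‖x‖) ≤ Real.log (2 + 2 * ‖x‖) :=
    Real.log_le_log (by positivity) (by linarith)
  have := logSing_nonneg (x - y)
  linarith

lemma logSing_le_rpow {n : ℕ} {a : ℝ} (ha : 0 < a) (z : E n) :
    logSing z ≤ a⁻¹ * ‖z‖ ^ (-a) := by
  have h0 : 0 ≤ a⁻¹ * ‖z‖ ^ (-a) := by positivity
  refine max_le h0 ?_
  rcases eq_or_ne z 0 with rfl | hz
  · simpa using h0
  have hz : 0 < ‖z‖ := norm_pos_iff.2 hz
  have := Real.log_le_rpow_div (x := ‖z‖⁻¹) (by positivity) ha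
  rw [Real.log_inv, Real.inv_rpow hz.le, ← Real.rpow_neg hz.le] at this
  rw [inv_mul_eq_div]; exact this

lemma integrable_logSing {n : ℕ} (hn : 0 < n) : Integrable (logSing : E n → ℝ) := by
  have hsupp : Function.support (logSing : E n → ℝ) ⊆ ball 0 1 := by
    intro z hz
    by_contra h
    rw [mem_ball_zero_iff, not_lt] at h
    exact hz (logSing_eq_zero h)
  rw [← integrableOn_iff_integrable_of_support_subset hsupp]
  refine integrableOn_ball_of_norm_le_rpow (C := (1 / 2)⁻¹) (α := 1 / 2) ?_ ?_ ?_ ?_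
  · simpa using Nat.one_le_iff_ne_zero.mpr hn.ne'
  · have : (1 : ℝ) ≤ n := by exact_mod_cast hn
    simp only [finrank_euclideanSpace_fin]; linarith
  · filter_upwards with z
    rw [Real.norm_of_nonneg (logSing_nonneg _)]
    exact logSing_le_rpow one_half_pos z
  · exact measurable_logSing.aestronglyMeasurable

/-! ### Logarithmic potentials of integrable densities -/

/-- The potential `∫ log ((1 + |y|) / |x - y|) f(y) dy`, without a normalising constant. -/
def pot {n : ℕ} (f : E n → ℝ) (x : E n) : ℝ := ∫ y, logKernel x y * f y

/-- Against a bounded weight with a logarithmic moment, kernel and density are jointly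
integrable. -/
lemma integrable_prod_logKernel {n : ℕ} (hn : 0 < n) {F : Type*} [NormedAddCommGroup F]
    [NormedSpace ℝ F] {f : E n → ℝ} (hf : Integrable f)
    {g : E n → F} {B : ℝ} (hg : Integrable g) (hB : ∀ x, ‖g x‖ ≤ B)
    (hgl : Integrable (fun x => Real.log (2 + 2 * ‖x‖) * ‖g x‖)) :
    Integrable (fun z : E n × E n => (logKernel z.1 z.2 * f z.2) • g z.1) (volume.prod volume) := by
  have hm : AEStronglyMeasurable (fun z : E n × E n => (logKernel z.1 z.2 * f z.2) • g z.1)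
      (volume.prod volume) :=
    (measurable_logKernel.aestronglyMeasurable.mul hf.1.comp_snd).smul hg.1.comp_fst
  have hdom : Integrable (fun z : E n × E n =>
      (Real.log (2 + 2 * ‖z.1‖) * ‖g z.1‖) * ‖f z.2‖ + B * (logSing (z.1 - z.2) * ‖f z.2‖))
      (volume.prod volume) := by
    refine (hgl.mul_prod hf.norm).add (Integrable.const_mul ?_ _)
    have h1 : Integrable (fun z : E n × E n => logSing (z.2 - z.1) * ‖f z.1‖)
        (volume.prod volume) := by
      have hm' : AEStronglyMeasurable (fun z : E n × E n => logSing (z.2 - z.1) * ‖f z.1‖)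
          (volume.prod volume) :=
        ((measurable_logSing.comp (measurable_snd.sub measurable_fst)).aestronglyMeasurable).mul
          hf.1.norm.comp_fst
      rw [integrable_prod_iff hm']
      refine ⟨.of_forall fun y => ((integrable_logSing hn).comp_sub_right y).mul_const ‖f y‖, ?_⟩
      have : (fun y : E n => ∫ x, ‖logSing (x - y) * ‖f y‖‖) =
          fun y => (∫ x : E n, logSing x) * ‖f y‖ := by
        funext y
        rw [← integral_sub_right_eq_self (μ := (volume : Measure (E n))) logSing y,
          ← integral_mul_const]
        congr with x
        rw [norm_mul, norm_norm, Real.norm_of_nonneg (logSing_nonneg _)]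
      rw [this]
      exact hf.norm.const_mul _
    exact h1.swap
  refine hdom.mono' hm (.of_forall fun z => ?_)
  rw [norm_smul, norm_mul]
  have h := abs_logKernel_le z.1 z.2
  have hs := logSing_nonneg (z.1 - z.2)
  rw [← Real.norm_eq_abs] at h
  calc ‖logKernel z.1 z.2‖ * ‖f z.2‖ * ‖g z.1‖
      ≤ (Real.log (2 + 2 * ‖z.1‖) + logSing (z.1 - z.2)) * ‖f z.2‖ * ‖g z.1‖ := by gcongr
    _ = (Real.log (2 + 2 * ‖z.1‖) * ‖g z.1‖) * ‖f z.2‖ +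
        ‖g z.1‖ * (logSing (z.1 - z.2) * ‖f z.2‖) := by ring
    _ ≤ _ := by gcongr; exact hB _

lemma log_two_add_le_rpow {a t : ℝ} (ha : 0 < a) (ht : 0 ≤ t) :
    Real.log (2 + 2 * t) ≤ 2 ^ a / a * (1 + t) ^ a := by
  have h := Real.log_le_rpow_div (x := 2 + 2 * t) (by positivity) ha
  rw [show 2 + 2 * t = 2 * (1 + t) by ring, Real.mul_rpow (by norm_num) (by positivity)] at h
  rw [show 2 + 2 * t = 2 * (1 + t) by ring]
  calc _ ≤ _ := h
    _ = _ := by ring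

lemma integrable_log_mul_one_add_rpow {n : ℕ} {r : ℝ} (hr : (n : ℝ) < r) :
    Integrable (fun x : E n => Real.log (2 + 2 * ‖x‖) * (1 + ‖x‖) ^ (-r)) := by
  set a := (r - n) / 2 with ha
  have ha0 : 0 < a := by rw [ha]; linarith
  have hint : Integrable (fun x : E n => 2 ^ a / a * (1 + ‖x‖) ^ (-(r - a))) :=
    (integrable_one_add_norm
      (by simp only [finrank_euclideanSpace_fin]; rw [ha]; linarith)).const_mul _
  refine hint.mono' ?_ (.of_forall fun x => ?_)
  · exact ((Measurable.log (by fun_prop)).mul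
      ((by fun_prop : Measurable fun x : E n => 1 + ‖x‖).pow_const _)).aestronglyMeasurable
  have hx := norm_nonneg x
  have hl : 0 ≤ Real.log (2 + 2 * ‖x‖) := Real.log_nonneg (by linarith)
  rw [Real.norm_of_nonneg (by positivity)]
  calc _ ≤ 2 ^ a / a * (1 + ‖x‖) ^ a * (1 + ‖x‖) ^ (-r) := by
        gcongr; exact log_two_add_le_rpow ha0 hx
    _ = _ := by rw [mul_assoc, ← Real.rpow_add (by positivity)]; ring_nf

/-- The logarithmic potential grows slowly enough to be integrable against `(1 + |x|)^(-r)`,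
`r > n`. -/
lemma integrable_pot_mul {n : ℕ} (hn : 0 < n) {f : E n → ℝ} (hf : Integrable f) {r : ℝ}
    (hr : (n : ℝ) < r) : Integrable (fun x : E n => |pot f x| * (1 + ‖x‖) ^ (-r)) := by
  have hg : Integrable (fun x : E n => (1 + ‖x‖) ^ (-r)) :=
    integrable_one_add_norm (by simpa using hr)
  have hnn : ∀ x : E n, 0 ≤ (1 + ‖x‖) ^ (-r) := fun x => by positivity
  have h := (integrable_prod_logKernel hn hf (B := 1) hg (fun x => by
    rw [Real.norm_of_nonneg (hnn x)]
    refine Real.rpow_le_one_of_one_le_of_nonpos (by linarith [norm_nonneg x]) ?_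
    have : (0 : ℝ) ≤ n := Nat.cast_nonneg n
    linarith) (by simpa only [Real.norm_of_nonneg (hnn _)] using
      integrable_log_mul_one_add_rpow hr)).integral_prod_left
  refine h.norm.congr (.of_forall fun x => ?_)
  simp only [pot, smul_eq_mul]
  rw [integral_mul_const, norm_mul, Real.norm_of_nonneg (hnn x), Real.norm_eq_abs]

lemma ae_integrable_logKernel {n : ℕ} (hn : 0 < n) {f : E n → ℝ} (hf : Integrable f) :
    ∀ᵐ x : E n, Integrable (fun y => logKernel x y * f y) := by
  have hg : Integrable (fun x : E n => (1 + ‖x‖) ^ (-(n + 1 : ℝ))) :=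
    integrable_one_add_norm (by simp)
  have hnn : ∀ x : E n, 0 < (1 + ‖x‖) ^ (-(n + 1 : ℝ)) := fun x => by positivity
  have h := (integrable_prod_logKernel hn hf (B := 1) hg (fun x => by
    rw [Real.norm_of_nonneg (hnn x).le]
    refine Real.rpow_le_one_of_one_le_of_nonpos (by linarith [norm_nonneg x]) ?_
    have : (0 : ℝ) ≤ n := Nat.cast_nonneg n
    linarith) (by simpa only [Real.norm_of_nonneg (hnn _).le] using
      integrable_log_mul_one_add_rpow (by linarith))).prod_right_ae
  filter_upwards [h] with x hx
  have := hx.mul_const ((1 + ‖x‖) ^ (-(n + 1 : ℝ)))⁻¹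
  refine this.congr (.of_forall fun y => ?_)
  simp only [smul_eq_mul]
  rw [mul_assoc, mul_inv_cancel₀ (hnn x).ne', mul_one]

lemma locallyIntegrable_pot {n : ℕ} (hn : 0 < n) {f : E n → ℝ} (hf : Integrable f) :
    LocallyIntegrable (pot f) := by
  have h := (integrable_pot_mul hn hf (r := n + 1) (by linarith)).locallyIntegrable
  have hm : AEStronglyMeasurable (pot f) := by
    unfold pot
    exact (measurable_logKernel.aestronglyMeasurable.mul hf.1.comp_snd).integral_prod_right'
  have hc : Continuous (fun x : E n => (1 + ‖x‖) ^ ((n : ℝ) + 1)) :=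
    (continuous_const.add continuous_norm).rpow_const fun x => Or.inr (by positivity)
  rw [locallyIntegrable_iff] at h ⊢
  intro K hK
  have := (h K hK).continuousOn_mul hc.continuousOn hK
  refine Integrable.mono this hm.restrict (.of_forall fun x => ?_)
  have hp : 0 < (1 + ‖x‖) ^ ((n : ℝ) + 1) := by positivity
  rw [norm_mul, norm_mul, Real.norm_of_nonneg hp.le, Real.norm_eq_abs, Real.norm_eq_abs, abs_abs,
    Real.norm_of_nonneg (by positivity), Real.rpow_neg (by positivity)]
  field_simp
  rfl

/-! ### The fundamental solution -/

lemma sphereArea_eq (n : ℕ) :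
    sphereArea n = 2 * Real.pi ^ ((n + 1 : ℝ) / 2) / Real.Gamma ((n + 1 : ℝ) / 2) := by
  rw [sphereArea, Measure.toSphere_real_apply_univ, Measure.real, EuclideanSpace.volume_ball]
  have hG : 0 < Real.Gamma ((n + 1 : ℝ) / 2) := Real.Gamma_pos_of_pos (by positivity)
  have h1 : Real.Gamma ((n + 1 : ℝ) / 2 + 1) = (n + 1 : ℝ) / 2 * Real.Gamma ((n + 1 : ℝ) / 2) :=
    Real.Gamma_add_one (by positivity)
  have h2 : √Real.pi ^ (n + 1) = Real.pi ^ ((n + 1 : ℝ) / 2) := by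
    rw [Real.sqrt_eq_rpow, ← Real.rpow_natCast, ← Real.rpow_mul Real.pi_pos.le]
    congr 1; push_cast; ring
  simp only [finrank_euclideanSpace_fin, Fintype.card_fin, ENNReal.ofReal_one, one_pow, one_mul]
  push_cast
  rw [h1, h2, ENNReal.toReal_ofReal (by positivity)]
  field_simp

lemma gammaConst_eq {n : ℕ} (hn : 0 < n) :
    gammaConst n = 2 ^ (n - 1) * Real.pi ^ ((n : ℝ) / 2) * Real.Gamma ((n : ℝ) / 2) := by
  have hn' : (0 : ℝ) < n := by exact_mod_cast hn
  have h := Real.Gamma_mul_Gamma_add_half ((n : ℝ) / 2)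
  have h1 : Real.Gamma n = (Nat.factorial (n - 1) : ℝ) := by
    obtain ⟨m, rfl⟩ := Nat.exists_eq_succ_of_ne_zero hn.ne'
    simpa using Real.Gamma_nat_eq_factorial m
  rw [show 2 * ((n : ℝ) / 2) = n by ring, h1, show (n : ℝ) / 2 + 1 / 2 = (n + 1) / 2 by ring] at h
  have hG : 0 < Real.Gamma ((n + 1 : ℝ) / 2) := Real.Gamma_pos_of_pos (by positivity)
  have hpi := Real.pi_pos
  have h3 : Real.pi ^ ((n + 1 : ℝ) / 2) = Real.pi ^ ((n : ℝ) / 2) * √Real.pi := by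
    rw [Real.sqrt_eq_rpow, ← Real.rpow_add hpi]; congr 1; ring
  have h4 : (2 : ℝ) ^ (1 - (n : ℝ)) * 2 ^ (n - 1) = 1 := by
    rw [← Real.rpow_natCast, ← Real.rpow_add (by norm_num), Nat.cast_sub hn]; simp
  rw [gammaConst, sphereArea_eq, h3]
  have h5 : (Nat.factorial (n - 1) : ℝ) * √Real.pi =
      2 ^ (n - 1) * (Real.Gamma ((n : ℝ) / 2) * Real.Gamma ((n + 1 : ℝ) / 2)) := by
    rw [h]
    linear_combination (-(Nat.factorial (n - 1) : ℝ) * √Real.pi) * h4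
  field_simp
  linear_combination h5

lemma gammaConst_pos {n : ℕ} (hn : 0 < n) : 0 < gammaConst n := by
  rw [gammaConst_eq hn]
  have : (0 : ℝ) < n := by exact_mod_cast hn
  have := Real.Gamma_pos_of_pos (show 0 < (n : ℝ) / 2 by positivity)
  have := Real.pi_pos
  positivity

lemma integrableOn_frullani_exp {a : ℝ} (ha : 0 < a) :
    IntegrableOn (fun t : ℝ => t⁻¹ * (Real.exp (-(a * t)) - Real.exp (-t))) (Ioi 0) := by
  set m := min a 1 with hm
  have hm0 : 0 < m := lt_min ha one_pos
  have hint : IntegrableOn (fun t : ℝ => |a - 1| * Real.exp (-m * t)) (Ioi 0) :=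
    (exp_neg_integrableOn_Ioi 0 hm0).const_mul _
  refine Integrable.mono' hint (by fun_prop) ?_
  filter_upwards [self_mem_ae_restrict measurableSet_Ioi] with t ht
  have ht : 0 < t := ht
  have key : ∀ x y : ℝ, m * t ≤ x → m * t ≤ y →
      |Real.exp (-x) - Real.exp (-y)| ≤ |x - y| * Real.exp (-m * t) := by
    have aux : ∀ x y : ℝ, m * t ≤ x → x ≤ y →
        Real.exp (-x) - Real.exp (-y) ≤ (y - x) * Real.exp (-m * t) := by
      intro x y hx hxy
      have h1 := Real.add_one_le_exp (-(y - x))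
      have h2 : Real.exp (-y) = Real.exp (-x) * Real.exp (-(y - x)) := by
        rw [← Real.exp_add]; ring_nf
      have h3 : Real.exp (-x) ≤ Real.exp (-m * t) := Real.exp_le_exp.2 (by linarith)
      have h4 := Real.exp_pos (-x)
      rw [h2]
      nlinarith
    intro x y hx hy
    rcases le_total x y with h | h
    · rw [abs_of_nonneg (by have := Real.exp_le_exp.2 (neg_le_neg h); linarith), abs_sub_comm,
        abs_of_nonneg (sub_nonneg.2 h)]
      exact aux x y hx h
    · rw [abs_sub_comm, abs_of_nonneg (by have := Real.exp_le_exp.2 (neg_le_neg h); linarith),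
        abs_of_nonneg (sub_nonneg.2 h)]
      exact aux y x hy h
  have h := key (a * t) t (by gcongr; exact min_le_left _ _)
    (by nlinarith [min_le_right a 1])
  rw [Real.norm_eq_abs, abs_mul, abs_of_pos (inv_pos.2 ht), inv_mul_le_iff₀ ht]
  calc _ ≤ _ := h
    _ = _ := by
      rw [show a * t - t = (a - 1) * t by ring, abs_mul, abs_of_pos ht]; ring

/-- Frullani's integral, the representation of the logarithm as a superposition of exponentials. -/
lemma integral_frullani_exp {a : ℝ} (ha : 0 < a) :
    ∫ t in Ioi (0 : ℝ), t⁻¹ * (Real.exp (-(a * t)) - Real.exp (-t)) = -Real.log a := by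
  have h := Frullani.integral_Ioi_eq (f := fun t => Real.exp (-t)) (L := 1) (R := 0) (a := a)
    (b := 1)
    ((by fun_prop : Continuous fun t : ℝ => Real.exp (-t)).locallyIntegrable.locallyIntegrableOn _)
    ha one_pos
    ?_ ?_ ?_
  · simpa using h
  · have : Tendsto (fun t : ℝ => Real.exp (-t)) (𝓝 0) (𝓝 (Real.exp (-0))) :=
      (by fun_prop : Continuous fun t : ℝ => Real.exp (-t)).tendsto 0
    simpa using this.mono_left nhdsWithin_le_nhds
  · exact Real.tendsto_exp_neg_atTop_nhds_zero
  · simpa using integrableOn_frullani_exp ha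

lemma integral_abs_frullani_exp {a : ℝ} (ha : 0 < a) :
    ∫ t in Ioi (0 : ℝ), |t⁻¹ * (Real.exp (-(a * t)) - Real.exp (-t))| = |Real.log a| := by
  rcases le_total a 1 with h | h
  · rw [abs_of_nonpos (Real.log_nonpos ha.le h), ← integral_frullani_exp ha]
    refine setIntegral_congr_fun measurableSet_Ioi fun t ht => ?_
    have ht : 0 < t := ht
    refine abs_of_nonneg (mul_nonneg (by positivity) (sub_nonneg.2 (Real.exp_le_exp.2 ?_)))
    nlinarith
  · rw [abs_of_nonneg (Real.log_nonneg h), ← neg_neg (Real.log a), ← integral_frullani_exp ha,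
      ← integral_neg]
    refine setIntegral_congr_fun measurableSet_Ioi fun t ht => ?_
    have ht : 0 < t := ht
    refine abs_of_nonpos (mul_nonpos_of_nonneg_of_nonpos (by positivity)
      (sub_nonpos.2 (Real.exp_le_exp.2 ?_)))
    nlinarith

lemma integrableOn_rpow_mul_exp_neg_div {s c : ℝ} (hs : 0 < s) (hc : 0 < c) :
    IntegrableOn (fun t : ℝ => t ^ (-s - 1) * Real.exp (-(c / t))) (Ioi 0) := by
  have h : IntegrableOn (fun x : ℝ => x ^ (s - 1) * Real.exp (-(c * x))) (Ioi 0) := by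
    have := integrableOn_rpow_mul_exp_neg_mul_rpow (s := s - 1) (p := 1) (b := c)
      (by linarith) one_pos hc
    simpa using this
  rw [← integrableOn_Ioi_comp_rpow_iff _ (show (-1 : ℝ) ≠ 0 by norm_num)] at h
  refine h.congr_fun (fun t ht => ?_) measurableSet_Ioi
  have ht : 0 < t := ht
  simp only [abs_neg, abs_one, one_mul, smul_eq_mul]
  rw [← Real.rpow_mul ht.le, ← mul_assoc, ← Real.rpow_add ht, Real.rpow_neg_one, div_eq_mul_inv]
  congr 2; ring

lemma integral_rpow_mul_exp_neg_div {s c : ℝ} (hs : 0 < s) (hc : 0 < c) :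
    ∫ t in Ioi (0 : ℝ), t ^ (-s - 1) * Real.exp (-(c / t)) = Real.Gamma s * c ^ (-s) := by
  have h := Real.integral_rpow_mul_exp_neg_mul_Ioi hs hc
  rw [← integral_comp_rpow_Ioi _ (show (-1 : ℝ) ≠ 0 by norm_num)] at h
  rw [mul_comm, Real.rpow_neg hc.le, ← Real.inv_rpow hc.le, ← one_div, ← h]
  refine setIntegral_congr_fun measurableSet_Ioi fun t ht => ?_
  have ht : 0 < t := ht
  simp only [abs_neg, abs_one, one_mul, smul_eq_mul]
  rw [← Real.rpow_mul ht.le, ← mul_assoc, ← Real.rpow_add ht, Real.rpow_neg_one, div_eq_mul_inv]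
  congr 2; ring

lemma schwartz_iteratedFDeriv_le {n : ℕ} {F : Type*} [NormedAddCommGroup F] [NormedSpace ℝ F]
    (g : 𝓢(E n, F)) (j k : ℕ) :
    ∃ C : ℝ, 0 ≤ C ∧ ∀ x, ‖iteratedFDeriv ℝ j g x‖ ≤ C * (1 + ‖x‖) ^ (-(k : ℝ)) := by
  refine ⟨2 ^ k * (Finset.Iic (k, j)).sup (fun m => SchwartzMap.seminorm ℝ m.1 m.2) g,
    by positivity, fun x => ?_⟩
  have := g.one_add_le_sup_seminorm_apply (𝕜 := ℝ) (m := (k, j)) le_rfl le_rfl x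
  have hp : 0 < (1 + ‖x‖) ^ k := by positivity
  rw [Real.rpow_neg (by positivity), Real.rpow_natCast, ← div_eq_mul_inv, le_div_iff₀ hp, mul_comm]
  exact this

lemma schwartz_norm_le {n : ℕ} {F : Type*} [NormedAddCommGroup F] [NormedSpace ℝ F]
    (g : 𝓢(E n, F)) (k : ℕ) :
    ∃ C : ℝ, 0 ≤ C ∧ ∀ x, ‖g x‖ ≤ C * (1 + ‖x‖) ^ (-(k : ℝ)) := by
  simpa using schwartz_iteratedFDeriv_le g 0 k

lemma integrable_log_mul_schwartz {n : ℕ} {F : Type*} [NormedAddCommGroup F] [NormedSpace ℝ F]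
    (g : 𝓢(E n, F)) : Integrable (fun x => Real.log (2 + 2 * ‖x‖) * ‖g x‖) := by
  obtain ⟨C, hC0, hC⟩ := schwartz_norm_le g (n + 1)
  refine ((integrable_log_mul_one_add_rpow (n := n) (r := (n + 1 : ℕ))
    (by push_cast; linarith)).const_mul C).mono'
    ((Measurable.log (by fun_prop)).aestronglyMeasurable.mul
      g.continuous.norm.aestronglyMeasurable) (.of_forall fun x => ?_)
  have hl : 0 ≤ Real.log (2 + 2 * ‖x‖) := Real.log_nonneg (by linarith [norm_nonneg x])
  rw [Real.norm_of_nonneg (by positivity)]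
  calc _ ≤ Real.log (2 + 2 * ‖x‖) * (C * (1 + ‖x‖) ^ (-((n + 1 : ℕ) : ℝ))) := by gcongr; exact hC x
    _ = _ := by ring

lemma schwartz_bounded {n : ℕ} {F : Type*} [NormedAddCommGroup F] [NormedSpace ℝ F]
    (g : 𝓢(E n, F)) : ∃ B : ℝ, ∀ x, ‖g x‖ ≤ B := by
  obtain ⟨C, -, hC⟩ := schwartz_norm_le g 0
  exact ⟨C, fun x => by simpa using hC x⟩

lemma integrable_logKernel_smul_schwartz {n : ℕ} (hn : 0 < n) {F : Type*} [NormedAddCommGroup F]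
    [NormedSpace ℝ F] (g : 𝓢(E n, F)) (y : E n) : Integrable (fun x => logKernel x y • g x) := by
  obtain ⟨B, hB⟩ := schwartz_bounded g
  have hB0 : 0 ≤ B := (norm_nonneg _).trans (hB 0)
  refine ((integrable_log_mul_schwartz g).add
    (((integrable_logSing hn).comp_sub_right y).const_mul B)).mono'
    ((measurable_logKernel_left y).aestronglyMeasurable.smul g.continuous.aestronglyMeasurable)
    (.of_forall fun x => ?_)
  have h := abs_logKernel_le x y
  have hs := logSing_nonneg (x - y)
  rw [norm_smul, Real.norm_eq_abs]
  calc _ ≤ (Real.log (2 + 2 * ‖x‖) + logSing (x - y)) * ‖g x‖ := by gcongr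
    _ = Real.log (2 + 2 * ‖x‖) * ‖g x‖ + ‖g x‖ * logSing (x - y) := by ring
    _ ≤ _ := by
      simp only [Pi.add_apply]
      gcongr; exact hB x

lemma integral_gaussian_smul_eq {n : ℕ} (g : 𝓢(E n, ℂ)) (y : E n) {t : ℝ} (ht : 0 < t) :
    ∫ x, Real.exp (-(‖x - y‖ ^ 2 * t)) • g x =
      ∫ ξ, ((Real.pi / t) ^ ((n : ℝ) / 2) * Real.exp (-(Real.pi ^ 2 * ‖ξ‖ ^ 2 / t))) •
        (Complex.exp (2 * Real.pi * Complex.I * (inner ℝ y ξ : ℝ)) * 𝓕 (g : E n → ℂ) ξ) := by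
  set b : ℂ := ((Real.pi ^ 2 / t : ℝ) : ℂ) with hb
  have hpi := Real.pi_pos
  have hbre : 0 < b.re := by rw [hb, Complex.ofReal_re]; positivity
  have J : Integrable (fun w : E n => Complex.exp (-b * ‖w‖ ^ 2 +
      2 * Real.pi * Complex.I * (inner ℝ y w : ℝ))) :=
    GaussianFourier.integrable_cexp_neg_mul_sq_norm_add hbre _ _
  have h : ∫ w : E n, 𝓕 (fun w : E n => Complex.exp (-b * ‖w‖ ^ 2 +
      2 * Real.pi * Complex.I * (inner ℝ y w : ℝ))) w • g w = ∫ w : E n, Complex.exp (-b * ‖w‖ ^ 2 +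
      2 * Real.pi * Complex.I * (inner ℝ y w : ℝ)) • 𝓕 (g : E n → ℂ) w := by
    simpa using! (VectorFourier.integral_fourierIntegral_smul_eq_flip (L := innerₗ (E n))
      Real.continuous_fourierChar continuous_inner J g.integrable)
  have h1 : ∀ w : E n, 𝓕 (fun w : E n => Complex.exp (-b * ‖w‖ ^ 2 +
      2 * Real.pi * Complex.I * (inner ℝ y w : ℝ))) w =
      (((t / Real.pi) ^ ((n : ℝ) / 2) * Real.exp (-(‖w - y‖ ^ 2 * t)) : ℝ) : ℂ) := by
    intro w
    rw [fourier_gaussian_innerProductSpace' hbre]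
    have e1 : (Real.pi : ℂ) / b = ((t / Real.pi : ℝ) : ℂ) := by
      rw [hb]; push_cast; field_simp
    have e2 : -(Real.pi : ℂ) ^ 2 * (‖y - w‖ : ℂ) ^ 2 / b = ((-(‖w - y‖ ^ 2 * t) : ℝ) : ℂ) := by
      rw [hb, norm_sub_rev]; push_cast; field_simp
    rw [e1, e2, finrank_euclideanSpace_fin, ← Complex.ofReal_exp,
      show ((n : ℂ) / 2) = (((n : ℝ) / 2 : ℝ) : ℂ) by push_cast; rfl,
      ← Complex.ofReal_cpow (by positivity)]
    push_cast; rfl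
  have hc : (Real.pi / t) ^ ((n : ℝ) / 2) * (t / Real.pi) ^ ((n : ℝ) / 2) = 1 := by
    rw [← Real.mul_rpow (by positivity) (by positivity)]
    have : Real.pi / t * (t / Real.pi) = 1 := by field_simp
    rw [this, Real.one_rpow]
  calc ∫ x, Real.exp (-(‖x - y‖ ^ 2 * t)) • g x
      = ∫ x, ((Real.pi / t) ^ ((n : ℝ) / 2)) • (𝓕 (fun w : E n => Complex.exp (-b * ‖w‖ ^ 2 +
          2 * Real.pi * Complex.I * (inner ℝ y w : ℝ))) x • g x) := by
        congr with x
        rw [h1, smul_eq_mul, Complex.real_smul, Complex.real_smul, ← mul_assoc,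
          ← Complex.ofReal_mul,
          ← mul_assoc, hc, one_mul]
    _ = ((Real.pi / t) ^ ((n : ℝ) / 2)) • ∫ w : E n, Complex.exp (-b * ‖w‖ ^ 2 +
      2 * Real.pi * Complex.I * (inner ℝ y w : ℝ)) • 𝓕 (g : E n → ℂ) w := by
        rw [integral_smul, h]
    _ = _ := by
        rw [← integral_smul]
        congr with w
        have e3 : -b * (‖w‖ : ℂ) ^ 2 = ((-(Real.pi ^ 2 * ‖w‖ ^ 2 / t) : ℝ) : ℂ) := by
          rw [hb]; push_cast; field_simp
        rw [Complex.exp_add, e3, ← Complex.ofReal_exp]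
        simp only [Complex.real_smul, smul_eq_mul]
        push_cast; ring

/-- The logarithm is, up to a constant, the superposition of Gaussians `∫ e^(-t|x|²) dt/t`;
applying this under the integral turns its pairing with `g` into one with Gaussians. -/
lemma integral_neg_log_smul_eq {n : ℕ} (hn : 0 < n) (g : 𝓢(E n, ℂ)) (hg0 : ∫ x, g x = 0)
    (y : E n) :
    ∫ x, (-Real.log ‖x - y‖) • g x =
      (1 / 2 : ℝ) • ∫ t in Ioi (0 : ℝ), t⁻¹ • ∫ x, Real.exp (-(‖x - y‖ ^ 2 * t)) • g x := by
  have : Nonempty (Fin n) := ⟨⟨0, hn⟩⟩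
  have hne : ∀ᵐ x : E n, x ≠ y := by simp [ae_iff]
  have hlogint : Integrable (fun x => Real.log ‖x - y‖ * ‖g x‖) := by
    have h1 := (integrable_logKernel_smul_schwartz hn g y).norm
    have h2 := (g.integrable (μ := volume)).norm.const_mul (Real.log (1 + ‖y‖))
    refine (h1.add h2).mono'
      ((Measurable.log (by fun_prop)).aestronglyMeasurable.mul
        g.continuous.norm.aestronglyMeasurable) ?_
    filter_upwards [hne] with x hx
    simp only [Pi.add_apply]
    have h3 : Real.log ‖x - y‖ = Real.log (1 + ‖y‖) - logKernel x y := by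
      rw [logKernel_eq hx]; ring
    have h4 : 0 ≤ Real.log (1 + ‖y‖) := Real.log_nonneg (by linarith [norm_nonneg y])
    rw [norm_mul, norm_norm, h3, norm_smul, ← add_mul]
    gcongr
    calc _ ≤ ‖Real.log (1 + ‖y‖)‖ + ‖logKernel x y‖ := norm_sub_le _ _
      _ = _ := by rw [Real.norm_of_nonneg h4]; ring
  set k : E n → ℝ → ℝ := fun x t => t⁻¹ * (Real.exp (-(‖x - y‖ ^ 2 * t)) - Real.exp (-t)) with hk
  have hkm : Measurable (fun z : E n × ℝ => k z.1 z.2) := by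
    simp only [hk]; fun_prop
  have hlog : ∀ x : E n, x ≠ y → ∫ t in Ioi (0 : ℝ), k x t = 2 * (-Real.log ‖x - y‖) := by
    intro x hx
    have hp : 0 < ‖x - y‖ := by simpa [sub_eq_zero] using hx
    rw [hk, integral_frullani_exp (by positivity), Real.log_pow]; push_cast; ring
  have hprod : Integrable (fun z : E n × ℝ => k z.1 z.2 • g z.1)
      (volume.prod (volume.restrict (Ioi 0))) := by
    have hm : AEStronglyMeasurable (fun z : E n × ℝ => k z.1 z.2 • g z.1)
        (volume.prod (volume.restrict (Ioi 0))) :=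
      hkm.aestronglyMeasurable.smul (g.continuous.comp continuous_fst).aestronglyMeasurable
    rw [integrable_prod_iff hm]
    constructor
    · filter_upwards [hne] with x hx
      have hp : 0 < ‖x - y‖ := by simpa [sub_eq_zero] using hx
      exact (integrableOn_frullani_exp (show 0 < ‖x - y‖ ^ 2 by positivity)).smul_const (g x)
    · refine (hlogint.norm.const_mul 2).congr ?_
      filter_upwards [hne] with x hx
      have hp : 0 < ‖x - y‖ := by simpa [sub_eq_zero] using hx
      simp only [norm_smul]
      rw [integral_mul_const]
      simp only [hk, Real.norm_eq_abs]
      rw [integral_abs_frullani_exp (by positivity), Real.log_pow, abs_mul, abs_mul, abs_norm]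
      push_cast
      rw [abs_of_pos (by norm_num : (0 : ℝ) < 2)]; ring
  have hswap := integral_integral_swap (f := fun x t => k x t • g x) hprod
  have hL : ∫ x, ∫ t in Ioi (0 : ℝ), k x t • g x = ∫ x, (2 : ℝ) • ((-Real.log ‖x - y‖) • g x) := by
    refine integral_congr_ae ?_
    filter_upwards [hne] with x hx
    rw [integral_smul_const, hlog x hx, mul_smul]
  have hR : ∫ t in Ioi (0 : ℝ), ∫ x, k x t • g x =
      ∫ t in Ioi (0 : ℝ), t⁻¹ • ∫ x, Real.exp (-(‖x - y‖ ^ 2 * t)) • g x := by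
    refine setIntegral_congr_fun measurableSet_Ioi fun t ht => ?_
    have ht : 0 < t := ht
    simp only [hk]
    have hi : Integrable (fun x => Real.exp (-(‖x - y‖ ^ 2 * t)) • g x) := by
      refine (g.integrable (μ := volume)).norm.mono' (by fun_prop) (.of_forall fun x => ?_)
      rw [norm_smul, Real.norm_of_nonneg (Real.exp_pos _).le]
      refine mul_le_of_le_one_left (norm_nonneg _) (Real.exp_le_one_iff.2 ?_)
      have : 0 ≤ ‖x - y‖ ^ 2 * t := by positivity
      linarith
    calc ∫ x, (t⁻¹ * (Real.exp (-(‖x - y‖ ^ 2 * t)) - Real.exp (-t))) • g x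
        = ∫ x, t⁻¹ • (Real.exp (-(‖x - y‖ ^ 2 * t)) • g x - Real.exp (-t) • g x) := by
          congr with x; rw [mul_smul, sub_smul]
      _ = _ := by
          have hi2 : Integrable (fun x => Real.exp (-t) • g x) := g.integrable.fun_smul _
          rw [integral_smul, integral_sub hi hi2, integral_smul, hg0, smul_zero, sub_zero]
  rw [hL, hR, integral_smul] at hswap
  rw [← hswap, smul_smul]; norm_num

/-- `log (1 / |x|)` is `γ_n` times a fundamental solution of `(-Δ)^(n/2)`, the operator being given
by its symbol. -/
theorem integral_logKernel_smul {n : ℕ} (hn : 0 < n) (φ g : 𝓢(E n, ℂ))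
    (h : ∀ ξ, 𝓕 (g : E n → ℂ) ξ = (((2 * Real.pi * ‖ξ‖) ^ n : ℝ) : ℂ) * 𝓕 (φ : E n → ℂ) ξ)
    (y : E n) : ∫ x, logKernel x y • g x = gammaConst n • φ y := by
  have : Nonempty (Fin n) := ⟨⟨0, hn⟩⟩
  have hpi := Real.pi_pos
  have hn' : (0 : ℝ) < n := by exact_mod_cast hn
  have hne : ∀ᵐ x : E n, x ≠ y := by simp [ae_iff]
  have hne0 : ∀ᵐ x : E n, x ≠ 0 := by simp [ae_iff]
  have hg0 : ∫ x, g x = 0 := by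
    have h0 := h 0
    rw [Real.fourier_eq'] at h0
    simpa [hn.ne'] using h0
  -- The symbol vanishes at `0`, so `g` has mean zero and `log (1 + |y|)` does not contribute.
  have hstep1 : ∫ x, logKernel x y • g x = ∫ x, (-Real.log ‖x - y‖) • g x := by
    have h1 : ∫ x, (-Real.log ‖x - y‖) • g x =
        ∫ x, (logKernel x y • g x - Real.log (1 + ‖y‖) • g x) := by
      refine integral_congr_ae ?_
      filter_upwards [hne] with x hx
      rw [logKernel_eq hx, ← sub_smul]; congr 1; ring
    have h2 : Integrable (fun x => Real.log (1 + ‖y‖) • g x) := g.integrable.fun_smul _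
    rw [h1, integral_sub (integrable_logKernel_smul_schwartz hn g y) h2,
      integral_smul, hg0, smul_zero, sub_zero]
  set m : E n → ℂ := fun ξ =>
    Complex.exp (2 * Real.pi * Complex.I * (inner ℝ y ξ : ℝ)) * 𝓕 (φ : E n → ℂ) ξ with hm
  have hFφ : Integrable (𝓕 (φ : E n → ℂ)) := by
    rw [← SchwartzMap.fourier_coe]; exact SchwartzMap.integrable _
  have hFc : Continuous (𝓕 (φ : E n → ℂ)) := by
    rw [← SchwartzMap.fourier_coe]; exact SchwartzMap.continuous _
  have hmc : Continuous m := by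
    simp only [hm]
    fun_prop
  have hmn : ∀ ξ, ‖m ξ‖ = ‖𝓕 (φ : E n → ℂ) ξ‖ := by
    intro ξ
    have : (2 * Real.pi * Complex.I * (inner ℝ y ξ : ℝ) : ℂ) =
        ((2 * Real.pi * inner ℝ y ξ : ℝ) : ℂ) * Complex.I := by push_cast; ring
    simp only [hm]
    rw [norm_mul, this, Complex.norm_exp_ofReal_mul_I, one_mul]
  have hmi : Integrable m :=
    hFφ.norm.mono' hmc.aestronglyMeasurable (.of_forall fun ξ => (hmn ξ).le)
  have hinv : ∫ ξ, m ξ = φ y := by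
    have h1 : 𝓕⁻ (𝓕 (φ : E n → ℂ)) y = φ y := by
      rw [φ.continuous.fourierInv_fourier_eq φ.integrable hFφ]
    rw [← h1, Real.fourierInv_eq']
    congr with ξ
    simp only [hm, smul_eq_mul]
    congr 2
    rw [real_inner_comm]
    push_cast; ring
  -- The density in `t` of the transformed Gaussians, times the symbol; its integral over `t` is the
  -- constant `2γ_n`, because `Γ(n/2) |ξ|^(-n)` cancels the symbol.
  set κ : E n → ℝ → ℝ := fun ξ t => (2 * Real.pi * ‖ξ‖) ^ n * (Real.pi ^ ((n : ℝ) / 2) *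
    (t ^ (-((n : ℝ) / 2) - 1) * Real.exp (-(Real.pi ^ 2 * ‖ξ‖ ^ 2 / t)))) with hκ
  have hκm : Measurable (fun z : E n × ℝ => κ z.1 z.2) := by
    simp only [hκ]; fun_prop
  have hκnn : ∀ ξ t, 0 < t → 0 ≤ κ ξ t := by
    intro ξ t ht; simp only [hκ]; positivity
  have hκint : ∀ ξ, ξ ≠ 0 → ∫ t in Ioi (0 : ℝ), κ ξ t = 2 * gammaConst n := by
    intro ξ hξ
    have hp : 0 < ‖ξ‖ := norm_pos_iff.2 hξ
    simp only [hκ]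
    rw [integral_const_mul, integral_const_mul,
      integral_rpow_mul_exp_neg_div (by positivity) (by positivity), gammaConst_eq hn]
    have e1 : (Real.pi ^ 2 * ‖ξ‖ ^ 2) ^ (-((n : ℝ) / 2)) = (Real.pi ^ n)⁻¹ * (‖ξ‖ ^ n)⁻¹ := by
      rw [← mul_pow, ← Real.rpow_natCast, ← Real.rpow_mul (by positivity),
        show ((2 : ℕ) : ℝ) * -((n : ℝ) / 2) = -(n : ℝ) by push_cast; ring,
        Real.rpow_neg (by positivity), Real.rpow_natCast, mul_pow, mul_inv]
    have e2 : (2 : ℝ) ^ n = 2 * 2 ^ (n - 1) := by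
      rw [← pow_succ', Nat.sub_add_cancel hn]
    rw [e1, mul_pow, mul_pow, e2]
    field_simp
  have hprod : Integrable (fun z : E n × ℝ => κ z.1 z.2 • m z.1)
      (volume.prod (volume.restrict (Ioi 0))) := by
    have hm : AEStronglyMeasurable (fun z : E n × ℝ => κ z.1 z.2 • m z.1)
        (volume.prod (volume.restrict (Ioi 0))) :=
      hκm.aestronglyMeasurable.smul (hmc.comp continuous_fst).aestronglyMeasurable
    rw [integrable_prod_iff hm]
    constructor
    · filter_upwards [hne0] with ξ hξ
      have hp : 0 < ‖ξ‖ := norm_pos_iff.2 hξ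
      refine Integrable.smul_const (c := m ξ) ?_
      exact ((integrableOn_rpow_mul_exp_neg_div (by positivity)
        (by positivity)).const_mul _).const_mul _
    · refine (hmi.norm.const_mul (2 * gammaConst n)).congr ?_
      filter_upwards [hne0] with ξ hξ
      simp only [norm_smul]
      rw [integral_mul_const, ← hκint ξ hξ]
      congr 1
      refine setIntegral_congr_fun measurableSet_Ioi fun t ht => ?_
      exact (Real.norm_of_nonneg (hκnn ξ t ht)).symm
  have hswap := integral_integral_swap (f := fun ξ t => κ ξ t • m ξ) hprod
  have hL : ∫ ξ, ∫ t in Ioi (0 : ℝ), κ ξ t • m ξ = (2 * gammaConst n) • φ y := by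
    rw [← hinv, ← integral_smul]
    refine integral_congr_ae ?_
    filter_upwards [hne0] with ξ hξ
    rw [integral_smul_const, hκint ξ hξ]
  rw [hstep1, integral_neg_log_smul_eq hn g hg0]
  have hR : ∫ t in Ioi (0 : ℝ), t⁻¹ • ∫ x, Real.exp (-(‖x - y‖ ^ 2 * t)) • g x =
      ∫ t in Ioi (0 : ℝ), ∫ ξ, κ ξ t • m ξ := by
    refine setIntegral_congr_fun measurableSet_Ioi fun t ht => ?_
    have ht : 0 < t := ht
    rw [integral_gaussian_smul_eq g y ht, ← integral_smul]
    congr with ξ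
    rw [h]
    simp only [hκ, hm, Complex.real_smul]
    have e3 : t⁻¹ * (Real.pi / t) ^ ((n : ℝ) / 2) = Real.pi ^ ((n : ℝ) / 2) *
        t ^ (-((n : ℝ) / 2) - 1) := by
      rw [Real.div_rpow hpi.le ht.le, Real.rpow_sub ht, Real.rpow_neg ht.le, Real.rpow_one]
      field_simp
    have e4 := congrArg (fun r : ℝ => (r : ℂ)) e3
    push_cast at e4 ⊢
    linear_combination (Complex.exp (-((Real.pi : ℂ) ^ 2 * (‖ξ‖ : ℂ) ^ 2 / (t : ℂ))) *
      (Complex.exp (2 * Real.pi * Complex.I * (inner ℝ y ξ : ℝ)) *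
        ((2 * Real.pi * ‖ξ‖) ^ n * 𝓕 (φ : E n → ℂ) ξ))) * e4
  rw [hR, ← hswap, hL, smul_smul]
  congr 1; ring

/-! ### The logarithmic potential solves the equation -/

lemma integrable_prod_logKernel_schwartz {n : ℕ} (hn : 0 < n) {f : E n → ℝ} (hf : Integrable f)
    (g : 𝓢(E n, ℂ)) :
    Integrable (fun z : E n × E n => (logKernel z.1 z.2 * f z.2) • g z.1) (volume.prod volume) := by
  obtain ⟨B, hB⟩ := schwartz_bounded g
  exact integrable_prod_logKernel hn hf g.integrable hB (integrable_log_mul_schwartz g)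

/-- `γ_n⁻¹ pot f` solves `(-Δ)^(n/2) v = f` when tested against Schwartz functions. -/
theorem integral_pot_smul {n : ℕ} (hn : 0 < n) {f : E n → ℝ} (hf : Integrable f) (φ g : 𝓢(E n, ℂ))
    (h : ∀ ξ, 𝓕 (g : E n → ℂ) ξ = (((2 * Real.pi * ‖ξ‖) ^ n : ℝ) : ℂ) * 𝓕 (φ : E n → ℂ) ξ) :
    ∫ x, pot f x • g x = gammaConst n • ∫ y, f y • φ y := by
  have hswap := integral_integral_swap (f := fun x y => (logKernel x y * f y) • g x)
    (integrable_prod_logKernel_schwartz hn hf g)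
  calc ∫ x, pot f x • g x = ∫ x, ∫ y, (logKernel x y * f y) • g x := by
        congr with x
        rw [integral_smul_const, pot]
    _ = ∫ y, ∫ x, (logKernel x y * f y) • g x := hswap
    _ = ∫ y, gammaConst n • (f y • φ y) := by
        congr with y
        have : ∀ x, (logKernel x y * f y) • g x = f y • (logKernel x y • g x) := by
          intro x; rw [mul_comm, mul_smul]
        simp_rw [this]
        rw [integral_smul, integral_logKernel_smul hn φ g h, smul_comm]
    _ = _ := integral_smul _ _

/-! ### Integer powers of the Laplacian on test functions -/

/-- The operator `-Δ` on complex Schwartz functions. -/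
def negLap (n : ℕ) : 𝓢(E n, ℂ) →L[ℂ] 𝓢(E n, ℂ) :=
  -(LineDeriv.laplacianCLM ℂ (E n) 𝓢(E n, ℂ))

lemma negLap_apply {n : ℕ} (φ : 𝓢(E n, ℂ)) (x : E n) : negLap n φ x = -(Δ (φ : E n → ℂ) x) := by
  rw [← SchwartzMap.laplacian_apply, ← SchwartzMap.laplacianCLM_eq ℂ]
  rfl

lemma fourier_negLap {n : ℕ} (φ : 𝓢(E n, ℂ)) (ξ : E n) :
    𝓕 (negLap n φ) ξ = (((2 * Real.pi * ‖ξ‖) ^ 2 : ℝ) : ℂ) * 𝓕 φ ξ := by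
  have h1 : negLap n φ = (2 * Real.pi) ^ 2 • SchwartzMap.fourierMultiplierCLM ℂ
      (fun ξ : E n => ‖ξ‖ ^ 2) φ := by
    have h2 : negLap n φ = -(Δ φ) := by
      rw [← SchwartzMap.laplacianCLM_eq ℂ]; rfl
    rw [h2, SchwartzMap.laplacian_eq_fourierMultiplierCLM, neg_smul, neg_neg]
  have hT : Function.HasTemperateGrowth (fun ξ : E n => ‖ξ‖ ^ 2) := by fun_prop
  rw [h1, FourierTransform.fourier_smul, SchwartzMap.fourierMultiplierCLM_apply,
    FourierTransform.fourier_fourierInv_eq, _root_.smul_apply,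
    SchwartzMap.smulLeftCLM_apply_apply hT, smul_smul, ← mul_pow, Complex.real_smul]

lemma fourier_negLap_pow {n : ℕ} (k : ℕ) (φ : 𝓢(E n, ℂ)) (ξ : E n) :
    𝓕 ((negLap n ^ k) φ) ξ = (((2 * Real.pi * ‖ξ‖) ^ (2 * k) : ℝ) : ℂ) * 𝓕 φ ξ := by
  induction k with
  | zero => simp
  | succ k ih =>
    have : (negLap n ^ (k + 1)) φ = negLap n ((negLap n ^ k) φ) := by
      rw [pow_succ']; rfl
    rw [this, fourier_negLap, ih, ← mul_assoc, ← Complex.ofReal_mul, ← pow_add]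
    congr 3; ring

lemma negLaplacianPow_succ {n k : ℕ} (φ : E n → ℝ) :
    negLaplacianPow n (k + 1) φ = fun x => -(Δ (negLaplacianPow n k φ) x) := by
  simp only [negLaplacianPow, Function.iterate_succ', Function.comp]

lemma exists_schwartz_negLaplacianPow {n : ℕ} (k : ℕ) (ψ : 𝓢(E n, ℝ)) (φ : 𝓢(E n, ℂ))
    (h : ∀ x, φ x = ψ x) :
    ∃ G : 𝓢(E n, ℝ), (∀ x, G x = negLaplacianPow n k ψ x) ∧
      ∀ x, (negLap n ^ k) φ x = (negLaplacianPow n k ψ x : ℂ) := by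
  induction k with
  | zero => exact ⟨ψ, fun x => rfl, fun x => by simpa [negLaplacianPow] using h x⟩
  | succ k ih =>
    obtain ⟨G, hG1, hG2⟩ := ih
    have hG1' : (G : E n → ℝ) = negLaplacianPow n k ψ := funext hG1
    refine ⟨-(Δ G), fun x => ?_, fun x => ?_⟩
    · rw [negLaplacianPow_succ, ← hG1', _root_.neg_apply, SchwartzMap.laplacian_apply]
    · have e1 : (negLap n ^ (k + 1)) φ = negLap n ((negLap n ^ k) φ) := by
        rw [pow_succ']; rfl
      have e2 : (((negLap n ^ k) φ : 𝓢(E n, ℂ)) : E n → ℂ) = Complex.ofRealCLM ∘ G := by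
        funext y; rw [hG2 y, ← hG1 y]; rfl
      rw [e1, negLap_apply, e2,
        ContDiffAt.laplacian_CLM_comp_left ((G.smooth 2).contDiffAt), negLaplacianPow_succ, ← hG1']
      simp

lemma tsupport_laplacian_subset {n : ℕ} (φ : E n → ℝ) :
    tsupport (fun x => -(Δ φ x)) ⊆ tsupport φ := by
  refine closure_minimal (fun x hx => ?_) (isClosed_tsupport _)
  by_contra h
  rw [notMem_tsupport_iff_eventuallyEq] at h
  have h1 := (InnerProductSpace.laplacian_congr_nhds h).eq_of_nhds
  have h2 : Δ (0 : E n → ℝ) x = 0 := by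
    have := InnerProductSpace.laplacian_const (E := E n) (F := ℝ) (c := 0)
    exact congrFun this x
  apply hx
  simp only [h1, h2, neg_zero]

lemma tsupport_negLaplacianPow_subset {n : ℕ} (k : ℕ) (φ : E n → ℝ) :
    tsupport (negLaplacianPow n k φ) ⊆ tsupport φ := by
  induction k with
  | zero => exact subset_rfl
  | succ k ih => rw [negLaplacianPow_succ]; exact (tsupport_laplacian_subset _).trans ih

lemma hasCompactSupport_negLaplacianPow {n : ℕ} (k : ℕ) {φ : E n → ℝ} (h : HasCompactSupport φ) :
    HasCompactSupport (negLaplacianPow n k φ) :=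
  h.of_isClosed_subset (isClosed_tsupport _) (tsupport_negLaplacianPow_subset k φ)

/-- A smooth compactly supported real function as a complex Schwartz function. -/
def toComplexSchwartz {n : ℕ} {φ : E n → ℝ} (h1 : ContDiff ℝ ∞ φ) (h2 : HasCompactSupport φ) :
    𝓢(E n, ℂ) :=
  HasCompactSupport.toSchwartzMap (f := fun x => (φ x : ℂ))
    (h2.comp_left (g := fun r : ℝ => (r : ℂ)) (by simp)) (Complex.ofRealCLM.contDiff.comp h1)

lemma toComplexSchwartz_apply {n : ℕ} {φ : E n → ℝ} (h1 : ContDiff ℝ ∞ φ)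
    (h2 : HasCompactSupport φ) (x : E n) : toComplexSchwartz h1 h2 x = φ x := rfl

lemma negLap_pow_toComplexSchwartz {n : ℕ} (k : ℕ) {φ : E n → ℝ} (h1 : ContDiff ℝ ∞ φ)
    (h2 : HasCompactSupport φ) (x : E n) :
    (negLap n ^ k) (toComplexSchwartz h1 h2) x = (negLaplacianPow n k φ x : ℂ) := by
  obtain ⟨G, -, hG⟩ := exists_schwartz_negLaplacianPow k (h2.toSchwartzMap h1)
    (toComplexSchwartz h1 h2) (fun x => rfl)
  exact hG x

lemma contDiff_negLaplacianPow {n : ℕ} (k : ℕ) {φ : E n → ℝ} (h1 : ContDiff ℝ ∞ φ)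
    (h2 : HasCompactSupport φ) : ContDiff ℝ ∞ (negLaplacianPow n k φ) := by
  obtain ⟨G, hG, -⟩ := exists_schwartz_negLaplacianPow k (h2.toSchwartzMap h1)
    (toComplexSchwartz h1 h2) (fun x => rfl)
  have : (G : E n → ℝ) = negLaplacianPow n k φ := funext hG
  rw [← this]
  exact G.smooth ⊤

/-- For even `n`, the difference of a solution and the logarithmic potential is polyharmonic. -/
lemma integral_sub_pot_mul_negLaplacianPow {n : ℕ} (hn : 0 < n) (he : Even n) {u f : E n → ℝ}
    (hf : Integrable f) (hu : IsSolution n n u f) {φ : E n → ℝ} (h1 : ContDiff ℝ ∞ φ)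
    (h2 : HasCompactSupport φ) :
    ∫ x, (u x - 1 / gammaConst n * pot f x) * negLaplacianPow n (n / 2) φ x = 0 := by
  obtain ⟨hul, hue⟩ := hu.1 he
  have hγ := gammaConst_pos hn
  set ψ := negLaplacianPow n (n / 2) φ with hψ
  have hψc : HasCompactSupport ψ := hasCompactSupport_negLaplacianPow _ h2
  have hψd : Continuous ψ := (contDiff_negLaplacianPow _ h1 h2).continuous
  have hi1 : Integrable (fun x => u x * ψ x) := by
    simpa [mul_comm] using hul.integrable_smul_left_of_hasCompactSupport hψd hψc
  have hi2 : Integrable (fun x => pot f x * ψ x) := by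
    simpa [mul_comm] using
      (locallyIntegrable_pot hn hf).integrable_smul_left_of_hasCompactSupport hψd hψc
  have hv := integral_pot_smul hn hf (toComplexSchwartz h1 h2)
    ((negLap n ^ (n / 2)) (toComplexSchwartz h1 h2)) (fun ξ => by
      have := fourier_negLap_pow (n / 2) (toComplexSchwartz h1 h2) ξ
      rwa [Nat.two_mul_div_two_of_even he] at this)
  simp only [negLap_pow_toComplexSchwartz, toComplexSchwartz_apply, Complex.real_smul,
    ← Complex.ofReal_mul] at hv
  rw [integral_complex_ofReal, integral_complex_ofReal, ← Complex.ofReal_mul,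
    Complex.ofReal_inj] at hv
  have : ∀ x, (u x - 1 / gammaConst n * pot f x) * ψ x =
      u x * ψ x - 1 / gammaConst n * (pot f x * ψ x) := fun x => by ring
  simp_rw [this]
  rw [integral_sub hi1 (hi2.const_mul _), integral_const_mul, hue φ h1 h2, hv]
  field_simp
  ring

/-! ### A bump function whose iterated Laplacian is positive near the boundary of its support -/

/-- The standard basis vectors of `ℝⁿ`. -/
def stdVec {n : ℕ} (i : Fin n) : E n := EuclideanSpace.basisFun (Fin n) ℝ i

lemma stdVec_apply {n : ℕ} (i j : Fin n) : (stdVec i : E n) j = if j = i then 1 else 0 := by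
  simp [stdVec]

lemma inner_stdVec {n : ℕ} (x : E n) (i : Fin n) : inner ℝ x (stdVec i) = x i := by
  have := EuclideanSpace.basisFun_inner (ι := Fin n) (𝕜 := ℝ) x i
  rw [real_inner_comm]; exact this

lemma laplacian_eq_sum_fderiv {n : ℕ} {h : E n → ℝ} (hh : ContDiff ℝ 2 h) (x : E n) :
    Δ h x = ∑ i, fderiv ℝ (fun y => fderiv ℝ h y (stdVec i)) x (stdVec i) := by
  rw [InnerProductSpace.laplacian_eq_iteratedFDeriv_orthonormalBasis h
    (EuclideanSpace.basisFun (Fin n) ℝ)]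
  refine Finset.sum_congr rfl fun i _ => ?_
  have hd : DifferentiableAt ℝ (fderiv ℝ h) x :=
    ((hh.fderiv_right (m := 1) (by norm_num)).differentiable (by norm_num)) x
  rw [iteratedFDeriv_two_apply, fderiv_clm_apply hd (by fun_prop)]
  simp [stdVec]

lemma laplacian_comp_one_sub_norm_sq {n : ℕ} {g g' g'' : ℝ → ℝ} (hg : ∀ t, HasDerivAt g (g' t) t)
    (hg' : ∀ t, HasDerivAt g' (g'' t) t) (h2 : ContDiff ℝ 2 g) (x : E n) :
    Δ (fun x : E n => g (1 - ‖x‖ ^ 2)) x =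
      4 * ‖x‖ ^ 2 * g'' (1 - ‖x‖ ^ 2) - 2 * n * g' (1 - ‖x‖ ^ 2) := by
  have hq : ∀ y : E n, HasFDerivAt (fun y : E n => 1 - ‖y‖ ^ 2) (-(2 • innerSL ℝ y)) y := by
    intro y
    have := (hasStrictFDerivAt_norm_sq y).hasFDerivAt.const_sub 1
    exact this
  have hc : ContDiff ℝ 2 (fun x : E n => g (1 - ‖x‖ ^ 2)) :=
    h2.comp (contDiff_const.sub (contDiff_norm_sq ℝ))
  rw [laplacian_eq_sum_fderiv hc]
  have hfirst : ∀ (i : Fin n) (y : E n), fderiv ℝ (fun x : E n => g (1 - ‖x‖ ^ 2)) y (stdVec i) =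
      g' (1 - ‖y‖ ^ 2) * (-2 * inner ℝ y (stdVec i)) := by
    intro i y
    have h : HasFDerivAt (fun x : E n => g (1 - ‖x‖ ^ 2)) _ y :=
      (hg _).comp_hasFDerivAt y (hq y)
    rw [h.fderiv]
    simp
  have hsecond : ∀ i : Fin n, fderiv ℝ (fun y : E n => fderiv ℝ (fun x : E n => g (1 - ‖x‖ ^ 2)) y
      (stdVec i)) x (stdVec i) =
      4 * g'' (1 - ‖x‖ ^ 2) * (x i) ^ 2 - 2 * g' (1 - ‖x‖ ^ 2) := by
    intro i
    simp_rw [hfirst i]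
    have hl : HasFDerivAt (fun y : E n => -2 * inner ℝ y (stdVec i))
        ((-2 : ℝ) • innerSL ℝ (stdVec i)) x := by
      have : HasFDerivAt (fun y : E n => innerSL ℝ (stdVec i) y) (innerSL ℝ (stdVec i)) x :=
        (innerSL ℝ (stdVec i)).hasFDerivAt
      have h3 := this.const_mul (-2 : ℝ)
      refine h3.congr_of_eventuallyEq (.of_forall fun y => ?_)
      simp only [innerSL_apply_apply, real_inner_comm]
    have hm : HasFDerivAt (fun y : E n => g' (1 - ‖y‖ ^ 2) * (-2 * inner ℝ y (stdVec i))) _ x :=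
      ((hg' _).comp_hasFDerivAt x (hq x)).mul hl
    rw [hm.fderiv]
    have h1 : inner ℝ (stdVec i) (stdVec i : E n) = (1 : ℝ) := by
      rw [inner_stdVec, stdVec_apply]; simp
    simp only [add_apply, smul_apply, innerSL_apply_apply, smul_eq_mul, neg_apply, Function.comp]
    rw [h1, inner_stdVec]
    simp
    ring
  simp_rw [hsecond]
  rw [Finset.sum_sub_distrib, ← Finset.mul_sum, EuclideanSpace.norm_sq_eq]
  simp
  ring

open Polynomial in
/-- The effect on `P` of the Laplacian on `x ↦ P (1 / (1 - |x|²)) e^(-1/(1 - |x|²))`. -/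
def bumpStep (n : ℕ) (P : ℝ[X]) : ℝ[X] :=
  C 4 * ((X - 1) * (X * (X ^ 2 * (P - derivative P) - derivative (X ^ 2 * (P - derivative P))))) -
    C (2 * (n : ℝ)) * (X ^ 2 * (P - derivative P))

/-- The function `x ↦ P (1 / (1 - |x|²)) e^(-1/(1 - |x|²))`, extended by zero. -/
def bumpFun (n : ℕ) (P : Polynomial ℝ) (x : E n) : ℝ :=
  P.eval (1 - ‖x‖ ^ 2)⁻¹ * expNegInvGlue (1 - ‖x‖ ^ 2)

lemma contDiff_bumpFun (n : ℕ) (P : Polynomial ℝ) : ContDiff ℝ ∞ (bumpFun n P) :=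
  (expNegInvGlue.contDiff_polynomial_eval_inv_mul P).comp
    (contDiff_const.sub (contDiff_norm_sq ℝ))

lemma bumpFun_eq_zero {n : ℕ} (P : Polynomial ℝ) {x : E n} (hx : 1 ≤ ‖x‖) : bumpFun n P x = 0 := by
  rw [bumpFun, expNegInvGlue.zero_of_nonpos (by nlinarith), mul_zero]

lemma hasCompactSupport_bumpFun (n : ℕ) (P : Polynomial ℝ) : HasCompactSupport (bumpFun n P) := by
  refine HasCompactSupport.intro (isCompact_closedBall (0 : E n) 1) fun x hx => ?_
  refine bumpFun_eq_zero P ?_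
  simp only [mem_closedBall, dist_zero_right, not_le] at hx
  exact hx.le

lemma laplacian_bumpFun (n : ℕ) (P : Polynomial ℝ) (x : E n) :
    Δ (bumpFun n P) x = bumpFun n (bumpStep n P) x := by
  have h1 := expNegInvGlue.hasDerivAt_polynomial_eval_inv_mul P
  have h2 := expNegInvGlue.hasDerivAt_polynomial_eval_inv_mul
    (Polynomial.X ^ 2 * (P - Polynomial.derivative P))
  have h3 := laplacian_comp_one_sub_norm_sq h1 h2
    (expNegInvGlue.contDiff_polynomial_eval_inv_mul (n := (2 : ℕ)) P) x
  rw [show bumpFun n P =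
      fun x : E n => P.eval (1 - ‖x‖ ^ 2)⁻¹ * expNegInvGlue (1 - ‖x‖ ^ 2) from rfl,
    h3, bumpFun, bumpStep]
  set t := 1 - ‖x‖ ^ 2 with ht
  have hx2 : ‖x‖ ^ 2 = 1 - t := by rw [ht]; ring
  rw [hx2]
  rcases eq_or_ne t 0 with h0 | h0
  · simp [h0]
  simp only [Polynomial.eval_sub, Polynomial.eval_mul, Polynomial.eval_C, Polynomial.eval_X,
    Polynomial.eval_pow, Polynomial.eval_one]
  field_simp

open Polynomial in
lemma bumpStep_leadingCoeff_pos (n : ℕ) {P : ℝ[X]} (hP : 0 < P.leadingCoeff) :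
    0 < (bumpStep n P).leadingCoeff := by
  have hsub : ∀ {Q : ℝ[X]}, 0 < Q.leadingCoeff →
      (Q - derivative Q).leadingCoeff = Q.leadingCoeff ∧ (Q - derivative Q).degree = Q.degree := by
    intro Q hQ
    have hQ0 : Q ≠ 0 := by rintro rfl; simp at hQ
    have := degree_derivative_lt hQ0
    exact ⟨leadingCoeff_sub_of_degree_lt this, degree_sub_eq_left_of_degree_lt this⟩
  have hQ : 0 < (X ^ 2 * (P - derivative P)).leadingCoeff := by
    rw [leadingCoeff_mul, leadingCoeff_X_pow, one_mul, (hsub hP).1]; exact hP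
  unfold bumpStep
  set Q := X ^ 2 * (P - derivative P) with hQdef
  have hQ0 : Q ≠ 0 := by rintro h; rw [h] at hQ; simp at hQ
  obtain ⟨h1, h2⟩ := hsub hQ
  have hX1 : ((X : ℝ[X]) - 1) = X - C 1 := by simp
  have hdeg : (C (2 * (n : ℝ)) * Q).degree <
      (C 4 * ((X - 1) * (X * (Q - derivative Q)))).degree := by
    rw [degree_C_mul (a := 4) (by norm_num), degree_mul (p := X - 1), degree_mul (p := X), hX1,
      degree_X_sub_C, degree_X, h2]
    refine lt_of_le_of_lt ((degree_mul_le _ _).trans (add_le_of_nonpos_left degree_C_le)) ?_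
    rw [degree_eq_natDegree hQ0]
    norm_cast
    omega
  rw [leadingCoeff_sub_of_degree_lt hdeg, leadingCoeff_mul, leadingCoeff_mul, leadingCoeff_mul,
    leadingCoeff_C, hX1, leadingCoeff_X_sub_C, leadingCoeff_X, h1]
  linarith

/-- Every iterated Laplacian of `e^(-1/(1-|x|²))` is, up to the sign `(-1)^k`, of the form
`bumpFun n P` with a positive leading coefficient, hence positive near the unit sphere. -/
lemma exists_bump_negLaplacianPow (n k : ℕ) :
    ∃ P : Polynomial ℝ, 0 < P.leadingCoeff ∧
      negLaplacianPow n k (bumpFun n 1) = fun x => (-1) ^ k * bumpFun n P x := by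
  induction k with
  | zero => exact ⟨1, by simp, by funext x; simp [negLaplacianPow]⟩
  | succ k ih =>
    obtain ⟨P, hP, h⟩ := ih
    refine ⟨bumpStep n P, bumpStep_leadingCoeff_pos n hP, ?_⟩
    funext x
    rw [negLaplacianPow_succ, h]
    have : (fun x => (-1 : ℝ) ^ k * bumpFun n P x) = ((-1 : ℝ) ^ k) • bumpFun n P := rfl
    rw [this]
    have h2 : ContDiffAt ℝ 2 (bumpFun n P) x :=
      (contDiff_infty.1 (contDiff_bumpFun n P) 2).contDiffAt
    simp only
    rw [InnerProductSpace.laplacian_smul _ h2, laplacian_bumpFun, pow_succ]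
    simp

lemma exists_bumpFun_pos {P : Polynomial ℝ} (hP : 0 < P.leadingCoeff) :
    ∃ r : ℝ, 0 < r ∧ r < 1 ∧ ∀ (n : ℕ) (x : E n), r ≤ ‖x‖ → ‖x‖ < 1 → 0 < bumpFun n P x := by
  have hev : ∀ᶠ z in atTop, 0 < P.eval z := by
    rcases Nat.eq_zero_or_pos P.natDegree with h0 | h0
    · rw [Polynomial.eq_C_of_natDegree_eq_zero h0] at hP ⊢
      refine .of_forall fun z => ?_
      simpa using hP
    · exact (P.tendsto_atTop_of_leadingCoeff_nonneg
        (Polynomial.natDegree_pos_iff_degree_pos.1 h0) hP.le).eventually_gt_atTop 0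
  obtain ⟨Z, hZ⟩ := eventually_atTop.1 hev
  set z := max Z 2 with hz
  have hz2 : 2 ≤ z := le_max_right _ _
  refine ⟨1 - (2 * z)⁻¹, ?_, ?_, fun n x hx hx1 => ?_⟩
  · have : (2 * z)⁻¹ ≤ (2 * 2)⁻¹ := by gcongr
    linarith
  · have : 0 < (2 * z)⁻¹ := by positivity
    linarith
  · have ht : 0 < 1 - ‖x‖ ^ 2 := by nlinarith [norm_nonneg x]
    have ht2 : 1 - ‖x‖ ^ 2 ≤ z⁻¹ := by
      have : (2 * z)⁻¹ = z⁻¹ / 2 := by rw [mul_inv]; ring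
      nlinarith [norm_nonneg x]
    refine mul_pos (hZ _ ?_) (expNegInvGlue.pos_of_pos ht)
    calc Z ≤ z := le_max_left _ _
      _ = (z⁻¹)⁻¹ := (inv_inv z).symm
      _ ≤ _ := by gcongr

/-! ### Polyharmonic functions bounded above on average are tempered -/

lemma laplacian_comp_smul {n : ℕ} {h : E n → ℝ} (hh : ContDiff ℝ 2 h) (c : ℝ) (x : E n) :
    Δ (fun y => h (c • y)) x = c ^ 2 * Δ h (c • x) := by
  have hc : ContDiff ℝ 2 (fun y => h (c • y)) := hh.comp (contDiff_const_smul c)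
  rw [laplacian_eq_sum_fderiv hc, laplacian_eq_sum_fderiv hh, Finset.mul_sum]
  refine Finset.sum_congr rfl fun i _ => ?_
  have h1 : ∀ y, fderiv ℝ (fun y => h (c • y)) y (stdVec i) =
      c * fderiv ℝ h (c • y) (stdVec i) := by
    intro y
    rw [fderiv_comp_smul]
    rfl
  simp_rw [h1]
  have hd : Differentiable ℝ (fun y => fderiv ℝ h y (stdVec i)) :=
    ((hh.fderiv_right (m := 1) (by norm_num)).differentiable (by norm_num)).clm_apply
      (differentiable_const _)
  have hd2 : DifferentiableAt ℝ (fun y => fderiv ℝ h (c • y) (stdVec i)) x :=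
    (hd.comp (differentiable_id.const_smul c)) x
  rw [fderiv_const_mul hd2]
  have := fderiv_comp_smul (𝕜 := ℝ) (f := fun y => fderiv ℝ h y (stdVec i)) (c := c) (x := x)
  rw [this]
  simp only [smul_apply, smul_eq_mul]
  ring

lemma negLaplacianPow_comp_smul {n : ℕ} (k : ℕ) {φ : E n → ℝ} (h1 : ContDiff ℝ ∞ φ)
    (h2 : HasCompactSupport φ) (c : ℝ) (x : E n) :
    negLaplacianPow n k (fun y => φ (c • y)) x = (c ^ 2) ^ k * negLaplacianPow n k φ (c • x) := by
  induction k generalizing x with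
  | zero => simp [negLaplacianPow]
  | succ k ih =>
    have hc : ContDiff ℝ 2 (negLaplacianPow n k φ) :=
      contDiff_infty.1 (contDiff_negLaplacianPow k h1 h2) 2
    have hc2 : ContDiff ℝ 2 (fun y => negLaplacianPow n k φ (c • y)) :=
      hc.comp (contDiff_const_smul c)
    rw [negLaplacianPow_succ, negLaplacianPow_succ]
    have : negLaplacianPow n k (fun y => φ (c • y)) =
        ((c ^ 2) ^ k) • (fun y => negLaplacianPow n k φ (c • y)) := funext ih
    simp only
    rw [this, InnerProductSpace.laplacian_smul _ hc2.contDiffAt, laplacian_comp_smul hc]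
    simp only [smul_eq_mul]
    ring

/-- A locally integrable function whose mass on the balls of radius `l ^ j` grows geometrically in
`j` is integrable against a negative power of `1 + |x|`. -/
lemma integrable_mul_rpow_of_geometric {n : ℕ} {w : E n → ℝ} (hw : LocallyIntegrable w) {l D Q : ℝ}
    (hl : 1 < l) (hQ : 0 < Q) (hD : 0 ≤ D)
    (h : ∀ j : ℕ, ∫ x in ball (0 : E n) (l ^ j), |w x| ≤ D * Q ^ j) :
    ∃ N : ℕ, Integrable (fun x => |w x| * (1 + ‖x‖) ^ (-(N : ℝ))) := by
  have hl0 : 0 < l := by linarith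
  obtain ⟨N, hN⟩ := pow_unbounded_of_one_lt (2 * Q) hl
  refine ⟨N, ?_⟩
  have hwm : AEStronglyMeasurable w := hw.aestronglyMeasurable
  have hm : AEStronglyMeasurable (fun x : E n => |w x| * (1 + ‖x‖) ^ (-(N : ℝ))) := by
    have : Measurable (fun x : E n => (1 + ‖x‖) ^ (-(N : ℝ))) :=
      (by fun_prop : Measurable fun x : E n => 1 + ‖x‖).pow_const _
    exact hwm.norm.mul this.aestronglyMeasurable
  refine ⟨hm, ?_⟩
  set a : ℕ → ENNReal := fun j => ENNReal.ofReal (l ^ N * (l ^ N)⁻¹ ^ j) with ha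
  have hpt : ∀ x : E n, ‖|w x| * (1 + ‖x‖) ^ (-(N : ℝ))‖ₑ ≤
      ∑' j, a j * (ball (0 : E n) (l ^ j)).indicator (fun x => ‖w x‖ₑ) x := by
    intro x
    have hex : ∃ j : ℕ, ‖x‖ < l ^ j := pow_unbounded_of_one_lt _ hl
    classical
    set j := Nat.find hex with hj
    have hjlt : ‖x‖ < l ^ j := Nat.find_spec hex
    have hkey : (1 + ‖x‖) ^ (-(N : ℝ)) ≤ l ^ N * (l ^ N)⁻¹ ^ j := by
      rw [Real.rpow_neg (by positivity), Real.rpow_natCast]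
      rcases Nat.eq_zero_or_pos j with h0 | h0
      · rw [h0, pow_zero, mul_one]
        calc ((1 + ‖x‖) ^ N)⁻¹ ≤ 1 :=
              inv_le_one_of_one_le₀ (one_le_pow₀ (by linarith [norm_nonneg x]))
          _ ≤ l ^ N := one_le_pow₀ hl.le
      · have h1 : l ^ (j - 1) ≤ ‖x‖ := by
          have := Nat.find_min hex (m := j - 1) (by omega)
          linarith [not_lt.1 this]
        have h2 : l ^ N * (l ^ N)⁻¹ ^ j = ((l ^ (j - 1)) ^ N)⁻¹ := by
          obtain ⟨i, hi⟩ := Nat.exists_eq_succ_of_ne_zero h0.ne'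
          rw [hi, Nat.succ_sub_one, pow_succ, ← pow_mul, mul_comm i N, pow_mul, inv_pow]
          field_simp
        rw [h2]
        gcongr
        linarith
    refine le_trans ?_ (ENNReal.le_tsum j)
    rw [indicator_of_mem (by simpa using hjlt), enorm_mul, mul_comm]
    gcongr
    · rw [Real.enorm_of_nonneg (by positivity)]
      exact ENNReal.ofReal_le_ofReal hkey
    · rw [← Real.norm_eq_abs, enorm_norm]
  have hball : ∀ j : ℕ, ∫⁻ x, (ball (0 : E n) (l ^ j)).indicator (fun x => ‖w x‖ₑ) x ≤
      ENNReal.ofReal (D * Q ^ j) := by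
    intro j
    rw [lintegral_indicator measurableSet_ball]
    have hi : IntegrableOn w (ball (0 : E n) (l ^ j)) :=
      (hw.integrableOn_isCompact (isCompact_closedBall 0 (l ^ j))).mono_set ball_subset_closedBall
    rw [← ofReal_integral_norm_eq_lintegral_enorm hi]
    exact ENNReal.ofReal_le_ofReal (h j)
  calc ∫⁻ x, ‖|w x| * (1 + ‖x‖) ^ (-(N : ℝ))‖ₑ
      ≤ ∫⁻ x, ∑' j, a j * (ball (0 : E n) (l ^ j)).indicator (fun x => ‖w x‖ₑ) x :=
        lintegral_mono hpt
    _ = ∑' j, a j * ∫⁻ x, (ball (0 : E n) (l ^ j)).indicator (fun x => ‖w x‖ₑ) x := by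
        have hmj : ∀ j : ℕ, AEMeasurable
            (fun x => (ball (0 : E n) (l ^ j)).indicator (fun x => ‖w x‖ₑ) x) :=
          fun j => hwm.enorm.indicator measurableSet_ball
        rw [lintegral_tsum fun j => (hmj j).const_mul _]
        refine tsum_congr fun j => ?_
        rw [lintegral_const_mul'' _ (hmj j)]
    _ ≤ ∑' j : ℕ, ENNReal.ofReal (l ^ N * D * (1 / 2) ^ j) := by
        refine ENNReal.tsum_le_tsum fun j => ?_
        refine (mul_le_mul_right (hball j) _).trans ?_
        rw [ha, ← ENNReal.ofReal_mul (by positivity)]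
        refine ENNReal.ofReal_le_ofReal ?_
        have : (l ^ N)⁻¹ ^ j * Q ^ j ≤ (1 / 2) ^ j := by
          rw [← mul_pow]
          gcongr
          rw [inv_mul_le_iff₀ (by positivity)]
          linarith
        calc l ^ N * (l ^ N)⁻¹ ^ j * (D * Q ^ j) = l ^ N * D * ((l ^ N)⁻¹ ^ j * Q ^ j) := by ring
          _ ≤ _ := by gcongr
    _ < ⊤ := by
        have hs : Summable (fun j : ℕ => l ^ N * D * (1 / 2 : ℝ) ^ j) :=
          summable_geometric_two.mul_left _
        rw [← ENNReal.ofReal_tsum_of_nonneg (fun j => by positivity) hs]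
        exact ENNReal.ofReal_lt_top

/-- A polyharmonic function whose positive part grows polynomially in the mean is tempered. Testing
with an iterated Laplacian that is positive near the unit sphere, at scale `ρ`, bounds the negative
part on `|x| < r'ρ` by the positive part on `|x| < ρ` and the negative part on `|x| < rρ`, `r < r'`.
Iterating this over the radii `(r'/r)^j` gives polynomial growth of the negative part. -/
theorem polyharmonic_tempered {n k : ℕ} {w : E n → ℝ} (hw : LocallyIntegrable w)
    (hharm : ∀ φ : E n → ℝ, ContDiff ℝ ∞ φ → HasCompactSupport φ →
      ∫ x, w x * negLaplacianPow n k φ x = 0)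
    {B : ℝ} {d : ℕ} (hB : 0 ≤ B)
    (hplus : ∀ ρ : ℝ, 1 ≤ ρ → ∫ x in ball (0 : E n) ρ, max (w x) 0 ≤ B * ρ ^ d) :
    ∃ N : ℕ, Integrable (fun x => |w x| * (1 + ‖x‖) ^ (-(N : ℝ))) := by
  obtain ⟨P, hP, hPk⟩ := exists_bump_negLaplacianPow n k
  obtain ⟨r, hr0, hr1, hpos⟩ := exists_bumpFun_pos hP
  replace hpos := hpos n
  set r' := (r + 1) / 2 with hr'
  have hrr' : r < r' := by rw [hr']; linarith
  have hr'1 : r' < 1 := by rw [hr']; linarith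
  have hψc : Continuous (bumpFun n P) := (contDiff_bumpFun n P).continuous
  obtain ⟨C, hC⟩ := hψc.bounded_above_of_compact_support (hasCompactSupport_bumpFun n P)
  have hC0 : 0 ≤ C := (norm_nonneg _).trans (hC 0)
  have hann : IsCompact (closedBall (0 : E n) r' \ ball 0 r) :=
    (isCompact_closedBall _ _).diff isOpen_ball
  obtain ⟨c, hc0, hc⟩ := hann.exists_forall_le' (f := bumpFun n P) (a := 0) hψc.continuousOn
    (fun x hx => by
      simp only [Set.mem_sdiff, mem_closedBall, dist_zero_right, mem_ball, not_lt] at hx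
      exact hpos x hx.2 (by linarith [hx.1]))
  -- The test function is at least `c` on `r ≤ |x| < r'`, nonnegative outside, and at least `-C`
  -- inside.
  have hptw : ∀ x : E n, c * (ball (0 : E n) r').indicator 1 x ≤
      bumpFun n P x + (C + c) * (ball (0 : E n) r).indicator 1 x := by
    intro x
    rcases lt_or_ge ‖x‖ r with h1 | h1
    · rw [indicator_of_mem (s := ball (0 : E n) r) (by simpa using h1),
        indicator_of_mem (by simpa using h1.trans hrr')]
      have := (abs_le.1 (hC x)).1
      simp only [Pi.one_apply]; linarith
    rw [indicator_of_notMem (s := ball (0 : E n) r) (by simpa using h1)]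
    rcases lt_or_ge ‖x‖ r' with h2 | h2
    · rw [indicator_of_mem (by simpa using h2)]
      have := hc x (by simpa using ⟨h2.le, h1⟩)
      simp only [Pi.one_apply]; linarith
    rw [indicator_of_notMem (by simpa using h2)]
    rcases lt_or_ge ‖x‖ 1 with h3 | h3
    · have := hpos x h1 h3; linarith
    · rw [bumpFun_eq_zero P h3]; simp
  set wp : E n → ℝ := fun x => max (w x) 0 with hwp
  set wm : E n → ℝ := fun x => max (-w x) 0 with hwm
  have hwpl : LocallyIntegrable wp := by
    refine hw.mono (hw.aestronglyMeasurable.sup aestronglyMeasurable_const) (.of_forall fun x => ?_)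
    rw [Real.norm_of_nonneg (le_max_right _ _), Real.norm_eq_abs]
    exact max_le (le_abs_self _) (abs_nonneg _)
  have hwml : LocallyIntegrable wm := by
    refine hw.mono (hw.aestronglyMeasurable.neg.sup aestronglyMeasurable_const)
      (.of_forall fun x => ?_)
    rw [Real.norm_of_nonneg (le_max_right _ _), Real.norm_eq_abs]
    exact max_le (neg_le_abs _) (abs_nonneg _)
  have hon : ∀ {g : E n → ℝ}, LocallyIntegrable g → ∀ s : ℝ, IntegrableOn g (ball (0 : E n) s) :=
    fun hg s =>
      (hg.integrableOn_isCompact (isCompact_closedBall 0 s)).mono_set ball_subset_closedBall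
  set M : ℝ → ℝ := fun s => ∫ x in ball (0 : E n) s, wm x with hM
  have hstep : ∀ ρ : ℝ, 1 ≤ ρ → c * M (r' * ρ) ≤ C * (B * ρ ^ d) + (C + c) * M (r * ρ) := by
    intro ρ hρ
    have hρ0 : 0 < ρ := by linarith
    set ψ : E n → ℝ := fun x => bumpFun n P (ρ⁻¹ • x) with hψ
    have hψcont : Continuous ψ := hψc.comp (continuous_const_smul _)
    have hψsupp : HasCompactSupport ψ :=
      (hasCompactSupport_bumpFun n P).comp_smul (inv_ne_zero hρ0.ne')
    have hzero : ∫ x, w x * ψ x = 0 := by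
      have h1 : ContDiff ℝ ∞ (fun x : E n => bumpFun n 1 (ρ⁻¹ • x)) :=
        (contDiff_bumpFun n 1).comp (contDiff_const_smul _)
      have h2 : HasCompactSupport (fun x : E n => bumpFun n 1 (ρ⁻¹ • x)) :=
        (hasCompactSupport_bumpFun n 1).comp_smul (inv_ne_zero hρ0.ne')
      have h3 := hharm _ h1 h2
      have h4 : ∀ x, w x * negLaplacianPow n k (fun x : E n => bumpFun n 1 (ρ⁻¹ • x)) x =
          ((ρ⁻¹ ^ 2) ^ k * (-1) ^ k) * (w x * ψ x) := by
        intro x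
        rw [negLaplacianPow_comp_smul k (contDiff_bumpFun n 1) (hasCompactSupport_bumpFun n 1), hPk]
        ring
      simp_rw [h4] at h3
      rw [integral_const_mul] at h3
      refine (mul_eq_zero.1 h3).resolve_left ?_
      positivity
    have hip : Integrable (fun x => wp x * ψ x) := by
      simpa [mul_comm] using hwpl.integrable_smul_left_of_hasCompactSupport hψcont hψsupp
    have him : Integrable (fun x => wm x * ψ x) := by
      simpa [mul_comm] using hwml.integrable_smul_left_of_hasCompactSupport hψcont hψsupp
    have heq : ∫ x, wm x * ψ x = ∫ x, wp x * ψ x := by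
      have h5 : ∀ x, w x * ψ x = wp x * ψ x - wm x * ψ x := by
        intro x
        have : w x = wp x - wm x := by
          simp only [hwp, hwm]
          rcases le_total (w x) 0 with h | h
          · rw [max_eq_right h, max_eq_left (by linarith)]; ring
          · rw [max_eq_left h, max_eq_right (by linarith)]; ring
        rw [this]; ring
      simp_rw [h5] at hzero
      rw [integral_sub hip him] at hzero
      linarith
    have hupper : ∫ x, wp x * ψ x ≤ C * (B * ρ ^ d) := by
      calc ∫ x, wp x * ψ x ≤ ∫ x, (ball (0 : E n) ρ).indicator (fun x => C * wp x) x := by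
            refine integral_mono hip
              ((integrable_indicator_iff measurableSet_ball).2 ((hon hwpl ρ).const_mul C))
              fun x => ?_
            by_cases hx : x ∈ ball (0 : E n) ρ
            · simp only [indicator_of_mem hx]
              rw [mul_comm]
              have : 0 ≤ wp x := le_max_right _ _
              gcongr
              exact (le_abs_self _).trans (hC _)
            · simp only [indicator_of_notMem hx]
              simp only [mem_ball, dist_zero_right, not_lt] at hx
              have : 1 ≤ ‖ρ⁻¹ • x‖ := by
                rw [norm_smul, norm_inv, Real.norm_of_nonneg hρ0.le, inv_mul_eq_div,
                  le_div_iff₀ hρ0]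
                linarith
              simp only [hψ]
              rw [bumpFun_eq_zero P this, mul_zero]
        _ = C * ∫ x in ball (0 : E n) ρ, wp x := by
            rw [integral_indicator measurableSet_ball, integral_const_mul]
        _ ≤ _ := by gcongr; exact hplus ρ hρ
    have hind : ∀ (s : ℝ), 0 < s → ∀ x : E n,
        (ball (0 : E n) s).indicator (1 : E n → ℝ) (ρ⁻¹ • x) * wm x =
        (ball (0 : E n) (s * ρ)).indicator wm x := by
      intro s hs x
      have hiff : ρ⁻¹ • x ∈ ball (0 : E n) s ↔ x ∈ ball (0 : E n) (s * ρ) := by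
        simp only [mem_ball, dist_zero_right, norm_smul, norm_inv, Real.norm_of_nonneg hρ0.le]
        rw [inv_mul_eq_div, div_lt_iff₀ hρ0]
      by_cases hx : x ∈ ball (0 : E n) (s * ρ)
      · rw [indicator_of_mem hx, indicator_of_mem (hiff.2 hx)]; simp
      · rw [indicator_of_notMem hx, indicator_of_notMem (fun h => hx (hiff.1 h))]; simp
    have hlower : c * M (r' * ρ) ≤ (∫ x, wm x * ψ x) + (C + c) * M (r * ρ) := by
      have hi1 : Integrable ((ball (0 : E n) (r' * ρ)).indicator wm) :=
        (integrable_indicator_iff measurableSet_ball).2 (hon hwml _)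
      have hi2 : Integrable ((ball (0 : E n) (r * ρ)).indicator wm) :=
        (integrable_indicator_iff measurableSet_ball).2 (hon hwml _)
      simp only [hM]
      rw [← integral_indicator measurableSet_ball, ← integral_indicator measurableSet_ball,
        ← integral_const_mul, ← integral_const_mul, ← integral_add him (hi2.const_mul _)]
      refine integral_mono (hi1.const_mul _) (him.add (hi2.const_mul _)) fun x => ?_
      rw [← hind r' (by linarith), ← hind r hr0]
      have h6 := hptw (ρ⁻¹ • x)
      have h7 : 0 ≤ wm x := le_max_right _ _
      calc c * ((ball (0 : E n) r').indicator 1 (ρ⁻¹ • x) * wm x)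
          = (c * (ball (0 : E n) r').indicator 1 (ρ⁻¹ • x)) * wm x := by ring
        _ ≤ (bumpFun n P (ρ⁻¹ • x) +
            (C + c) * (ball (0 : E n) r).indicator 1 (ρ⁻¹ • x)) * wm x := by
            gcongr
        _ = _ := by simp only [hψ]; ring
    linarith
  -- Both radii `r ρ` and `r' ρ` are powers of `l` when `ρ = l ^ j / r`.
  set l := r' / r with hl
  have hl1 : 1 < l := by rw [hl, one_lt_div hr0]; exact hrr'
  have hl0 : 0 < l := by linarith
  have hM0 : ∀ s, 0 ≤ M s := fun s => integral_nonneg fun x => le_max_right _ _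
  set A := (C + c) / c with hA
  set B' := C * B / (c * r ^ d) with hB'
  have hA0 : 0 ≤ A := by positivity
  have hB'0 : 0 ≤ B' := by positivity
  have hrec : ∀ j : ℕ, M (l ^ (j + 1)) ≤ A * M (l ^ j) + B' * (l ^ d) ^ j := by
    intro j
    have hlj : 1 ≤ l ^ j := one_le_pow₀ hl1.le
    have h1 := hstep (l ^ j / r) (by rw [le_div_iff₀ hr0]; linarith)
    have e1 : r' * (l ^ j / r) = l ^ (j + 1) := by rw [pow_succ, hl]; ring
    have e2 : r * (l ^ j / r) = l ^ j := by field_simp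
    rw [e1, e2, div_pow (l ^ j) r d] at h1
    have e3 : (l ^ j) ^ d = (l ^ d) ^ j := by rw [← pow_mul, ← pow_mul, mul_comm]
    rw [e3] at h1
    calc M (l ^ (j + 1)) = (c * M (l ^ (j + 1))) / c := by field_simp
      _ ≤ (C * (B * ((l ^ d) ^ j / r ^ d)) + (C + c) * M (l ^ j)) / c := by gcongr
      _ = _ := by rw [hA, hB']; field_simp; ring
  set Q := A + 1 + l ^ d with hQ
  have hld : 0 < l ^ d := by positivity
  have hgeo : ∀ j : ℕ, M (l ^ j) ≤ (M 1 + B') * Q ^ j := by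
    intro j
    induction j with
    | zero => simpa using hB'0
    | succ j ih =>
      have h0 := hM0 1
      calc M (l ^ (j + 1)) ≤ A * M (l ^ j) + B' * (l ^ d) ^ j := hrec j
        _ ≤ A * ((M 1 + B') * Q ^ j) + (M 1 + B') * Q ^ j := by
            gcongr
            · linarith
            · linarith
        _ = (M 1 + B') * Q ^ j * (A + 1) := by ring
        _ ≤ (M 1 + B') * Q ^ j * Q := by
            gcongr
            linarith
        _ = _ := by ring
  refine integrable_mul_rpow_of_geometric hw (l := l) (D := M 1 + B' + B) (Q := Q) hl1
    (by positivity) (by have := hM0 1; positivity) fun j => ?_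
  have habs : ∀ x, |w x| = wp x + wm x := by
    intro x
    simp only [hwp, hwm]
    rcases le_total (w x) 0 with h | h
    · rw [max_eq_right h, max_eq_left (by linarith), abs_of_nonpos h]; ring
    · rw [max_eq_left h, max_eq_right (by linarith), abs_of_nonneg h]; ring
  simp_rw [habs]
  rw [integral_add (hon hwpl _) (hon hwml _)]
  have h1 := hplus (l ^ j) (one_le_pow₀ hl1.le)
  have h2 := hgeo j
  have h3 : (l ^ j) ^ d ≤ Q ^ j := by
    rw [← pow_mul, mul_comm, pow_mul]; gcongr; linarith
  have h4 : B * (l ^ j) ^ d ≤ B * Q ^ j := by gcongr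
  simp only [hM] at h2 ⊢
  linarith

/-! ### Tempered functionals and cutoffs -/

/-- A function vanishing on the unit ball, dilated to vanish on `|x| < j + 1`, multiplies a Schwartz
function to one of small seminorms: one power of `|x| ≥ j + 1` is spared for the gain. -/
lemma seminorm_dilate_smul_le {n : ℕ} {θ : E n → ℂ} (hθ : θ.HasTemperateGrowth)
    (h0 : ∀ x, ‖x‖ < 1 → θ x = 0) (h : 𝓢(E n, ℂ)) (k m : ℕ) :
    ∃ C : ℝ, 0 ≤ C ∧ ∀ j : ℕ, ∀ g : 𝓢(E n, ℂ),
      (∀ x, g x = θ (((j : ℝ) + 1)⁻¹ • x) * h x) →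
      SchwartzMap.seminorm ℝ k m g ≤ C * ((j : ℝ) + 1)⁻¹ := by
  obtain ⟨K, C0, hC0, hb⟩ := hθ.norm_iteratedFDeriv_le_uniform m
  choose D hD0 hD using fun i => schwartz_iteratedFDeriv_le h i (K + k + 1)
  refine ⟨∑ i ∈ Finset.range (m + 1), (m.choose i : ℝ) * C0 * D (m - i),
    Finset.sum_nonneg fun i _ => by have := hD0 (m - i); positivity, fun j g hg => ?_⟩
  have hj : (0 : ℝ) < (j : ℝ) + 1 := by positivity
  have hS : 0 ≤ ∑ i ∈ Finset.range (m + 1), (m.choose i : ℝ) * C0 * D (m - i) :=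
    Finset.sum_nonneg fun i _ => by have := hD0 (m - i); positivity
  refine SchwartzMap.seminorm_le_bound ℝ k m g (by positivity) fun x => ?_
  have hgf : (g : E n → ℂ) = fun x => θ (((j : ℝ) + 1)⁻¹ • x) * h x := funext hg
  rcases lt_or_ge ‖x‖ ((j : ℝ) + 1) with hx | hx
  · have hz : iteratedFDeriv ℝ m g x = 0 := by
      have he : (g : E n → ℂ) =ᶠ[𝓝 x] fun _ => (0 : ℂ) := by
        filter_upwards [(isOpen_lt continuous_norm continuous_const).mem_nhds hx] with y hy
        have hy' : ‖y‖ < (j : ℝ) + 1 := hy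
        rw [hg, h0, zero_mul]
        rw [norm_smul, Real.norm_of_nonneg (by positivity), inv_mul_lt_iff₀ hj]
        simpa using hy'
      rw [(he.iteratedFDeriv ℝ m).eq_of_nhds]
      simp
    rw [hz]
    simp only [norm_zero, mul_zero]
    positivity
  · have hsc : ContDiff ℝ ∞ fun x : E n => θ (((j : ℝ) + 1)⁻¹ • x) :=
      hθ.1.comp (contDiff_const_smul _)
    have hle := norm_iteratedFDeriv_mul_le (𝕜 := ℝ) (N := ∞) hsc h.smooth' x
      (n := m) (by exact_mod_cast le_top)
    have hterm : ∀ i ∈ Finset.range (m + 1),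
        (m.choose i : ℝ) * ‖iteratedFDeriv ℝ i (fun x : E n => θ (((j : ℝ) + 1)⁻¹ • x)) x‖ *
          ‖iteratedFDeriv ℝ (m - i) h x‖ ≤
        (m.choose i : ℝ) * C0 * D (m - i) * (1 + ‖x‖) ^ (-((k + 1 : ℕ) : ℝ)) := by
      intro i hi
      have hi' : i ≤ m := Nat.lt_succ_iff.1 (Finset.mem_range.1 hi)
      have h1 : ‖iteratedFDeriv ℝ i (fun x : E n => θ (((j : ℝ) + 1)⁻¹ • x)) x‖ ≤
          C0 * (1 + ‖x‖) ^ (K : ℝ) := by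
        rw [iteratedFDeriv_comp_const_smul _ ((contDiff_infty.1 hθ.1) i), norm_smul, norm_pow,
          Real.norm_of_nonneg (by positivity)]
        have ha : ((j : ℝ) + 1)⁻¹ ≤ 1 :=
          inv_le_one_of_one_le₀ (by linarith [Nat.cast_nonneg (α := ℝ) j])
        have h2 := hb i hi' (((j : ℝ) + 1)⁻¹ • x)
        have h3 : ‖((j : ℝ) + 1)⁻¹ • x‖ ≤ ‖x‖ := by
          rw [norm_smul, Real.norm_of_nonneg (by positivity)]
          exact mul_le_of_le_one_left (norm_nonneg _) ha
        calc _ ≤ 1 * (C0 * (1 + ‖x‖) ^ K) := by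
              gcongr
              · exact pow_le_one₀ (by positivity) ha
              · exact h2.trans (by gcongr)
          _ = _ := by rw [one_mul, Real.rpow_natCast]
      calc _ ≤ (m.choose i : ℝ) * (C0 * (1 + ‖x‖) ^ (K : ℝ)) *
            (D (m - i) * (1 + ‖x‖) ^ (-((K + k + 1 : ℕ) : ℝ))) := by
              gcongr
              exact hD _ x
        _ = _ := by
          have : (1 + ‖x‖) ^ (-((k + 1 : ℕ) : ℝ)) =
              (1 + ‖x‖) ^ (K : ℝ) * (1 + ‖x‖) ^ (-((K + k + 1 : ℕ) : ℝ)) := by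
            rw [← Real.rpow_add (by positivity)]
            congr 1
            push_cast
            ring
          rw [this]
          ring
    rw [hgf]
    have h4 : ‖x‖ ^ k * (1 + ‖x‖) ^ (-((k + 1 : ℕ) : ℝ)) ≤ ((j : ℝ) + 1)⁻¹ := by
      rw [Real.rpow_neg (by positivity), Real.rpow_natCast, pow_succ, mul_inv, ← mul_assoc]
      have : ‖x‖ ^ k * ((1 + ‖x‖) ^ k)⁻¹ ≤ 1 := by
        rw [mul_inv_le_iff₀ (by positivity), one_mul]
        exact pow_le_pow_left₀ (norm_nonneg _) (by linarith) _
      calc _ ≤ 1 * (1 + ‖x‖)⁻¹ := by gcongr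
        _ ≤ _ := by
          rw [one_mul]
          exact inv_anti₀ hj (by linarith)
    calc _ ≤ ‖x‖ ^ k * ∑ i ∈ Finset.range (m + 1),
          (m.choose i : ℝ) * C0 * D (m - i) * (1 + ‖x‖) ^ (-((k + 1 : ℕ) : ℝ)) := by
            gcongr
            exact hle.trans (Finset.sum_le_sum hterm)
      _ = (∑ i ∈ Finset.range (m + 1), (m.choose i : ℝ) * C0 * D (m - i)) *
          (‖x‖ ^ k * (1 + ‖x‖) ^ (-((k + 1 : ℕ) : ℝ))) := by
            rw [← Finset.sum_mul]; ring
      _ ≤ _ := by gcongr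

/-- Multiplying a Schwartz function by dilates `χ(x/(j+1))` of a function equal to one near the
origin recovers it in the limit, in the topology of the Schwartz space. -/
lemma tendsto_smulLeftCLM_dilate {n : ℕ} {χ : E n → ℂ} (hχ : χ.HasTemperateGrowth)
    (h1 : ∀ x, ‖x‖ < 1 → χ x = 1) (h : 𝓢(E n, ℂ)) :
    Tendsto (fun j : ℕ => SchwartzMap.smulLeftCLM ℂ (fun x => χ (((j : ℝ) + 1)⁻¹ • x)) h)
      atTop (𝓝 h) := by
  rw [(schwartz_withSeminorms ℝ (E n) ℂ).tendsto_nhds]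
  rintro ⟨k, m⟩ ε hε
  have hθ : (fun x => χ x - 1).HasTemperateGrowth := by fun_prop
  obtain ⟨C, hC, hb⟩ := seminorm_dilate_smul_le hθ (fun x hx => by simp [h1 x hx]) h k m
  have hlim : Tendsto (fun j : ℕ => C * ((j : ℝ) + 1)⁻¹) atTop (𝓝 0) := by
    have := (tendsto_inv_atTop_zero.comp
      (tendsto_atTop_add_const_right atTop (1 : ℝ) tendsto_natCast_atTop_atTop)).const_mul C
    simpa using this
  filter_upwards [hlim.eventually_lt_const hε] with j hj
  refine lt_of_le_of_lt (hb j _ fun x => ?_) hj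
  have hd : (fun x : E n => χ (((j : ℝ) + 1)⁻¹ • x)).HasTemperateGrowth := by fun_prop
  rw [_root_.sub_apply, SchwartzMap.smulLeftCLM_apply_apply hd, smul_eq_mul]
  ring

/-- Integration against a function of polynomial growth in the mean, as a functional on the
Schwartz space. -/
def temperedFunctional {n : ℕ} (w : E n → ℝ) {N : ℕ} (hm : AEStronglyMeasurable w)
    (hw : Integrable (fun x => |w x| * (1 + ‖x‖) ^ (-(N : ℝ)))) : 𝓢(E n, ℂ) →L[ℂ] ℂ :=
  have hbd : ∀ (f : 𝓢(E n, ℂ)) (x : E n), ‖w x • f x‖ ≤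
      |w x| * (1 + ‖x‖) ^ (-(N : ℝ)) *
        (2 ^ N * (Finset.Iic (N, 0)).sup (fun m => SchwartzMap.seminorm ℂ m.1 m.2) f) := by
    intro f x
    have := SchwartzMap.one_add_le_sup_seminorm_apply (𝕜 := ℂ) (m := (N, 0)) le_rfl le_rfl f x
    rw [norm_iteratedFDeriv_zero] at this
    rw [norm_smul, Real.norm_eq_abs, mul_assoc]
    gcongr
    calc ‖f x‖ = (1 + ‖x‖) ^ (-(N : ℝ)) * ((1 + ‖x‖) ^ N * ‖f x‖) := by
          rw [Real.rpow_neg (by positivity), Real.rpow_natCast, inv_mul_cancel_left₀]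
          positivity
      _ ≤ _ := by gcongr
  have hint : ∀ f : 𝓢(E n, ℂ), Integrable fun x => w x • f x := fun f =>
    (hw.mul_const _).mono' (hm.smul f.continuous.aestronglyMeasurable)
      (Eventually.of_forall (hbd f))
  SchwartzMap.mkCLMtoNormedSpace (𝕜 := ℂ) (fun f => ∫ x, w x • f x)
    (fun f g => by
      simp only [_root_.add_apply, smul_add]
      exact integral_add (hint f) (hint g))
    (fun a f => by
      simp only [_root_.smul_apply, RingHom.id_apply]
      rw [← integral_smul]
      exact integral_congr_ae (Eventually.of_forall fun x => smul_comm _ _ _))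
    ⟨Finset.Iic (N, 0), (∫ x, |w x| * (1 + ‖x‖) ^ (-(N : ℝ))) * 2 ^ N,
      mul_nonneg (integral_nonneg fun x => by positivity) (by positivity), fun f => by
      refine (norm_integral_le_of_norm_le (hw.mul_const _)
        (Eventually.of_forall (hbd f))).trans (le_of_eq ?_)
      rw [integral_mul_const, ← mul_assoc]
      rfl⟩

lemma temperedFunctional_apply {n : ℕ} (w : E n → ℝ) {N : ℕ} (hm : AEStronglyMeasurable w)
    (hw : Integrable (fun x => |w x| * (1 + ‖x‖) ^ (-(N : ℝ)))) (f : 𝓢(E n, ℂ)) :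
    temperedFunctional w hm hw f = ∫ x, w x • f x := rfl

lemma integrable_smul_schwartz {n : ℕ} {w : E n → ℝ} {N : ℕ} (hm : AEStronglyMeasurable w)
    (hw : Integrable (fun x => |w x| * (1 + ‖x‖) ^ (-(N : ℝ)))) (f : 𝓢(E n, ℂ)) :
    Integrable fun x => w x • f x := by
  obtain ⟨C, hC, hb⟩ := schwartz_norm_le f N
  refine (hw.mul_const C).mono' (hm.smul f.continuous.aestronglyMeasurable)
    (Eventually.of_forall fun x => ?_)
  rw [norm_smul, Real.norm_eq_abs, mul_assoc]
  gcongr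
  rw [mul_comm]
  exact hb x

/-- A smooth cutoff, equal to one on the unit ball, with compact support. -/
def cutoff (n : ℕ) : ContDiffBump (0 : E n) := ⟨1, 2, one_pos, one_lt_two⟩

lemma cutoff_one {n : ℕ} {x : E n} (hx : ‖x‖ ≤ 1) : cutoff n x = 1 :=
  (cutoff n).one_of_mem_closedBall (by simpa [cutoff] using hx)

lemma contDiff_cutoff (n : ℕ) : ContDiff ℝ ∞ (cutoff n) := (cutoff n).contDiff

/-- The cutoff as a complex Schwartz function. -/
def cutoffSchwartz (n : ℕ) : 𝓢(E n, ℂ) :=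
  toComplexSchwartz (contDiff_cutoff n) (cutoff n).hasCompactSupport

lemma cutoffSchwartz_apply {n : ℕ} (x : E n) : cutoffSchwartz n x = (cutoff n x : ℂ) :=
  toComplexSchwartz_apply _ _ _

/-! ### Mollifying a function whose Fourier transform is supported at the origin -/

/-- If the Fourier transform of `w` vanishes on compactly supported functions that are zero near the
origin, then it vanishes on all Schwartz functions that are zero near the origin. -/
lemma integral_smul_fourierInv_eq_zero {n : ℕ} {w : E n → ℝ} {N : ℕ} (hm : AEStronglyMeasurable w)
    (hw : Integrable (fun x => |w x| * (1 + ‖x‖) ^ (-(N : ℝ))))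
    (hker : ∀ h : 𝓢(E n, ℂ), HasCompactSupport h → (∃ r > 0, ∀ x, ‖x‖ < r → h x = 0) →
      ∫ x, w x • (𝓕⁻ h) x = 0)
    (h : 𝓢(E n, ℂ)) (h0 : ∃ r > 0, ∀ x, ‖x‖ < r → h x = 0) : ∫ x, w x • (𝓕⁻ h) x = 0 := by
  have ht := tendsto_smulLeftCLM_dilate (cutoffSchwartz n).hasTemperateGrowth
    (fun x hx => by rw [cutoffSchwartz_apply, cutoff_one hx.le]; simp) h
  have hcont : Continuous fun g : 𝓢(E n, ℂ) =>
      temperedFunctional w hm hw (FourierTransform.fourierInvCLM ℂ 𝓢(E n, ℂ) g) := by fun_prop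
  have hlim := (hcont.tendsto h).comp ht
  have hzero : ∀ j : ℕ, temperedFunctional w hm hw (FourierTransform.fourierInvCLM ℂ 𝓢(E n, ℂ)
      (SchwartzMap.smulLeftCLM ℂ (fun x => cutoffSchwartz n (((j : ℝ) + 1)⁻¹ • x)) h)) = 0 := by
    intro j
    have hd : (fun x : E n => cutoffSchwartz n (((j : ℝ) + 1)⁻¹ • x)).HasTemperateGrowth := by
      have := (cutoffSchwartz n).hasTemperateGrowth
      fun_prop
    have hap : ∀ x, SchwartzMap.smulLeftCLM ℂ
        (fun x => cutoffSchwartz n (((j : ℝ) + 1)⁻¹ • x)) h x =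
        cutoffSchwartz n (((j : ℝ) + 1)⁻¹ • x) * h x := fun x => by
      rw [SchwartzMap.smulLeftCLM_apply_apply hd, smul_eq_mul]
    rw [temperedFunctional_apply]
    refine hker _ ?_ ?_
    · have hc : HasCompactSupport fun x : E n => cutoffSchwartz n (((j : ℝ) + 1)⁻¹ • x) := by
        have h2 : HasCompactSupport (cutoffSchwartz n) :=
          ((cutoff n).hasCompactSupport.comp_left (g := fun r : ℝ => (r : ℂ)) (by simp))
        exact h2.comp_smul (by positivity)
      have : (SchwartzMap.smulLeftCLM ℂ
        (fun x => cutoffSchwartz n (((j : ℝ) + 1)⁻¹ • x)) h : E n → ℂ) =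
          (fun x : E n => cutoffSchwartz n (((j : ℝ) + 1)⁻¹ • x)) * h := funext hap
      rw [this]
      exact hc.mul_right
    · obtain ⟨r, hr, hz⟩ := h0
      exact ⟨r, hr, fun x hx => by rw [hap, hz x hx, mul_zero]⟩
  refine tendsto_nhds_unique hlim ?_
  refine tendsto_const_nhds.congr fun j => ?_
  exact (hzero j).symm

/-- The inverse Fourier transform of the dilated cutoff `ξ ↦ χ(Rξ)`. -/
def mollifier (n : ℕ) {R : ℝ} (hR : R ≠ 0) : 𝓢(E n, ℂ) :=
  𝓕⁻ (toComplexSchwartz (φ := fun ξ => cutoff n (R • ξ))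
    ((contDiff_cutoff n).comp (contDiff_const_smul R))
    ((cutoff n).hasCompactSupport.comp_smul hR))

lemma mollifier_apply (n : ℕ) {R : ℝ} (hR : 0 < R) (x : E n) :
    mollifier n hR.ne' x = ((R ^ n)⁻¹ : ℝ) • (𝓕⁻ (cutoffSchwartz n)) (R⁻¹ • x) := by
  rw [mollifier, SchwartzMap.fourierInv_coe, SchwartzMap.fourierInv_coe, Real.fourierInv_eq,
    Real.fourierInv_eq]
  have h := Measure.integral_comp_smul (volume : Measure (E n))
    (fun v => Real.fourierChar (inner ℝ v (R⁻¹ • x)) • cutoffSchwartz n v) R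
  rw [finrank_euclideanSpace_fin, abs_of_pos (by positivity)] at h
  rw [← h]
  refine integral_congr_ae (Eventually.of_forall fun v => ?_)
  simp only [toComplexSchwartz_apply, cutoffSchwartz_apply]
  rw [inner_smul_left, inner_smul_right]
  simp [hR.ne']

/-- If the Fourier transform of `w` is supported at the origin, then `w` pairs with a Schwartz
function as with its mollification. -/
lemma integral_smul_convolution {n : ℕ} {w : E n → ℝ} {N : ℕ} (hm : AEStronglyMeasurable w)
    (hw : Integrable (fun x => |w x| * (1 + ‖x‖) ^ (-(N : ℝ))))
    (hker : ∀ h : 𝓢(E n, ℂ), HasCompactSupport h → (∃ r > 0, ∀ x, ‖x‖ < r → h x = 0) →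
      ∫ x, w x • (𝓕⁻ h) x = 0) {R : ℝ} (hR : 0 < R) (ψ : 𝓢(E n, ℂ)) :
    ∫ x, w x • ψ x = ∫ x, w x • ∫ y, mollifier n hR.ne' (x - y) * ψ y := by
  set B := ContinuousLinearMap.mul ℂ ℂ
  set c := SchwartzMap.convolution B (mollifier n hR.ne') ψ
  have hc : ∀ x, c x = ∫ y, mollifier n hR.ne' (x - y) * ψ y := fun x => by
    rw [SchwartzMap.convolution_apply, convolution_eq_swap]
    rfl
  -- The transform of `ψ - c` is `(1 - χ(Rξ)) 𝓕 ψ`, which is zero near the origin.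
  have hF : ∀ x, 𝓕 c x = (cutoff n (R • x) : ℂ) * 𝓕 ψ x := fun x => by
    rw [SchwartzMap.fourier_convolution, SchwartzMap.pairing_apply_apply, mollifier,
      FourierTransform.fourier_fourierInv_eq]
    rfl
  have hz := integral_smul_fourierInv_eq_zero hm hw hker (𝓕 (ψ - c)) ⟨R⁻¹, by positivity,
    fun x hx => by
      have hsub : 𝓕 (ψ - c) = 𝓕 ψ - 𝓕 c :=
        map_sub (FourierTransform.fourierCLM ℂ 𝓢(E n, ℂ)) ψ c
      rw [hsub, _root_.sub_apply, hF, cutoff_one]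
      · simp
      · rw [norm_smul, Real.norm_of_nonneg hR.le]
        have := mul_lt_mul_of_pos_left hx hR
        rw [mul_inv_cancel₀ hR.ne'] at this
        exact this.le⟩
  rw [FourierTransform.fourierInv_fourier_eq] at hz
  simp only [_root_.sub_apply, smul_sub] at hz
  rw [integral_sub (integrable_smul_schwartz hm hw ψ) (integrable_smul_schwartz hm hw c),
    sub_eq_zero] at hz
  rw [hz]
  simp only [hc]

lemma one_add_norm_sub_rpow_le {n : ℕ} (N : ℕ) (x y : E n) :
    (1 + ‖x - y‖) ^ (-(N : ℝ)) ≤ (1 + ‖x‖) ^ (-(N : ℝ)) * (1 + ‖y‖) ^ N := by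
  have h1 : 1 + ‖x‖ ≤ (1 + ‖x - y‖) * (1 + ‖y‖) := by
    have := norm_le_norm_sub_add x y
    nlinarith [norm_nonneg (x - y), norm_nonneg y]
  have h2 := pow_le_pow_left₀ (by positivity) h1 N
  rw [Real.rpow_neg (by positivity), Real.rpow_neg (by positivity), Real.rpow_natCast,
    Real.rpow_natCast, inv_le_iff_one_le_mul₀ (by positivity), mul_assoc, ← mul_pow,
    ← div_eq_inv_mul, one_le_div (by positivity)]
  rwa [mul_comm (1 + ‖y‖)]

/-- A function whose Fourier transform is supported at the origin is reproduced by every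
mollification. -/
lemma ae_eq_integral_mollifier {n : ℕ} {w : E n → ℝ} {N : ℕ} (hl : LocallyIntegrable w)
    (hw : Integrable (fun x => |w x| * (1 + ‖x‖) ^ (-(N : ℝ))))
    (hker : ∀ h : 𝓢(E n, ℂ), HasCompactSupport h → (∃ r > 0, ∀ x, ‖x‖ < r → h x = 0) →
      ∫ x, w x • (𝓕⁻ h) x = 0) {R : ℝ} (hR : 0 < R) :
    ∀ᵐ y, w y = ∫ x, w x * (mollifier n hR.ne' (x - y)).re := by
  have hm := hl.aestronglyMeasurable
  set η := mollifier n hR.ne'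
  obtain ⟨C, hC, hb⟩ := schwartz_norm_le η N
  have hbd : ∀ x y : E n, ‖w x * (η (x - y)).re‖ ≤
      |w x| * (1 + ‖x‖) ^ (-(N : ℝ)) * (C * (1 + ‖y‖) ^ N) := by
    intro x y
    rw [norm_mul, Real.norm_eq_abs, mul_assoc]
    gcongr
    calc _ ≤ ‖η (x - y)‖ := Complex.abs_re_le_norm _
      _ ≤ C * (1 + ‖x - y‖) ^ (-(N : ℝ)) := hb _
      _ ≤ C * ((1 + ‖x‖) ^ (-(N : ℝ)) * (1 + ‖y‖) ^ N) := by
        gcongr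
        exact one_add_norm_sub_rpow_le N x y
      _ = _ := by ring
  have hηc : Continuous fun z : E n × E n => (η (z.1 - z.2)).re :=
    Complex.continuous_re.comp (η.continuous.comp (continuous_fst.sub continuous_snd))
  have hmeas : AEStronglyMeasurable (fun z : E n × E n => w z.1 * (η (z.1 - z.2)).re)
      ((volume : Measure (E n)).prod volume) :=
    hm.comp_fst.mul hηc.aestronglyMeasurable
  have hWl : LocallyIntegrable fun y => ∫ x, w x * (η (x - y)).re := by
    have hcb : Continuous fun y : E n =>
        (∫ x, |w x| * (1 + ‖x‖) ^ (-(N : ℝ))) * (C * (1 + ‖y‖) ^ N) := by fun_prop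
    refine LocallyIntegrable.mono (hcb.locallyIntegrable (μ := volume)) ?_
      (Eventually.of_forall fun y => ?_)
    · exact hmeas.prod_swap.integral_prod_right'
    · refine (norm_integral_le_of_norm_le (hw.mul_const (C * (1 + ‖y‖) ^ N))
        (Eventually.of_forall fun x => hbd x y)).trans ?_
      rw [integral_mul_const]
      exact le_abs_self _
  refine ae_eq_of_integral_contDiff_smul_eq hl hWl fun g hg hgc => ?_
  have hkey := integral_smul_convolution hm hw hker hR (toComplexSchwartz hg hgc)
  have hηint : ∀ x, Integrable fun y => η (x - y) * (toComplexSchwartz hg hgc) y := fun x => by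
    refine ((toComplexSchwartz hg hgc).integrable (μ := volume)).bdd_mul (c := C)
      ((η.continuous.comp (continuous_const.sub continuous_id)).aestronglyMeasurable)
      (Eventually.of_forall fun y => (hb _).trans ?_)
    exact mul_le_of_le_one_right hC
      (Real.rpow_le_one_of_one_le_of_nonpos (by simp) (by simp))
  have hre := congrArg Complex.re hkey
  have hI1 := integrable_smul_schwartz hm hw (toComplexSchwartz hg hgc)
  have hI2 : Integrable fun x => w x • ∫ y, η (x - y) * (toComplexSchwartz hg hgc) y := by
    have := integrable_smul_schwartz hm hw
      (SchwartzMap.convolution (ContinuousLinearMap.mul ℂ ℂ) η (toComplexSchwartz hg hgc))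
    refine this.congr (Eventually.of_forall fun x => ?_)
    simp only
    rw [SchwartzMap.convolution_apply, convolution_eq_swap]
    rfl
  have e1 : (∫ x, w x • (toComplexSchwartz hg hgc) x).re = ∫ x, g x • w x := by
    rw [← RCLike.re_eq_complex_re, ← integral_re hI1]
    refine integral_congr_ae (Eventually.of_forall fun x => ?_)
    simp [toComplexSchwartz_apply, mul_comm]
  have e2 : (∫ x, w x • ∫ y, η (x - y) * (toComplexSchwartz hg hgc) y).re =
      ∫ x, ∫ y, w x * (η (x - y)).re * g y := by
    rw [← RCLike.re_eq_complex_re, ← integral_re hI2]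
    refine integral_congr_ae (Eventually.of_forall fun x => ?_)
    simp only [RCLike.re_eq_complex_re, Complex.real_smul, Complex.re_ofReal_mul]
    rw [← RCLike.re_eq_complex_re, ← integral_re (hηint x), ← integral_const_mul]
    refine integral_congr_ae (Eventually.of_forall fun y => ?_)
    simp [toComplexSchwartz_apply, mul_assoc]
  rw [← e1, hre, e2]
  have hgint : Integrable fun y => C * (1 + ‖y‖) ^ N * |g y| := by
    refine Continuous.integrable_of_hasCompactSupport ?_ ?_
    · have := hg.continuous
      fun_prop
    · exact (hgc.comp_left (g := fun r : ℝ => |r|) abs_zero).mul_left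
  have hprod : Integrable (fun z : E n × E n => w z.1 * (η (z.1 - z.2)).re * g z.2)
      ((volume : Measure (E n)).prod volume) := by
    refine (hw.mul_prod hgint).mono' (hmeas.mul
      (hg.continuous.comp continuous_snd).aestronglyMeasurable) (Eventually.of_forall fun z => ?_)
    rw [norm_mul, Real.norm_eq_abs (g _)]
    calc _ ≤ |w z.1| * (1 + ‖z.1‖) ^ (-(N : ℝ)) * (C * (1 + ‖z.2‖) ^ N) * |g z.2| := by
          gcongr
          exact hbd _ _
      _ = _ := by ring
  rw [integral_integral_swap (f := fun x y => w x * (η (x - y)).re * g y) hprod]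
  refine integral_congr_ae (Eventually.of_forall fun y => ?_)
  simp only [smul_eq_mul]
  rw [integral_mul_const, mul_comm]

/-! ### A Liouville theorem -/

/-- The value of a polynomial as a function on `ℝⁿ`, as a linear map. -/
def polyFunLin (n : ℕ) : MvPolynomial (Fin n) ℝ →ₗ[ℝ] (E n → ℝ) where
  toFun := polyFun n
  map_add' p q := by ext x; simp [polyFun]
  map_smul' c p := by ext x; simp [polyFun, MvPolynomial.smul_eval]

/-- The polynomial functions of degree at most `d`. -/
def polySpace (n d : ℕ) : Submodule ℝ (E n → ℝ) :=
  (MvPolynomial.restrictTotalDegree (Fin n) ℝ d).map (polyFunLin n)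

lemma mem_polySpace {n d : ℕ} {g : E n → ℝ} :
    g ∈ polySpace n d ↔ ∃ p : MvPolynomial (Fin n) ℝ, p.totalDegree ≤ d ∧ polyFun n p = g := by
  simp only [polySpace, Submodule.mem_map, MvPolynomial.mem_restrictTotalDegree]
  rfl

lemma finiteDimensional_polySpace (n d : ℕ) : FiniteDimensional ℝ (polySpace n d) := by
  unfold polySpace
  infer_instance

lemma prod_coord_mem_polySpace {n d j : ℕ} (hj : j ≤ d) (r : Fin j → Fin n) :
    (fun y : E n => ∏ i, y (r i)) ∈ polySpace n d := by
  refine mem_polySpace.2 ⟨∏ i, MvPolynomial.X (r i), ?_, ?_⟩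
  · refine (MvPolynomial.totalDegree_finsetProd _ _).trans ?_
    simpa using hj
  · ext y
    simp [polyFun]

lemma eq_sum_coord_smul_stdVec {n : ℕ} (y : E n) : y = ∑ i, y i • stdVec i := by
  ext j
  simp [stdVec_apply]

lemma multilinear_diag_eq {n j : ℕ} (A : ContinuousMultilinearMap ℝ (fun _ : Fin j => E n) ℝ)
    (y : E n) : A (fun _ => y) =
      ∑ r : Fin j → Fin n, (∏ i, y (r i)) * A fun i => stdVec (r i) := by
  conv_lhs => rw [eq_sum_coord_smul_stdVec y]
  rw [A.map_sum]
  refine Finset.sum_congr rfl fun r _ => ?_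
  rw [A.map_smul_univ]
  rfl

/-- A pointwise almost everywhere limit of polynomials of bounded degree is a polynomial. -/
lemma ae_eq_polyFun_of_tendsto {n d : ℕ} {w : E n → ℝ} {P : ℕ → E n → ℝ}
    (hP : ∀ j, P j ∈ polySpace n d)
    (hlim : ∀ᵐ y, Tendsto (fun j => P j y) atTop (𝓝 (w y))) :
    ∃ p : MvPolynomial (Fin n) ℝ, p.totalDegree ≤ d ∧ ∀ᵐ y, w y = polyFun n p y := by
  set X : Set (E n) := {y | Tendsto (fun j => P j y) atTop (𝓝 (w y))}
  let res : (E n → ℝ) →ₗ[ℝ] (X → ℝ) := LinearMap.funLeft ℝ ℝ (fun x : X => (x : E n))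
  have := finiteDimensional_polySpace n d
  have hcl : IsClosed (((polySpace n d).map res : Submodule ℝ (X → ℝ)) : Set (X → ℝ)) :=
    Submodule.closed_of_finiteDimensional _
  have hmem : res w ∈ (((polySpace n d).map res : Submodule ℝ (X → ℝ)) : Set (X → ℝ)) := by
    refine hcl.mem_of_tendsto (f := fun j => res (P j)) (b := atTop) ?_
      (Eventually.of_forall fun j => Submodule.mem_map_of_mem (hP j))
    rw [tendsto_pi_nhds]
    intro y
    exact y.2
  obtain ⟨g, hg, hgw⟩ := hmem
  obtain ⟨p, hp, rfl⟩ := mem_polySpace.1 hg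
  refine ⟨p, hp, ?_⟩
  filter_upwards [hlim] with y hy
  exact (congrFun hgw ⟨y, hy⟩).symm

/-- The remainder of the Taylor expansion of order `d` of a Schwartz function. -/
def taylorRem {n : ℕ} (κ : 𝓢(E n, ℝ)) (d : ℕ) (a b : E n) : ℝ :=
  κ (a + b) - ∑ j ∈ Finset.range (d + 1), ((j.factorial : ℝ))⁻¹ *
    iteratedFDeriv ℝ j κ a (fun _ => b)

lemma abs_taylorRem_le {n : ℕ} (κ : 𝓢(E n, ℝ)) (d M : ℕ) : ∃ C : ℝ, 0 ≤ C ∧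
    ∀ a b : E n, ‖b‖ ≤ 1 / 2 →
      |taylorRem κ d a b| ≤ C * ‖b‖ ^ (d + 1) * (1 + ‖a‖) ^ (-(M : ℝ)) := by
  obtain ⟨C, hC, hb⟩ := schwartz_iteratedFDeriv_le κ (d + 1) M
  refine ⟨(d.factorial : ℝ)⁻¹ * (C * 2 ^ M), by positivity, fun a b hb2 => ?_⟩
  have hT := map_add_eq_sum_add_integral_iteratedFDeriv (f := κ) (x := a) (y := b) (n := d)
    fun t _ => (κ.smooth (d + 1)).contDiffAt
  have hrem : taylorRem κ d a b = (d.factorial : ℝ)⁻¹ * ∫ t in (0 : ℝ)..1, (1 - t) ^ d •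
      iteratedFDeriv ℝ (d + 1) κ (a + t • b) (fun _ => b) := by
    rw [taylorRem, hT]
    simp only [smul_eq_mul]
    ring
  rw [hrem, abs_mul, abs_of_nonneg (by positivity), mul_assoc, mul_assoc]
  gcongr
  have hle : ∀ t ∈ Set.uIoc (0 : ℝ) 1, ‖(1 - t) ^ d •
      iteratedFDeriv ℝ (d + 1) κ (a + t • b) (fun _ => b)‖ ≤
      C * (2 ^ M * (‖b‖ ^ (d + 1) * (1 + ‖a‖) ^ (-(M : ℝ)))) := by
    intro t ht
    rw [Set.uIoc_of_le zero_le_one] at ht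
    have h1 : 1 + ‖a‖ ≤ 2 * (1 + ‖a + t • b‖) := by
      have h2 := norm_le_norm_add_norm_sub' a (a + t • b)
      have h3 : ‖a - (a + t • b)‖ ≤ 1 / 2 := by
        rw [sub_add_cancel_left, norm_neg, norm_smul, Real.norm_of_nonneg ht.1.le]
        nlinarith [ht.2, norm_nonneg b]
      linarith [norm_nonneg (a + t • b)]
    have h4 : (1 + ‖a + t • b‖) ^ (-(M : ℝ)) ≤ 2 ^ M * (1 + ‖a‖) ^ (-(M : ℝ)) := by
      rw [Real.rpow_neg (by positivity), Real.rpow_neg (by positivity), Real.rpow_natCast,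
        Real.rpow_natCast, ← div_eq_mul_inv, inv_le_comm₀ (by positivity) (by positivity),
        inv_div, div_le_iff₀ (by positivity), ← mul_pow, mul_comm]
      exact pow_le_pow_left₀ (by positivity) h1 M
    rw [norm_smul]
    calc _ ≤ 1 * (‖iteratedFDeriv ℝ (d + 1) κ (a + t • b)‖ * ‖b‖ ^ (d + 1)) := by
          gcongr
          · rw [norm_pow, Real.norm_of_nonneg (by linarith [ht.2])]
            exact pow_le_one₀ (by linarith [ht.2]) (by linarith [ht.1])
          · refine (ContinuousMultilinearMap.le_opNorm _ _).trans (le_of_eq ?_)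
            simp
      _ ≤ 1 * (C * (2 ^ M * (1 + ‖a‖) ^ (-(M : ℝ))) * ‖b‖ ^ (d + 1)) := by
          gcongr
          exact (hb _).trans (by gcongr)
      _ = _ := by ring
  have := intervalIntegral.norm_integral_le_of_norm_le_const hle
  rw [Real.norm_eq_abs] at this
  exact this.trans (le_of_eq (by rw [sub_zero, abs_one, mul_one, mul_assoc]))

lemma integrable_mul_iteratedFDeriv_dilate {n : ℕ} {w : E n → ℝ} {N : ℕ}
    (hm : AEStronglyMeasurable w)
    (hw : Integrable (fun x => |w x| * (1 + ‖x‖) ^ (-(N : ℝ)))) (κ : 𝓢(E n, ℝ)) (j : ℕ)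
    {c : ℝ} (hc : 0 < c) (hc1 : c ≤ 1) (v : Fin j → E n) :
    Integrable fun x => w x * iteratedFDeriv ℝ j κ (c • x) v := by
  obtain ⟨C, hC, hb⟩ := schwartz_iteratedFDeriv_le κ j N
  have hcont : Continuous fun x : E n => iteratedFDeriv ℝ j κ (c • x) v := by
    have := (κ.smooth j).continuous_iteratedFDeriv le_rfl
    fun_prop
  refine (hw.mul_const (C * (c⁻¹) ^ N * ∏ i, ‖v i‖)).mono'
    (hm.mul hcont.aestronglyMeasurable) (Eventually.of_forall fun x => ?_)
  have h1 : c * (1 + ‖x‖) ≤ 1 + ‖c • x‖ := by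
    rw [norm_smul, Real.norm_of_nonneg hc.le]
    nlinarith
  have h2 : (1 + ‖c • x‖) ^ (-(N : ℝ)) ≤ (c⁻¹) ^ N * (1 + ‖x‖) ^ (-(N : ℝ)) := by
    rw [Real.rpow_neg (by positivity), Real.rpow_neg (by positivity), Real.rpow_natCast,
      Real.rpow_natCast, inv_pow, ← mul_inv, ← mul_pow]
    exact inv_anti₀ (by positivity) (pow_le_pow_left₀ (by positivity) h1 N)
  rw [norm_mul, Real.norm_eq_abs, mul_assoc]
  gcongr
  calc _ ≤ ‖iteratedFDeriv ℝ j κ (c • x)‖ * ∏ i, ‖v i‖ := ContinuousMultilinearMap.le_opNorm _ _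
    _ ≤ C * ((c⁻¹) ^ N * (1 + ‖x‖) ^ (-(N : ℝ))) * ∏ i, ‖v i‖ := by
        have : 0 ≤ ∏ i, ‖v i‖ := Finset.prod_nonneg fun i _ => norm_nonneg _
        gcongr
        exact (hb _).trans (by gcongr)
    _ = _ := by ring

/-- A function of moderate growth which is reproduced by all dilates `R⁻ⁿ κ((x-y)/R)` of one
Schwartz function is a polynomial: after Taylor expansion of `κ` in `y` only the polynomial part
survives as `R → ∞`. -/
lemma ae_eq_polyFun_of_reproduced {n d : ℕ} {w : E n → ℝ} (hm : AEStronglyMeasurable w)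
    (hw : Integrable (fun x => |w x| * (1 + ‖x‖) ^ (-((n + d + 1 : ℕ) : ℝ)))) (κ : 𝓢(E n, ℝ))
    (hrep : ∀ j : ℕ, ∀ᵐ y, w y = ∫ x, w x *
      ((((j : ℝ) + 1) ^ n)⁻¹ * κ (((j : ℝ) + 1)⁻¹ • (x - y)))) :
    ∃ p : MvPolynomial (Fin n) ℝ, p.totalDegree ≤ d ∧ ∀ᵐ y, w y = polyFun n p y := by
  have hj0 : ∀ j : ℕ, (0 : ℝ) < (j : ℝ) + 1 := fun j => by positivity
  have hj1 : ∀ j : ℕ, ((j : ℝ) + 1)⁻¹ ≤ 1 := fun j =>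
    inv_le_one_of_one_le₀ (by linarith [Nat.cast_nonneg (α := ℝ) j])
  set P : ℕ → E n → ℝ := fun j y => ∑ i ∈ Finset.range (d + 1), ∑ r : Fin i → Fin n,
    ((((j : ℝ) + 1) ^ n)⁻¹ * (i.factorial : ℝ)⁻¹ * (-((j : ℝ) + 1)⁻¹) ^ i *
      ∫ x, w x * iteratedFDeriv ℝ i κ (((j : ℝ) + 1)⁻¹ • x) (fun l => stdVec (r l))) *
      ∏ l, y (r l) with hPdef
  have hint := fun (j i : ℕ) (v : Fin i → E n) =>
    integrable_mul_iteratedFDeriv_dilate hm hw κ i (inv_pos.2 (hj0 j)) (hj1 j) v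
  have hPmem : ∀ j, P j ∈ polySpace n d := by
    intro j
    have : P j = ∑ i ∈ Finset.range (d + 1), ∑ r : Fin i → Fin n,
      ((((j : ℝ) + 1) ^ n)⁻¹ * (i.factorial : ℝ)⁻¹ * (-((j : ℝ) + 1)⁻¹) ^ i *
      ∫ x, w x * iteratedFDeriv ℝ i κ (((j : ℝ) + 1)⁻¹ • x) (fun l => stdVec (r l))) •
      (fun y : E n => ∏ l, y (r l)) := by
      ext y
      simp only [hPdef, Finset.sum_apply, Pi.smul_apply, smul_eq_mul]
    rw [this]
    exact Submodule.sum_mem _ fun i hi => Submodule.sum_mem _ fun r _ =>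
      Submodule.smul_mem _ _ (prod_coord_mem_polySpace
        (Nat.lt_succ_iff.1 (Finset.mem_range.1 hi)) r)
  -- The polynomial `P j` integrates the Taylor polynomials of the kernel.
  have hPint : ∀ j y, P j y = ∫ x, w x * ((((j : ℝ) + 1) ^ n)⁻¹ *
      ∑ i ∈ Finset.range (d + 1), (i.factorial : ℝ)⁻¹ *
        iteratedFDeriv ℝ i κ (((j : ℝ) + 1)⁻¹ • x) (fun _ => -(((j : ℝ) + 1)⁻¹ • y))) := by
    intro j y
    have hexp : ∀ x : E n, w x * ((((j : ℝ) + 1) ^ n)⁻¹ *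
      ∑ i ∈ Finset.range (d + 1), (i.factorial : ℝ)⁻¹ *
        iteratedFDeriv ℝ i κ (((j : ℝ) + 1)⁻¹ • x) (fun _ => -(((j : ℝ) + 1)⁻¹ • y))) =
        ∑ i ∈ Finset.range (d + 1), ∑ r : Fin i → Fin n,
        ((((j : ℝ) + 1) ^ n)⁻¹ * (i.factorial : ℝ)⁻¹ * (-((j : ℝ) + 1)⁻¹) ^ i * ∏ l, y (r l)) *
        (w x * iteratedFDeriv ℝ i κ (((j : ℝ) + 1)⁻¹ • x) (fun l => stdVec (r l))) := by
      intro x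
      rw [Finset.mul_sum, Finset.mul_sum]
      refine Finset.sum_congr rfl fun i _ => ?_
      rw [multilinear_diag_eq, Finset.mul_sum, Finset.mul_sum, Finset.mul_sum]
      refine Finset.sum_congr rfl fun r _ => ?_
      have : ∏ l, (-(((j : ℝ) + 1)⁻¹ • y)) (r l) = (-((j : ℝ) + 1)⁻¹) ^ i * ∏ l, y (r l) := by
        rw [show (-((j : ℝ) + 1)⁻¹) ^ i = ∏ _l : Fin i, (-((j : ℝ) + 1)⁻¹) by simp,
          ← Finset.prod_mul_distrib]
        refine Finset.prod_congr rfl fun l _ => ?_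
        simp
      rw [this]
      ring
    simp only [hexp]
    rw [integral_finsetSum _ fun i _ => integrable_finsetSum _ fun r _ =>
      (hint j i _).const_mul _]
    refine Finset.sum_congr rfl fun i _ => ?_
    rw [integral_finsetSum _ fun r _ => (hint j i _).const_mul _]
    refine Finset.sum_congr rfl fun r _ => ?_
    rw [integral_const_mul]
    ring
  -- With the decay `(1 + |x|)^(-(n+d+1))` of the Taylor remainder, the factors `R` from the scaling
  -- cancel and the error is dominated by the weight against which `w` is integrable.
  obtain ⟨C, hC, hrem⟩ := abs_taylorRem_le κ d (n + d + 1)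
  set Q : ℕ → ℝ := fun j => ∫ x, |w x| * ((j : ℝ) + 1 + ‖x‖) ^ (-((n + d + 1 : ℕ) : ℝ)) with hQ
  have hQmeas : ∀ j : ℕ, Continuous fun x : E n =>
      ((j : ℝ) + 1 + ‖x‖) ^ (-((n + d + 1 : ℕ) : ℝ)) := fun j =>
    (continuous_const.add continuous_norm).rpow_const fun x =>
      Or.inl (show ((j : ℝ) + 1 + ‖x‖) ≠ 0 by have := hj0 j; positivity)
  have hQle : ∀ (j : ℕ) (x : E n), |w x| * ((j : ℝ) + 1 + ‖x‖) ^ (-((n + d + 1 : ℕ) : ℝ)) ≤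
      |w x| * (1 + ‖x‖) ^ (-((n + d + 1 : ℕ) : ℝ)) := fun j x => by
    refine mul_le_mul_of_nonneg_left ?_ (abs_nonneg _)
    have h1 : (0 : ℝ) < 1 + ‖x‖ := by positivity
    exact Real.rpow_le_rpow_of_nonpos h1
      (by linarith [Nat.cast_nonneg (α := ℝ) j]) (neg_nonpos.2 (Nat.cast_nonneg _))
  have hQint : ∀ j : ℕ, Integrable fun x : E n =>
      |w x| * ((j : ℝ) + 1 + ‖x‖) ^ (-((n + d + 1 : ℕ) : ℝ)) := fun j =>
    hw.mono' (hm.norm.mul (hQmeas j).aestronglyMeasurable) (Eventually.of_forall fun x => by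
      rw [Real.norm_of_nonneg (by have := hj0 j; positivity)]
      exact hQle j x)
  have hQlim : Tendsto Q atTop (𝓝 0) := by
    have := tendsto_integral_of_dominated_convergence
      (F := fun (j : ℕ) x => |w x| * ((j : ℝ) + 1 + ‖x‖) ^ (-((n + d + 1 : ℕ) : ℝ)))
      (f := fun _ => (0 : ℝ))
      _ (fun j => (hQint j).aestronglyMeasurable) hw
      (fun j => Eventually.of_forall fun x => by
        rw [Real.norm_of_nonneg (by have := hj0 j; positivity)]
        exact hQle j x)
      (Eventually.of_forall fun x => by
        have h1 : Tendsto (fun j : ℕ => (j : ℝ) + 1 + ‖x‖) atTop atTop :=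
          tendsto_atTop_add_const_right _ _
            (tendsto_atTop_add_const_right _ _ tendsto_natCast_atTop_atTop)
        have h2 := (tendsto_rpow_neg_atTop (y := ((n + d + 1 : ℕ) : ℝ)) (by positivity)).comp h1
        simpa using h2.const_mul |w x|)
    rwa [integral_zero] at this
  refine ae_eq_polyFun_of_tendsto hPmem ?_
  filter_upwards [ae_all_iff.2 hrep] with y hy
  -- The difference of `w` and `P j` is an integral of Taylor remainders.
  have hdiff : ∀ᶠ j : ℕ in atTop, |P j y - w y| ≤ C * ‖y‖ ^ (d + 1) * Q j := by
    filter_upwards [tendsto_natCast_atTop_atTop.eventually_ge_atTop (2 * ‖y‖)] with j hj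
    have hb2 : ‖-(((j : ℝ) + 1)⁻¹ • y)‖ ≤ 1 / 2 := by
      rw [norm_neg, norm_smul, Real.norm_of_nonneg (inv_pos.2 (hj0 j)).le,
        inv_mul_le_iff₀ (hj0 j)]
      linarith
    have hptw : ∀ x : E n, |w x * ((((j : ℝ) + 1) ^ n)⁻¹ *
        taylorRem κ d (((j : ℝ) + 1)⁻¹ • x) (-(((j : ℝ) + 1)⁻¹ • y)))| ≤
        C * ‖y‖ ^ (d + 1) * (|w x| * ((j : ℝ) + 1 + ‖x‖) ^ (-((n + d + 1 : ℕ) : ℝ))) := by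
      intro x
      rw [abs_mul, abs_mul,
        abs_of_nonneg (a := (((j : ℝ) + 1) ^ n)⁻¹) (by have := hj0 j; positivity)]
      have h1 := hrem (((j : ℝ) + 1)⁻¹ • x) (-(((j : ℝ) + 1)⁻¹ • y)) hb2
      have hid : (((j : ℝ) + 1) ^ n)⁻¹ * (C * ‖-(((j : ℝ) + 1)⁻¹ • y)‖ ^ (d + 1) *
          (1 + ‖((j : ℝ) + 1)⁻¹ • x‖) ^ (-((n + d + 1 : ℕ) : ℝ))) =
          C * ‖y‖ ^ (d + 1) * ((j : ℝ) + 1 + ‖x‖) ^ (-((n + d + 1 : ℕ) : ℝ)) := by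
        have hR := hj0 j
        have hR' : ((j : ℝ) + 1) ≠ 0 := hR.ne'
        rw [norm_neg, norm_smul, norm_smul, Real.norm_of_nonneg (inv_pos.2 hR).le]
        have : (j : ℝ) + 1 + ‖x‖ = ((j : ℝ) + 1) * (1 + ((j : ℝ) + 1)⁻¹ * ‖x‖) := by
          field_simp
        rw [this, Real.rpow_neg (by positivity), Real.rpow_neg (by positivity),
          Real.rpow_natCast, Real.rpow_natCast, mul_pow, mul_pow, mul_inv, inv_pow,
          show n + d + 1 = n + (d + 1) by ring, pow_add ((j : ℝ) + 1) n, mul_inv]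
        ring
      calc _ ≤ |w x| * ((((j : ℝ) + 1) ^ n)⁻¹ * (C * ‖-(((j : ℝ) + 1)⁻¹ • y)‖ ^ (d + 1) *
          (1 + ‖((j : ℝ) + 1)⁻¹ • x‖) ^ (-((n + d + 1 : ℕ) : ℝ)))) := by
            have := hj0 j
            gcongr
        _ = _ := by rw [hid]; ring
    have hcκ : Continuous fun x : E n => κ (((j : ℝ) + 1)⁻¹ • (x - y)) := by fun_prop
    have hsumint : Integrable fun x => w x * ((((j : ℝ) + 1) ^ n)⁻¹ *
      ∑ i ∈ Finset.range (d + 1), (i.factorial : ℝ)⁻¹ *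
        iteratedFDeriv ℝ i κ (((j : ℝ) + 1)⁻¹ • x) (fun _ => -(((j : ℝ) + 1)⁻¹ • y))) := by
      have : (fun x => w x * ((((j : ℝ) + 1) ^ n)⁻¹ *
        ∑ i ∈ Finset.range (d + 1), (i.factorial : ℝ)⁻¹ *
        iteratedFDeriv ℝ i κ (((j : ℝ) + 1)⁻¹ • x) (fun _ => -(((j : ℝ) + 1)⁻¹ • y)))) =
        fun x => ∑ i ∈ Finset.range (d + 1), ((((j : ℝ) + 1) ^ n)⁻¹ * (i.factorial : ℝ)⁻¹) *
          (w x * iteratedFDeriv ℝ i κ (((j : ℝ) + 1)⁻¹ • x)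
            (fun _ => -(((j : ℝ) + 1)⁻¹ • y))) := by
        ext x
        rw [Finset.mul_sum, Finset.mul_sum]
        exact Finset.sum_congr rfl fun i _ => by ring
      rw [this]
      exact integrable_finsetSum _ fun i _ => (hint j i _).const_mul _
    have hremint : Integrable fun x => w x * ((((j : ℝ) + 1) ^ n)⁻¹ *
        taylorRem κ d (((j : ℝ) + 1)⁻¹ • x) (-(((j : ℝ) + 1)⁻¹ • y))) := by
      refine ((hQint j).const_mul (C * ‖y‖ ^ (d + 1))).mono' (hm.mul ?_)
        (Eventually.of_forall hptw)
      refine Continuous.aestronglyMeasurable (continuous_const.mul ?_)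
      unfold taylorRem
      refine Continuous.sub (by fun_prop) (continuous_finsetSum _ fun i _ => ?_)
      have := (κ.smooth i).continuous_iteratedFDeriv le_rfl
      fun_prop
    have hsplit : w y = P j y + ∫ x, w x * ((((j : ℝ) + 1) ^ n)⁻¹ *
        taylorRem κ d (((j : ℝ) + 1)⁻¹ • x) (-(((j : ℝ) + 1)⁻¹ • y))) := by
      rw [hPint, ← integral_add hsumint hremint, hy j]
      refine integral_congr_ae (Eventually.of_forall fun x => ?_)
      simp only
      rw [taylorRem, smul_sub, ← sub_eq_add_neg]
      ring
    have : P j y - w y = -∫ x, w x * ((((j : ℝ) + 1) ^ n)⁻¹ *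
        taylorRem κ d (((j : ℝ) + 1)⁻¹ • x) (-(((j : ℝ) + 1)⁻¹ • y))) := by linarith
    rw [this, abs_neg, ← Real.norm_eq_abs, hQ, ← integral_const_mul]
    exact norm_integral_le_of_norm_le ((hQint j).const_mul _) (Eventually.of_forall hptw)
  rw [tendsto_iff_norm_sub_tendsto_zero]
  refine squeeze_zero' (Eventually.of_forall fun j => norm_nonneg _) hdiff ?_
  simpa using hQlim.const_mul (C * ‖y‖ ^ (d + 1))

/-- **Liouville theorem.** A function of moderate growth whose Fourier transform is supported at
the origin is a polynomial. -/
theorem ae_eq_polyFun_of_fourier_support {n d : ℕ} {w : E n → ℝ} (hl : LocallyIntegrable w)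
    (hw : Integrable (fun x => |w x| * (1 + ‖x‖) ^ (-((n + d + 1 : ℕ) : ℝ))))
    (hker : ∀ h : 𝓢(E n, ℂ), HasCompactSupport h → (∃ r > 0, ∀ x, ‖x‖ < r → h x = 0) →
      ∫ x, w x • (𝓕⁻ h) x = 0) :
    ∃ p : MvPolynomial (Fin n) ℝ, p.totalDegree ≤ d ∧ ∀ᵐ y, w y = polyFun n p y := by
  refine ae_eq_polyFun_of_reproduced hl.aestronglyMeasurable hw
    (SchwartzMap.postcompCLM (𝕜 := ℝ) Complex.reCLM (𝓕⁻ (cutoffSchwartz n))) fun j => ?_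
  have hj : (0 : ℝ) < (j : ℝ) + 1 := by positivity
  filter_upwards [ae_eq_integral_mollifier hl hw hker hj] with y hy
  rw [hy]
  refine integral_congr_ae (Eventually.of_forall fun x => ?_)
  simp only [mollifier_apply n hj]
  rw [Complex.real_smul, Complex.re_ofReal_mul]
  rfl

/-! ### Solutions differ from their potential by a polynomial -/

/-- A Schwartz function supported away from the origin is divided by `(2π|ξ|)ⁿ`: it is the
transform of `(-Δ)^(n/2) φ` for a Schwartz function `φ`. -/
lemma exists_schwartz_fourier_div {n : ℕ} (h : 𝓢(E n, ℂ)) (hc : HasCompactSupport h)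
    (h0 : ∃ r > 0, ∀ x, ‖x‖ < r → h x = 0) :
    ∃ φ : 𝓢(E n, ℂ), ∀ ξ, h ξ = (((2 * Real.pi * ‖ξ‖) ^ n : ℝ) : ℂ) * 𝓕 φ ξ := by
  obtain ⟨r, hr, hz⟩ := h0
  set q : E n → ℂ := fun ξ => ((((2 * Real.pi * ‖ξ‖) ^ n)⁻¹ : ℝ) : ℂ) * h ξ with hq
  have hqs : ContDiff ℝ ∞ q := by
    rw [contDiff_iff_contDiffAt]
    intro ξ
    by_cases hξ : ξ = 0
    · have : q =ᶠ[𝓝 ξ] fun _ => 0 := by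
        have hm : ball (0 : E n) r ∈ 𝓝 ξ := by
          rw [hξ]
          exact ball_mem_nhds _ hr
        filter_upwards [hm] with y hy
        simp only [hq]
        rw [hz y (by simpa using hy), mul_zero]
      exact contDiffAt_const.congr_of_eventuallyEq this
    · have h1 : ContDiffAt ℝ ∞ (fun ξ : E n => ((2 * Real.pi * ‖ξ‖) ^ n)⁻¹) ξ := by
        refine ContDiffAt.inv ((contDiffAt_const.mul (contDiffAt_norm ℝ hξ)).pow n) ?_
        have := norm_pos_iff.2 hξ
        positivity
      exact (Complex.ofRealCLM.contDiff.contDiffAt.comp ξ h1).mul h.smooth'.contDiffAt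
  have hqc : HasCompactSupport q := hc.mul_left
  refine ⟨𝓕⁻ (hqc.toSchwartzMap hqs), fun ξ => ?_⟩
  rw [FourierTransform.fourier_fourierInv_eq]
  change h ξ = _ * q ξ
  by_cases hξ : ξ = 0
  · simp only [hq]
    rw [hz ξ (by simpa [hξ] using hr)]
    simp
  · have h1 : (2 * Real.pi * ‖ξ‖) ^ n ≠ 0 := by
      have := norm_pos_iff.2 hξ
      positivity
    simp only [hq]
    rw [← mul_assoc, ← Complex.ofReal_mul, mul_inv_cancel₀ h1]
    simp

lemma integrable_pot_mul_natPow {n : ℕ} (hn : 0 < n) {f : E n → ℝ} (hf : Integrable f) {N : ℕ}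
    (hN : n < N) : Integrable fun x => |pot f x| * (1 + ‖x‖) ^ (-(N : ℝ)) :=
  integrable_pot_mul hn hf (by exact_mod_cast hN)

lemma integrable_sub_pot_mul {n : ℕ} (hn : 0 < n) {u f : E n → ℝ} (hf : Integrable f)
    (hu : AEStronglyMeasurable u) {N : ℕ} (hN : n < N) (c : ℝ)
    (hui : Integrable fun x => |u x| * (1 + ‖x‖) ^ (-(N : ℝ))) :
    Integrable fun x => |u x - c * pot f x| * (1 + ‖x‖) ^ (-(N : ℝ)) := by
  have hpm := (locallyIntegrable_pot hn hf).aestronglyMeasurable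
  have hwt : Continuous fun x : E n => (1 + ‖x‖) ^ (-(N : ℝ)) :=
    (continuous_const.add continuous_norm).rpow_const fun x =>
      Or.inl (show 1 + ‖x‖ ≠ 0 by positivity)
  refine (hui.add ((integrable_pot_mul_natPow hn hf hN).const_mul |c|)).mono'
    (((hu.sub (hpm.const_mul c)).norm).mul hwt.aestronglyMeasurable)
    (Eventually.of_forall fun x => ?_)
  rw [Real.norm_of_nonneg (by positivity)]
  simp only [Pi.add_apply]
  rw [← mul_assoc, ← add_mul, ← abs_mul]
  gcongr
  exact abs_sub _ _

/-- For odd `n` a solution differs from its logarithmic potential by a polynomial of degree at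
most `n - 1`; the degree is controlled by the weight in the definition of `L_(n/2)`. -/
lemma exists_poly_of_odd {n : ℕ} (hn : 0 < n) {u f : E n → ℝ} (ho : Odd n) (hf : Integrable f)
    (hu : IsSolution n n u f) : ∃ p : MvPolynomial (Fin n) ℝ, p.totalDegree ≤ n - 1 ∧
      ∀ᵐ x, u x - 1 / gammaConst n * pot f x = polyFun n p x := by
  obtain ⟨⟨hul, hui⟩, hsol⟩ := hu.2 ho
  have hγ := gammaConst_pos hn
  -- The weight of `L_(n/2)` decays like `|x|^(-2n)`, and `2n = n + d + 1` for `d = n - 1`.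
  have hN : n + (n - 1) + 1 = 2 * n := by omega
  have hwt : ∀ N : ℕ, Continuous fun x : E n => (1 + ‖x‖) ^ (-(N : ℝ)) := fun N =>
    (continuous_const.add continuous_norm).rpow_const fun x =>
      Or.inl (show 1 + ‖x‖ ≠ 0 by positivity)
  have hui2 : Integrable fun x => |u x| * (1 + ‖x‖) ^ (-((n + (n - 1) + 1 : ℕ) : ℝ)) := by
    refine hui.mono' (hul.aestronglyMeasurable.norm.mul (hwt _).aestronglyMeasurable)
      (Eventually.of_forall fun x => ?_)
    rw [Real.norm_of_nonneg (by positivity), hN, div_eq_mul_inv]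
    refine mul_le_mul_of_nonneg_left ?_ (abs_nonneg _)
    rw [show (n : ℝ) + 2 * ((n : ℝ) / 2) = ((2 * n : ℕ) : ℝ) by push_cast; ring,
      Real.rpow_neg (by positivity), Real.rpow_natCast, Real.rpow_natCast]
    refine inv_anti₀ (by positivity) ?_
    have := pow_add_pow_le (x := (1 : ℝ)) (y := ‖x‖) zero_le_one (norm_nonneg x)
      (n := 2 * n) (by omega)
    simpa using this
  have hwi := integrable_sub_pot_mul hn hf hul.aestronglyMeasurable (by omega)
    (1 / gammaConst n) hui2
  refine ae_eq_polyFun_of_fourier_support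
    (hul.sub ((locallyIntegrable_pot hn hf).smul (1 / gammaConst n))) hwi fun h hc h0 => ?_
  obtain ⟨φ, hφ⟩ := exists_schwartz_fourier_div h hc h0
  have h1 := hsol φ
  have h2 := integral_pot_smul hn hf φ (𝓕⁻ h) fun ξ => by
    have := hφ ξ
    rw [← SchwartzMap.fourier_coe, FourierTransform.fourier_fourierInv_eq,
      ← SchwartzMap.fourier_coe]
    exact this
  have h3 : ∀ x, fracLaplacian n n φ x = (𝓕⁻ h) x := by
    intro x
    have : (fun ξ : E n => (((2 * Real.pi * ‖ξ‖) ^ (n : ℝ) : ℝ) : ℂ) * 𝓕 (fun x : E n => φ x) ξ) =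
        h := funext fun ξ => by
      rw [hφ ξ, Real.rpow_natCast, SchwartzMap.fourier_coe]
    rw [fracLaplacian, SchwartzMap.fourierInv_coe, this]
  have i1 := integrable_smul_schwartz hul.aestronglyMeasurable hui2 (𝓕⁻ h)
  have i2 := integrable_smul_schwartz (locallyIntegrable_pot hn hf).aestronglyMeasurable
    (integrable_pot_mul_natPow hn hf (N := n + 1) (by omega)) (𝓕⁻ h)
  have h4 : ∀ x, (u x - 1 / gammaConst n * pot f x) • (𝓕⁻ h) x =
      u x • (𝓕⁻ h) x - (1 / gammaConst n) • (pot f x • (𝓕⁻ h) x) := fun x => by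
    rw [sub_smul, smul_smul]
  simp only [h4]
  have i3 := i2.fun_smul (1 / gammaConst n)
  rw [integral_sub i1 i3, integral_smul, h2, smul_smul, one_div,
    inv_mul_cancel₀ hγ.ne', one_smul]
  simp only [h3] at h1
  simp only [Complex.real_smul]
  rw [h1, sub_self]

/-- A tempered weak solution of `(-Δ)^k w = 0`, tested on compactly supported functions, may be
tested on Schwartz functions. -/
lemma integral_smul_negLap_pow_eq_zero {n k N : ℕ} {w : E n → ℝ} (hm : AEStronglyMeasurable w)
    (hw : Integrable (fun x => |w x| * (1 + ‖x‖) ^ (-(N : ℝ))))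
    (hharm : ∀ φ : E n → ℝ, ContDiff ℝ ∞ φ → HasCompactSupport φ →
      ∫ x, w x * negLaplacianPow n k φ x = 0) (Φ : 𝓢(E n, ℂ)) :
    ∫ x, w x • (negLap n ^ k) Φ x = 0 := by
  have hreal : ∀ φ : E n → ℝ, ∀ h1 : ContDiff ℝ ∞ φ, ∀ h2 : HasCompactSupport φ,
      ∫ x, w x • (negLap n ^ k) (toComplexSchwartz h1 h2) x = 0 := by
    intro φ h1 h2
    have : ∀ x, w x • (negLap n ^ k) (toComplexSchwartz h1 h2) x =
        ((w x * negLaplacianPow n k φ x : ℝ) : ℂ) := fun x => by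
      rw [negLap_pow_toComplexSchwartz, Complex.real_smul, Complex.ofReal_mul]
    simp only [this]
    rw [integral_complex_ofReal, hharm φ h1 h2, Complex.ofReal_zero]
  have hcomp : ∀ Ψ : 𝓢(E n, ℂ), HasCompactSupport Ψ →
      temperedFunctional w hm hw ((negLap n ^ k) Ψ) = 0 := by
    intro Ψ hΨ
    have a1 : ContDiff ℝ ∞ fun x => (Ψ x).re := Complex.reCLM.contDiff.comp Ψ.smooth'
    have a2 : HasCompactSupport fun x => (Ψ x).re := hΨ.comp_left (g := Complex.re) rfl
    have b1 : ContDiff ℝ ∞ fun x => (Ψ x).im := Complex.imCLM.contDiff.comp Ψ.smooth'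
    have b2 : HasCompactSupport fun x => (Ψ x).im := hΨ.comp_left (g := Complex.im) rfl
    have hsum : Ψ = toComplexSchwartz a1 a2 + Complex.I • toComplexSchwartz b1 b2 := by
      ext x
      rw [_root_.add_apply, _root_.smul_apply, toComplexSchwartz_apply, toComplexSchwartz_apply,
        smul_eq_mul, mul_comm]
      exact (Complex.re_add_im _).symm
    have ha := hreal _ a1 a2
    have hb := hreal _ b1 b2
    rw [hsum, map_add, map_smul, map_add, map_smul, temperedFunctional_apply,
      temperedFunctional_apply, ha, hb, smul_zero, add_zero]
  have ht := tendsto_smulLeftCLM_dilate (cutoffSchwartz n).hasTemperateGrowth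
    (fun x hx => by rw [cutoffSchwartz_apply, cutoff_one hx.le]; simp) Φ
  have hcont : Continuous fun g : 𝓢(E n, ℂ) => temperedFunctional w hm hw ((negLap n ^ k) g) :=
    (temperedFunctional w hm hw).continuous.comp (negLap n ^ k).continuous
  have hlim := (hcont.tendsto Φ).comp ht
  refine tendsto_nhds_unique hlim (tendsto_const_nhds.congr fun j => (hcomp _ ?_).symm)
  have hd : (fun x : E n => cutoffSchwartz n (((j : ℝ) + 1)⁻¹ • x)).HasTemperateGrowth := by
    have := (cutoffSchwartz n).hasTemperateGrowth
    fun_prop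
  have hc : HasCompactSupport fun x : E n => cutoffSchwartz n (((j : ℝ) + 1)⁻¹ • x) := by
    have h2 : HasCompactSupport (cutoffSchwartz n) :=
      ((cutoff n).hasCompactSupport.comp_left (g := fun r : ℝ => (r : ℂ)) (by simp))
    exact h2.comp_smul (by positivity)
  have : (SchwartzMap.smulLeftCLM ℂ
    (fun x => cutoffSchwartz n (((j : ℝ) + 1)⁻¹ • x)) Φ : E n → ℂ) =
      (fun x : E n => cutoffSchwartz n (((j : ℝ) + 1)⁻¹ • x)) * Φ := funext fun x => by
    rw [SchwartzMap.smulLeftCLM_apply_apply hd]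
    rfl
  rw [this]
  exact hc.mul_right

/-- For even `n` a solution differs from its logarithmic potential by a polynomial. -/
lemma exists_poly_of_tempered {n N : ℕ} (he : Even n) {w : E n → ℝ} (hl : LocallyIntegrable w)
    (hw : Integrable (fun x => |w x| * (1 + ‖x‖) ^ (-(N : ℝ))))
    (hharm : ∀ φ : E n → ℝ, ContDiff ℝ ∞ φ → HasCompactSupport φ →
      ∫ x, w x * negLaplacianPow n (n / 2) φ x = 0) :
    ∃ p : MvPolynomial (Fin n) ℝ, ∀ᵐ x, w x = polyFun n p x := by
  have hwt : Continuous fun x : E n => (1 + ‖x‖) ^ (-((n + N + 1 : ℕ) : ℝ)) :=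
    (continuous_const.add continuous_norm).rpow_const fun x =>
      Or.inl (show 1 + ‖x‖ ≠ 0 by positivity)
  have hw2 : Integrable (fun x => |w x| * (1 + ‖x‖) ^ (-((n + N + 1 : ℕ) : ℝ))) := by
    refine hw.mono' (hl.aestronglyMeasurable.norm.mul hwt.aestronglyMeasurable)
      (Eventually.of_forall fun x => ?_)
    rw [Real.norm_of_nonneg (by positivity)]
    refine mul_le_mul_of_nonneg_left ?_ (abs_nonneg _)
    exact Real.rpow_le_rpow_of_exponent_le (by simp)
      (by push_cast; linarith [Nat.cast_nonneg (α := ℝ) n])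
  obtain ⟨p, -, hp⟩ := ae_eq_polyFun_of_fourier_support hl hw2 fun h hc h0 => by
    obtain ⟨φ, hφ⟩ := exists_schwartz_fourier_div h hc h0
    have h1 : 𝓕⁻ h = (negLap n ^ (n / 2)) φ := by
      have : h = 𝓕 ((negLap n ^ (n / 2)) φ) := by
        ext ξ
        have h2 := fourier_negLap_pow (n / 2) φ ξ
        rw [Nat.two_mul_div_two_of_even he] at h2
        rw [hφ ξ, h2]
      rw [this, FourierTransform.fourierInv_fourier_eq]
    rw [h1]
    exact integral_smul_negLap_pow_eq_zero hl.aestronglyMeasurable hw hharm φ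
  exact ⟨p, hp⟩

/-! ### Polynomials of logarithmic growth -/

lemma abs_coord_le_norm {n : ℕ} (x : E n) (i : Fin n) : |x i| ≤ ‖x‖ := by
  have := PiLp.norm_apply_le (p := 2) x i
  simpa using this

lemma exists_polyFun_growth {n : ℕ} (p : MvPolynomial (Fin n) ℝ) :
    ∃ (C : ℝ) (k : ℕ), 0 ≤ C ∧ (∀ x, |polyFun n p x| ≤ C * (1 + ‖x‖) ^ k) ∧
      ∀ x y : E n, ‖y - x‖ ≤ 1 →
        |polyFun n p y - polyFun n p x| ≤ C * (1 + ‖x‖) ^ k * ‖y - x‖ := by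
  induction p using MvPolynomial.induction_on with
  | C a => exact ⟨|a|, 0, abs_nonneg _, fun x => by simp [polyFun], fun x y _ => by
      simp only [polyFun, MvPolynomial.eval_C, sub_self, abs_zero]
      positivity⟩
  | add p q hp hq =>
    obtain ⟨C, k, hC, h1, h2⟩ := hp
    obtain ⟨D, l, hD, h3, h4⟩ := hq
    have key : ∀ x : E n, C * (1 + ‖x‖) ^ k + D * (1 + ‖x‖) ^ l ≤
        (C + D) * (1 + ‖x‖) ^ (k + l) := fun x => by
      have hx : 1 ≤ 1 + ‖x‖ := by simp
      rw [add_mul]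
      gcongr <;> first | exact hx | omega
    refine ⟨C + D, k + l, by positivity, fun x => ?_, fun x y hxy => ?_⟩
    · simp only [polyFun, map_add]
      exact (abs_add_le _ _).trans ((add_le_add (h1 x) (h3 x)).trans (key x))
    · simp only [polyFun, map_add]
      rw [add_sub_add_comm]
      refine (abs_add_le _ _).trans ((add_le_add (h2 x y hxy) (h4 x y hxy)).trans ?_)
      rw [← add_mul]
      exact mul_le_mul_of_nonneg_right (key x) (norm_nonneg _)
  | mul_X p i hp =>
    obtain ⟨C, k, hC, h1, h2⟩ := hp
    refine ⟨2 * C, k + 1, by positivity, fun x => ?_, fun x y hxy => ?_⟩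
    · simp only [polyFun, map_mul, MvPolynomial.eval_X]
      rw [abs_mul]
      calc _ ≤ C * (1 + ‖x‖) ^ k * (1 + ‖x‖) :=
            mul_le_mul (h1 x) ((abs_coord_le_norm x i).trans (by linarith)) (abs_nonneg _)
              (by positivity)
        _ ≤ 2 * (C * (1 + ‖x‖) ^ k * (1 + ‖x‖)) :=
            le_mul_of_one_le_left (by positivity) one_le_two
        _ = _ := by ring
    · simp only [polyFun, map_mul, MvPolynomial.eval_X]
      have e : MvPolynomial.eval (fun i => y i) p * y i - MvPolynomial.eval (fun i => x i) p * x i =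
          (polyFun n p y - polyFun n p x) * y i + polyFun n p x * (y - x) i := by
        simp only [polyFun, PiLp.sub_apply]
        ring
      have hy : |y i| ≤ 1 + ‖x‖ := (abs_coord_le_norm y i).trans (by
        linarith [norm_le_norm_add_norm_sub' y x])
      rw [e]
      refine (abs_add_le _ _).trans ?_
      rw [abs_mul, abs_mul]
      calc _ ≤ C * (1 + ‖x‖) ^ k * ‖y - x‖ * (1 + ‖x‖) + C * (1 + ‖x‖) ^ k * ‖y - x‖ := by
            gcongr
            · exact h2 x y hxy
            · exact h1 x
            · exact abs_coord_le_norm _ _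
        _ ≤ C * (1 + ‖x‖) ^ k * ‖y - x‖ * (1 + ‖x‖) +
            C * (1 + ‖x‖) ^ k * ‖y - x‖ * (1 + ‖x‖) :=
            add_le_add le_rfl (le_mul_of_one_le_right (by positivity) (by simp))
        _ = _ := by ring

lemma continuous_polyFun {n : ℕ} (p : MvPolynomial (Fin n) ℝ) : Continuous (polyFun n p) := by
  unfold polyFun
  exact (MvPolynomial.continuous_eval p).comp (by fun_prop)

lemma hasFDerivAt_polyFun {n : ℕ} (p : MvPolynomial (Fin n) ℝ) (x : E n) :
    HasFDerivAt (polyFun n p)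
      (∑ i, polyFun n (MvPolynomial.pderiv i p) x • (EuclideanSpace.proj i : E n →L[ℝ] ℝ)) x := by
  induction p using MvPolynomial.induction_on with
  | C a =>
    have h1 : polyFun n (MvPolynomial.C a) = fun _ => a := by ext x; simp [polyFun]
    rw [h1]
    simpa [polyFun] using hasFDerivAt_const a x
  | add p q hp hq =>
    have h1 : polyFun n (p + q) = fun x => polyFun n p x + polyFun n q x := by
      ext x; simp [polyFun]
    rw [h1]
    refine (hp.add hq).congr_fderiv ?_
    rw [← Finset.sum_add_distrib]
    refine Finset.sum_congr rfl fun i _ => ?_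
    rw [← add_smul]
    simp [polyFun]
  | mul_X p j hp =>
    have h1 : polyFun n (p * MvPolynomial.X j) = fun x => polyFun n p x * x j := by
      ext x; simp [polyFun]
    rw [h1]
    refine (hp.mul ((EuclideanSpace.proj j : E n →L[ℝ] ℝ).hasFDerivAt)).congr_fderiv ?_
    ext v
    simp only [polyFun, MvPolynomial.pderiv_mul, MvPolynomial.pderiv_X, map_add, map_mul,
      MvPolynomial.eval_X, add_apply, smul_apply, sum_apply, smul_eq_mul, add_mul,
      Finset.sum_add_distrib, PiLp.proj_apply]
    rw [add_comm]
    congr 1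
    · rw [Finset.mul_sum]
      exact Finset.sum_congr rfl fun i _ => by ring
    · rw [Finset.sum_eq_single j]
      · simp
      · intro b _ hb
        simp [hb.symm]
      · simp

/-- An upper bound of logarithmic growth for a polynomial `p` with `e^(c p)` integrable against a
power weight: by the Lipschitz bound, `p` is large on a ball of polynomially small radius. -/
lemma polyFun_le_log {n : ℕ} (p : MvPolynomial (Fin n) ℝ) {c : ℝ} (hc : 0 < c) (N : ℕ)
    (hint : Integrable fun x => Real.exp (c * polyFun n p x) * (1 + ‖x‖) ^ (-(N : ℝ))) :
    ∃ A B : ℝ, 0 ≤ B ∧ ∀ x : E n, polyFun n p x ≤ A + B * Real.log (1 + ‖x‖) := by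
  obtain ⟨C, k, hC, -, hlip⟩ := exists_polyFun_growth p
  set I := ∫ x, Real.exp (c * polyFun n p x) * (1 + ‖x‖) ^ (-(N : ℝ)) with hI
  set V := (volume : Measure (E n)).real (ball 0 1) with hV
  have hV0 : 0 < V := ENNReal.toReal_pos (measure_ball_pos _ _ one_pos).ne' measure_ball_lt_top.ne
  set D := I * 2 ^ N * (C + 1) ^ n / V with hD
  have key : ∀ x : E n, Real.exp (c * (polyFun n p x - 1)) ≤ D * (1 + ‖x‖) ^ (N + k * n) := by
    intro x
    have hX : 1 ≤ 1 + ‖x‖ := by simp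
    -- On the ball of this radius `p` varies by at most `1`.
    set r := ((C + 1) * (1 + ‖x‖) ^ k)⁻¹ with hr
    have hr0 : 0 < r := by positivity
    have hr1 : r ≤ 1 := inv_le_one_of_one_le₀ (one_le_mul_of_one_le_of_one_le (by linarith)
      (one_le_pow₀ hX))
    have hlow : ∀ y ∈ ball x r, Real.exp (c * (polyFun n p x - 1)) *
        ((2 * (1 + ‖x‖)) ^ N)⁻¹ ≤ Real.exp (c * polyFun n p y) * (1 + ‖y‖) ^ (-(N : ℝ)) := by
      intro y hy
      rw [mem_ball, dist_eq_norm] at hy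
      have h1 := hlip x y (hy.le.trans hr1)
      have h2 : C * (1 + ‖x‖) ^ k * ‖y - x‖ ≤ 1 := by
        calc _ ≤ ((C + 1) * (1 + ‖x‖) ^ k) * r := by gcongr; linarith
          _ = 1 := mul_inv_cancel₀ (by positivity)
      have h3 : polyFun n p x - 1 ≤ polyFun n p y := by
        have := (abs_le.1 (h1.trans h2)).1
        linarith
      have h4 : 1 + ‖y‖ ≤ 2 * (1 + ‖x‖) := by
        linarith [norm_le_norm_add_norm_sub' y x]
      rw [Real.rpow_neg (by positivity), Real.rpow_natCast]
      gcongr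
    have h5 : V * r ^ n * (Real.exp (c * (polyFun n p x - 1)) * ((2 * (1 + ‖x‖)) ^ N)⁻¹) ≤ I := by
      calc _ = ∫ _ in ball x r, Real.exp (c * (polyFun n p x - 1)) *
            ((2 * (1 + ‖x‖)) ^ N)⁻¹ := by
            rw [setIntegral_const, measureReal_def, Measure.addHaar_ball_of_pos _ _ hr0,
              finrank_euclideanSpace_fin, ENNReal.toReal_mul,
              ENNReal.toReal_ofReal (by positivity), smul_eq_mul, hV, measureReal_def,
              mul_comm (r ^ n)]
        _ ≤ ∫ y in ball x r, Real.exp (c * polyFun n p y) * (1 + ‖y‖) ^ (-(N : ℝ)) :=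
            setIntegral_mono_on (integrableOn_const (by simp [measure_ball_lt_top.ne]))
              hint.integrableOn measurableSet_ball hlow
        _ ≤ I := setIntegral_le_integral hint (Eventually.of_forall fun y => by positivity)
    have h6 : Real.exp (c * (polyFun n p x - 1)) * (V * r ^ n * ((2 * (1 + ‖x‖)) ^ N)⁻¹) ≤ I := by
      linarith [h5]
    rw [← le_div_iff₀ (by positivity)] at h6
    refine h6.trans (le_of_eq ?_)
    rw [hD, hr, inv_pow, mul_pow, mul_pow, pow_add, ← pow_mul]
    field_simp
  have hD0 : 0 < D := by
    have h1 := (Real.exp_pos _).trans_le (key 0)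
    simpa using h1
  refine ⟨1 + Real.log D / c, (N + k * n : ℕ) / c, by positivity, fun x => ?_⟩
  have h1 := Real.log_le_log (Real.exp_pos _) (key x)
  have hX : 0 < 1 + ‖x‖ := by positivity
  rw [Real.log_exp, Real.log_mul hD0.ne' (by positivity), Real.log_pow, ← le_div_iff₀' hc] at h1
  have h2 : (Real.log D + ((N + k * n : ℕ) : ℝ) * Real.log (1 + ‖x‖)) / c =
      Real.log D / c + ((N + k * n : ℕ) : ℝ) / c * Real.log (1 + ‖x‖) := by ring
  linarith

open Polynomial in
/-- Along an algebraic curve `Q(s, y) = 0` with `s → ∞`, a branch `y → ∞` cannot be bounded by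
`log s`. -/
lemma false_of_algebraic_log {Q : ℝ[X][X]} (hQ : Q ≠ 0) {s y : ℕ → ℝ}
    (hs : Tendsto s atTop atTop) (hy : Tendsto y atTop atTop) {A B : ℝ}
    (hle : ∀ j, y j ≤ A + B * Real.log (s j)) (hz : ∀ j, Q.evalEval (s j) (y j) = 0) : False := by
  -- As a polynomial in `s` with coefficients in `ℝ[y]`; its leading coefficient tends to zero along
  -- the curve.
  set Q' := Bivariate.swap Q with hQ'
  have hQ'0 : Q' ≠ 0 := by
    rw [hQ', Ne, EmbeddingLike.map_eq_zero_iff]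
    exact hQ
  have hz' : ∀ j, ∑ k ∈ Finset.range (Q'.natDegree + 1), (Q'.coeff k).eval (y j) * s j ^ k = 0 := by
    intro j
    have h1 : Q'.evalEval (y j) (s j) = 0 := by
      rw [← coe_aevalAeval_eq_evalEval, hQ', Bivariate.aevalAeval_swap,
        coe_aevalAeval_eq_evalEval, hz]
    rw [evalEval, eval_eq_sum_range (p := Q'), eval_finsetSum] at h1
    simpa using h1
  -- Every power of `y` is negligible with respect to `s`.
  have hpow : ∀ m : ℕ, Tendsto (fun j => y j ^ m / s j) atTop (𝓝 0) := by
    intro m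
    have h1 : Tendsto (fun j => (|A| + |B|) ^ m * (Real.log (s j) ^ m / s j)) atTop (𝓝 0) := by
      have := (Real.isLittleO_pow_log_id_atTop (n := m)).tendsto_div_nhds_zero.comp hs
      simpa using this.const_mul ((|A| + |B|) ^ m)
    refine squeeze_zero' ?_ ?_ h1
    · filter_upwards [hs.eventually_ge_atTop 1, hy.eventually_ge_atTop 0] with j h2 h3
      positivity
    · filter_upwards [hs.eventually_ge_atTop (Real.exp 1), hy.eventually_ge_atTop 0] with j h2 h3
      have h4 : 1 ≤ Real.log (s j) := by
        rw [Real.le_log_iff_exp_le ((Real.exp_pos 1).trans_le h2)]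
        exact h2
      have h5 : y j ≤ (|A| + |B|) * Real.log (s j) := by
        have ha := le_abs_self A
        have hb := le_abs_self B
        have := hle j
        nlinarith [abs_nonneg A]
      have h6 : 0 < s j := (Real.exp_pos 1).trans_le h2
      rw [← mul_div_assoc, ← mul_pow]
      gcongr
  have hcoef : ∀ q : ℝ[X], Tendsto (fun j => q.eval (y j) / s j) atTop (𝓝 0) := by
    intro q
    have h1 : ∀ j, q.eval (y j) / s j =
        ∑ i ∈ Finset.range (q.natDegree + 1), q.coeff i * (y j ^ i / s j) := fun j => by
      rw [eval_eq_sum_range, Finset.sum_div]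
      exact Finset.sum_congr rfl fun i _ => by ring
    simp only [h1]
    have := tendsto_finsetSum (Finset.range (q.natDegree + 1))
      fun i _ => (hpow i).const_mul (q.coeff i)
    simpa using this
  have hlead : Tendsto (fun j => Q'.leadingCoeff.eval (y j)) atTop (𝓝 0) := by
    have h2 : Tendsto (fun j => -∑ k ∈ Finset.range Q'.natDegree,
        (Q'.coeff k).eval (y j) * s j ^ k / s j ^ Q'.natDegree) atTop (𝓝 0) := by
      rw [← neg_zero]
      refine Tendsto.neg ?_
      rw [← Finset.sum_const_zero (s := Finset.range Q'.natDegree)]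
      refine tendsto_finsetSum _ fun k hk => ?_
      have hk' := Finset.mem_range.1 hk
      refine squeeze_zero_norm' ?_ (tendsto_zero_iff_norm_tendsto_zero.1 (hcoef (Q'.coeff k)))
      filter_upwards [hs.eventually_ge_atTop 1] with j h3
      have h4 : 0 < s j := by linarith
      rw [norm_div, norm_mul, norm_div, norm_pow, norm_pow, Real.norm_of_nonneg h4.le,
        div_le_div_iff₀ (by positivity) h4, mul_assoc, ← pow_succ]
      gcongr
      exact hk'
    refine h2.congr' ?_
    filter_upwards [hs.eventually_ge_atTop 1] with j h3
    have h4 : s j ^ Q'.natDegree ≠ 0 := by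
      have : 0 < s j := by linarith
      positivity
    have h5 := hz' j
    rw [Finset.sum_range_succ, coeff_natDegree] at h5
    rw [← Finset.sum_div, ← neg_div, div_eq_iff h4]
    linarith
  have hL0 : Q'.leadingCoeff ≠ 0 := leadingCoeff_ne_zero.2 hQ'0
  rcases lt_or_ge 0 Q'.leadingCoeff.degree with hd | hd
  · have h1 := (Polynomial.abs_tendsto_atTop _ hd).comp hy
    have h2 := hlead.abs
    rw [abs_zero] at h2
    exact not_tendsto_nhds_of_tendsto_atTop h1 0 h2
  · rw [eq_C_of_degree_le_zero hd] at hlead hL0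
    simp only [eval_C] at hlead
    have := tendsto_nhds_unique hlead tendsto_const_nhds
    rw [← this] at hL0
    simp at hL0

open Polynomial in
/-- If points `x_j` satisfy `x_j(i)^m = s_j q_i(x_j)` with `deg q_i < m`, then the values of a
polynomial at `x_j` and the parameter `s_j` are algebraically dependent: the relations allow to
write every monomial in terms of the finitely many ones with all exponents below `m`. -/
lemma exists_algebraic_relation {n m : ℕ} {s : ℕ → ℝ} {x : ℕ → E n}
    (q : Fin n → MvPolynomial (Fin n) ℝ) (hq : ∀ i, (q i).totalDegree < m)
    (hx : ∀ j i, x j i ^ m = s j * polyFun n (q i) (x j)) (p : MvPolynomial (Fin n) ℝ) :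
    ∃ Q : ℝ[X][X], Q ≠ 0 ∧ ∀ j, Q.evalEval (s j) (polyFun n p (x j)) = 0 := by
  let φ : ℝ[X] →+* (ℕ → ℝ) := RingHom.pi fun j => evalRingHom (s j)
  let _ : Algebra ℝ[X] (ℕ → ℝ) := φ.toAlgebra
  let ψ : MvPolynomial (Fin n) ℝ →+* (ℕ → ℝ) :=
    RingHom.pi fun j => MvPolynomial.eval fun i => x j i
  have hφ : ∀ (r : ℝ[X]) (b : ℕ → ℝ) (j : ℕ), (r • b) j = r.eval (s j) * b j := fun r b j => by
    rw [Algebra.smul_def]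
    rfl
  have hψ : ∀ (r : MvPolynomial (Fin n) ℝ) j, ψ r j = polyFun n r (x j) := fun r j => rfl
  set F : Set (Fin n →₀ ℕ) := {β | ∀ i, β i < m} with hF
  have hFfin : F.Finite := by
    have h1 : (Set.Iic (Finsupp.equivFunOnFinite.symm fun _ : Fin n => m)).Finite :=
      Set.finite_Iic _
    exact h1.subset fun β hβ i => (hβ i).le
  set S : Submodule ℝ[X] (ℕ → ℝ) :=
    Submodule.span ℝ[X] ((fun β => ψ (MvPolynomial.monomial β 1)) '' F) with hS
  -- All polynomials are combinations of reduced monomials, by induction on the degree.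
  have hred : ∀ d : ℕ, ∀ r : MvPolynomial (Fin n) ℝ, r.totalDegree < d → ψ r ∈ S := by
    intro d
    induction d with
    | zero => intro r hr; omega
    | succ d ih =>
      intro r hr
      have hmon : ∀ β : Fin n →₀ ℕ, (β.sum fun _ e => e) ≤ d →
          ψ (MvPolynomial.monomial β 1) ∈ S := by
        intro β hβ
        by_cases hβF : β ∈ F
        · exact Submodule.subset_span ⟨β, hβF, rfl⟩
        · simp only [hF, Set.mem_ofPred_eq, not_forall, not_lt] at hβF
          obtain ⟨i, hi⟩ := hβF
          set β' := β - Finsupp.single i m with hβ'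
          have hsum : β = Finsupp.single i m + β' := by
            rw [hβ', add_tsub_cancel_of_le]
            exact Finsupp.single_le_iff.2 hi
          have hdeg : (β.sum fun _ e => e) = m + β'.sum fun _ e => e := by
            rw [hsum, Finsupp.sum_add_index' (fun _ => rfl) (fun _ _ _ => rfl),
              Finsupp.sum_single_index rfl]
          have hval : ψ (MvPolynomial.monomial β 1) =
              (X : ℝ[X]) • ψ (q i * MvPolynomial.monomial β' 1) := by
            ext j
            have h1 : MvPolynomial.monomial β (1 : ℝ) =
                MvPolynomial.X i ^ m * MvPolynomial.monomial β' 1 := by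
              rw [MvPolynomial.X_pow_eq_monomial, MvPolynomial.monomial_mul, ← hsum, one_mul]
            rw [hφ, h1, map_mul, map_mul, Pi.mul_apply, Pi.mul_apply, map_pow, Pi.pow_apply,
              eval_X, ← mul_assoc, hψ, hψ (q i)]
            congr 1
            rw [← hx j i]
            simp [polyFun]
          rw [hval]
          refine Submodule.smul_mem _ _ (ih _ ?_)
          have h2 := MvPolynomial.totalDegree_mul (q i) (MvPolynomial.monomial β' (1 : ℝ))
          rw [MvPolynomial.totalDegree_monomial _ one_ne_zero] at h2
          have h3 := hq i
          omega
      rw [r.as_sum, map_sum]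
      refine Submodule.sum_mem _ fun β hβ => ?_
      have h1 : MvPolynomial.monomial β (r.coeff β) =
          MvPolynomial.C (r.coeff β) * MvPolynomial.monomial β 1 := by
        rw [MvPolynomial.C_mul_monomial, mul_one]
      have h2 : ψ (MvPolynomial.monomial β (r.coeff β)) =
          (C (r.coeff β) : ℝ[X]) • ψ (MvPolynomial.monomial β 1) := by
        ext j
        rw [h1, map_mul, hφ, Pi.mul_apply, eval_C, hψ]
        simp [polyFun]
      rw [h2]
      exact Submodule.smul_mem _ _ (hmon β
        ((MvPolynomial.le_totalDegree hβ).trans (Nat.lt_succ_iff.1 hr)))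
  have hall : ∀ r, ψ r ∈ S := fun r => hred _ r (Nat.lt_succ_self _)
  have hmul : ∀ a b, a ∈ S → b ∈ S → a * b ∈ S := by
    intro a b ha hb
    have h1 : S * S ≤ S := by
      rw [hS, Submodule.span_mul_span]
      refine Submodule.span_le.2 ?_
      rintro _ ⟨_, ⟨β, -, rfl⟩, _, ⟨β', -, rfl⟩, rfl⟩
      change ψ _ * ψ _ ∈ S
      rw [← map_mul]
      exact hall _
    exact h1 (Submodule.mul_mem_mul ha hb)
  have hone : (1 : ℕ → ℝ) ∈ S := by
    rw [← map_one ψ]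
    exact hall 1
  have hint : IsIntegral ℝ[X] (ψ p) :=
    IsIntegral.of_mem_of_fg (S.toSubalgebra hone hmul)
      (by rw [Submodule.toSubalgebra_toSubmodule]; exact Submodule.fg_span (hFfin.image _))
      (ψ p) (hall p)
  obtain ⟨Q, hQm, hQ⟩ := hint
  refine ⟨Q, hQm.ne_zero, fun j => ?_⟩
  have h1 := congrArg (Pi.evalRingHom (fun _ : ℕ => ℝ) j) hQ
  rw [hom_eval₂, map_zero] at h1
  rw [← eval₂_evalRingHom]
  exact h1

lemma totalDegree_pderiv_le {σ : Type*} (p : MvPolynomial σ ℝ) (i : σ) :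
    (MvPolynomial.pderiv i p).totalDegree ≤ p.totalDegree := by
  refine Finset.sup_le fun m hm => ?_
  rw [MvPolynomial.mem_support_iff, MvPolynomial.coeff_pderiv] at hm
  have h1 := MvPolynomial.le_totalDegree (MvPolynomial.mem_support_iff.2 (left_ne_zero_of_mul hm))
  rw [Finsupp.sum_add_index' (fun _ => rfl) (fun _ _ _ => rfl)] at h1
  omega

lemma sum_pow_coord_ge {n : ℕ} (l : ℕ) (x : E n) :
    ‖x‖ ^ (2 * (l + 1)) / (n : ℝ) ^ l ≤ ∑ i, x i ^ (2 * (l + 1)) := by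
  have h := pow_sum_div_card_le_sum_pow (s := (Finset.univ : Finset (Fin n)))
    (f := fun i => x i ^ 2) (fun i _ => sq_nonneg _) l
  rw [← EuclideanSpace.real_norm_sq_eq, Finset.card_univ, Fintype.card_fin] at h
  simpa only [pow_mul] using h

/-- A polynomial bounded above by a multiple of `log |x|` is bounded above. Maximizing
`p - ε ∑ xᵢ^D` as `ε → 0` would otherwise trace an algebraic curve on which `p` tends to infinity
at most logarithmically. -/
theorem bddAbove_of_le_log {n : ℕ} (hn : 0 < n) (p : MvPolynomial (Fin n) ℝ) {A B : ℝ} (hB : 0 ≤ B)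
    (hle : ∀ x : E n, polyFun n p x ≤ A + B * Real.log (1 + ‖x‖)) :
    BddAbove (range (polyFun n p)) := by
  by_contra hnb
  obtain ⟨C, k, hC, hgr, -⟩ := exists_polyFun_growth p
  -- The even exponent `D` exceeds the growth exponent of `p`, and `deg p < D - 1`.
  set l := k + p.totalDegree with hl
  set D := 2 * (l + 1) with hD
  have hn0 : (0 : ℝ) < (n : ℝ) ^ l := by positivity
  set S : E n → ℝ := fun x => ∑ i, x i ^ D with hS
  have hScont : Continuous S := by fun_prop
  have hSge : ∀ x, ‖x‖ ^ D / (n : ℝ) ^ l ≤ S x := sum_pow_coord_ge l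
  have hS0 : S 0 = 0 := by simp [hS, hD]
  set K := (C * 2 ^ k + |polyFun n p 0|) * (n : ℝ) ^ l + 1 with hK
  have hK1 : 1 ≤ K := by
    have : 0 ≤ (C * 2 ^ k + |polyFun n p 0|) * (n : ℝ) ^ l := by positivity
    linarith
  -- Where the penalized polynomial exceeds its value at the origin, `|x|` is of order at most `1/ε`,
  -- with `ε = 1 / (j + 1)`.
  have hbig : ∀ (j : ℕ) (x : E n), polyFun n p 0 ≤ polyFun n p x - ((j : ℝ) + 1)⁻¹ * S x →
      ‖x‖ ≤ K * ((j : ℝ) + 1) := by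
    intro j x h
    have hj : (0 : ℝ) < (j : ℝ) + 1 := by positivity
    have hj1 : (1 : ℝ) ≤ (j : ℝ) + 1 := by simp
    rcases le_total ‖x‖ 1 with h1 | h1
    · exact h1.trans (one_le_mul_of_one_le_of_one_le hK1 hj1)
    · have h2 : ((j : ℝ) + 1)⁻¹ * (‖x‖ ^ D / (n : ℝ) ^ l) ≤
          (C * 2 ^ k + |polyFun n p 0|) * ‖x‖ ^ (D - 1) := by
        have h3 := (le_abs_self _).trans (hgr x)
        have h4 : (1 + ‖x‖) ^ k ≤ 2 ^ k * ‖x‖ ^ (D - 1) := by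
          calc _ ≤ (2 * ‖x‖) ^ k := by gcongr; linarith
            _ = 2 ^ k * ‖x‖ ^ k := mul_pow _ _ _
            _ ≤ _ := by
              have : k ≤ D - 1 := by omega
              gcongr
        have h5 : |polyFun n p 0| ≤ |polyFun n p 0| * ‖x‖ ^ (D - 1) :=
          le_mul_of_one_le_right (abs_nonneg _) (one_le_pow₀ h1)
        have h6 := neg_abs_le (polyFun n p 0)
        have h7 := mul_le_mul_of_nonneg_left (hSge x) (inv_pos.2 hj).le
        have h8 := mul_le_mul_of_nonneg_left h4 hC
        nlinarith
      have h9 : ‖x‖ ^ D = ‖x‖ ^ (D - 1) * ‖x‖ := by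
        rw [← pow_succ]
        congr 1
      have h10 : 0 < ‖x‖ ^ (D - 1) := by positivity
      rw [h9, inv_mul_eq_div, div_div, div_le_iff₀ (by positivity)] at h2
      have h11 : ‖x‖ ≤ (C * 2 ^ k + |polyFun n p 0|) * ((n : ℝ) ^ l * ((j : ℝ) + 1)) :=
        le_of_mul_le_mul_left (by linarith) h10
      rw [hK]
      nlinarith
  have hmax : ∀ j : ℕ, ∃ x : E n, ∀ y, polyFun n p y - ((j : ℝ) + 1)⁻¹ * S y ≤
      polyFun n p x - ((j : ℝ) + 1)⁻¹ * S x := by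
    intro j
    refine ((continuous_polyFun p).sub (continuous_const.mul hScont)).exists_forall_ge' 0 ?_
    have h1 : (closedBall (0 : E n) (K * ((j : ℝ) + 1)))ᶜ ∈ cocompact (E n) :=
      (isCompact_closedBall _ _).compl_mem_cocompact
    filter_upwards [h1] with x hx
    simp only [mem_compl_iff, mem_closedBall, dist_zero_right, not_le] at hx
    by_contra hcon
    have hcon' : polyFun n p 0 - ((j : ℝ) + 1)⁻¹ * S 0 <
        polyFun n p x - ((j : ℝ) + 1)⁻¹ * S x := not_le.1 hcon
    rw [hS0, mul_zero, sub_zero] at hcon'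
    exact absurd (hbig j x hcon'.le) (not_le.2 hx)
  choose x hxmax using hmax
  have hxbd : ∀ j, ‖x j‖ ≤ K * ((j : ℝ) + 1) := fun j =>
    hbig j _ (by simpa [hS0] using hxmax j 0)
  have hlog : ∀ j : ℕ, polyFun n p (x j) ≤
      (A + B * Real.log (2 * K)) + B * Real.log ((j : ℝ) + 1) := by
    intro j
    have hj1 : (1 : ℝ) ≤ (j : ℝ) + 1 := by simp
    have h1 : 1 + ‖x j‖ ≤ 2 * K * ((j : ℝ) + 1) := by
      have := hxbd j
      nlinarith
    have h2 := Real.log_le_log (by positivity) h1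
    rw [Real.log_mul (by positivity) (by positivity)] at h2
    have := hle (x j)
    nlinarith
  have htop : Tendsto (fun j => polyFun n p (x j)) atTop atTop := by
    rw [Filter.tendsto_atTop]
    intro T
    rw [bddAbove_def] at hnb
    push Not at hnb
    obtain ⟨_, ⟨x0, rfl⟩, hx0⟩ := hnb (T + 1)
    have h1 : Tendsto (fun j : ℕ => ((j : ℝ) + 1)⁻¹ * S x0) atTop (𝓝 0) := by
      have := (tendsto_inv_atTop_zero.comp
        (tendsto_atTop_add_const_right atTop (1 : ℝ) tendsto_natCast_atTop_atTop)).mul_const (S x0)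
      simpa using this
    filter_upwards [h1.eventually_lt_const one_pos] with j hj
    have h2 := hxmax j x0
    have h3 : 0 ≤ ((j : ℝ) + 1)⁻¹ * S (x j) := by
      have : 0 ≤ S (x j) := (by positivity : (0 : ℝ) ≤ _).trans (hSge (x j))
      positivity
    linarith
  -- The critical point equation at the maximizer.
  have hcrit : ∀ (j : ℕ) (i : Fin n), x j i ^ (D - 1) = ((j : ℝ) + 1) *
      polyFun n (MvPolynomial.C (D : ℝ)⁻¹ * MvPolynomial.pderiv i p) (x j) := by
    intro j i
    have hSd : HasFDerivAt S (∑ i, ((D : ℝ) * (x j i) ^ (D - 1)) •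
        (EuclideanSpace.proj i : E n →L[ℝ] ℝ)) (x j) := by
      refine HasFDerivAt.fun_sum fun i _ => ?_
      have h1 : HasFDerivAt (fun y : E n => y i) (EuclideanSpace.proj i : E n →L[ℝ] ℝ) (x j) :=
        (EuclideanSpace.proj i : E n →L[ℝ] ℝ).hasFDerivAt
      refine (h1.pow D).congr_fderiv ?_
      ext v
      simp
    have hder := (hasFDerivAt_polyFun p (x j)).sub (hSd.const_mul ((j : ℝ) + 1)⁻¹)
    have hloc : IsLocalMax (polyFun n p - fun y => ((j : ℝ) + 1)⁻¹ * S y) (x j) :=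
      Eventually.of_forall fun y => hxmax j y
    have hzero := hloc.hasFDerivAt_eq_zero hder
    have h2 := DFunLike.congr_fun hzero (stdVec i)
    have hj : ((j : ℝ) + 1) ≠ 0 := by positivity
    have hD0 : (D : ℝ) ≠ 0 := by
      rw [hD]
      positivity
    simp [stdVec_apply] at h2
    simp only [polyFun, map_mul, MvPolynomial.eval_C] at h2 ⊢
    field_simp at h2 ⊢
    linarith
  obtain ⟨Q, hQ0, hQ⟩ := exists_algebraic_relation
    (fun i => MvPolynomial.C (D : ℝ)⁻¹ * MvPolynomial.pderiv i p) (fun i => by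
      have h1 := MvPolynomial.totalDegree_mul (MvPolynomial.C (D : ℝ)⁻¹) (MvPolynomial.pderiv i p)
      have h2 := totalDegree_pderiv_le p i
      rw [MvPolynomial.totalDegree_C] at h1
      change _ < D - 1
      omega) hcrit p
  refine false_of_algebraic_log hQ0 ?_ htop hlog hQ
  exact tendsto_atTop_add_const_right atTop (1 : ℝ) tendsto_natCast_atTop_atTop

/-! ### Polyharmonic polynomials bounded above -/

/-- The Laplacian on polynomials. -/
def polyLap (n : ℕ) : MvPolynomial (Fin n) ℝ →ₗ[ℝ] MvPolynomial (Fin n) ℝ :=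
  ∑ i, (MvPolynomial.pderiv i).toLinearMap ∘ₗ (MvPolynomial.pderiv i).toLinearMap

lemma polyLap_apply {n : ℕ} (p : MvPolynomial (Fin n) ℝ) :
    polyLap n p = ∑ i, MvPolynomial.pderiv i (MvPolynomial.pderiv i p) := by
  simp [polyLap]

lemma polyFun_sum {n : ℕ} {ι : Type*} (s : Finset ι) (q : ι → MvPolynomial (Fin n) ℝ) (x : E n) :
    polyFun n (∑ i ∈ s, q i) x = ∑ i ∈ s, polyFun n (q i) x := by
  simp [polyFun]

lemma fderiv_polyFun_stdVec {n : ℕ} (p : MvPolynomial (Fin n) ℝ) (i : Fin n) (x : E n) :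
    fderiv ℝ (polyFun n p) x (stdVec i) = polyFun n (MvPolynomial.pderiv i p) x := by
  rw [(hasFDerivAt_polyFun p x).fderiv]
  simp [stdVec_apply]

lemma homogeneousComponent_pderiv {n : ℕ} (p : MvPolynomial (Fin n) ℝ) (i : Fin n) (k : ℕ) :
    MvPolynomial.homogeneousComponent k (MvPolynomial.pderiv i p) =
      MvPolynomial.pderiv i (MvPolynomial.homogeneousComponent (k + 1) p) := by
  ext m
  rw [MvPolynomial.coeff_homogeneousComponent, MvPolynomial.coeff_pderiv,
    MvPolynomial.coeff_pderiv, MvPolynomial.coeff_homogeneousComponent]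
  simp [map_add]

lemma homogeneousComponent_polyLap {n : ℕ} (p : MvPolynomial (Fin n) ℝ) (k : ℕ) :
    MvPolynomial.homogeneousComponent k (polyLap n p) =
      polyLap n (MvPolynomial.homogeneousComponent (k + 2) p) := by
  rw [polyLap_apply, polyLap_apply, map_sum]
  exact Finset.sum_congr rfl fun i _ => by
    rw [homogeneousComponent_pderiv, homogeneousComponent_pderiv]

lemma homogeneousComponent_polyLap_pow {n : ℕ} (m : ℕ) (p : MvPolynomial (Fin n) ℝ) (k : ℕ) :
    MvPolynomial.homogeneousComponent k ((polyLap n ^ m) p) =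
      (polyLap n ^ m) (MvPolynomial.homogeneousComponent (k + 2 * m) p) := by
  induction m generalizing p with
  | zero => simp
  | succ m ih =>
    rw [pow_succ, Module.End.mul_apply, Module.End.mul_apply, ih, homogeneousComponent_polyLap]
    congr 3

/-- A polynomial is integrable against a continuous function that decays rapidly. -/
lemma integrable_polyFun_smul {n : ℕ} {F : Type*} [NormedAddCommGroup F] [NormedSpace ℝ F]
    (q : MvPolynomial (Fin n) ℝ) {g : E n → F} (hg : Continuous g)
    (hdec : ∀ N : ℕ, ∃ C : ℝ, ∀ x, ‖g x‖ ≤ C * (1 + ‖x‖) ^ (-(N : ℝ))) :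
    Integrable fun x => polyFun n q x • g x := by
  obtain ⟨C, k, hC, hb, -⟩ := exists_polyFun_growth q
  obtain ⟨D, hD⟩ := hdec (k + n + 1)
  have hi : Integrable fun x : E n => C * D * (1 + ‖x‖) ^ (-((n + 1 : ℕ) : ℝ)) :=
    (integrable_one_add_norm (by simp)).const_mul _
  refine hi.mono' ((continuous_polyFun q).smul hg).aestronglyMeasurable
    (Eventually.of_forall fun x => ?_)
  have hX : 0 < 1 + ‖x‖ := by positivity
  rw [norm_smul, Real.norm_eq_abs]
  calc _ ≤ C * (1 + ‖x‖) ^ k * (D * (1 + ‖x‖) ^ (-((k + n + 1 : ℕ) : ℝ))) := by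
        gcongr
        · exact hb x
        · exact hD x
    _ = _ := by
        have : (1 + ‖x‖) ^ (-((n + 1 : ℕ) : ℝ)) =
            (1 + ‖x‖) ^ (k : ℝ) * (1 + ‖x‖) ^ (-((k + n + 1 : ℕ) : ℝ)) := by
          rw [← Real.rpow_add hX]
          congr 1
          push_cast
          ring
        rw [this, Real.rpow_natCast]
        ring

lemma integrable_polyFun_smul_schwartz {n : ℕ} (q : MvPolynomial (Fin n) ℝ) (φ : 𝓢(E n, ℂ)) :
    Integrable fun x => polyFun n q x • φ x :=
  integrable_polyFun_smul q φ.continuous fun N => by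
    obtain ⟨C, -, hb⟩ := schwartz_norm_le φ N
    exact ⟨C, hb⟩

lemma integral_polyFun_smul_fderiv {n : ℕ} (q : MvPolynomial (Fin n) ℝ) (φ : 𝓢(E n, ℂ))
    (i : Fin n) : ∫ x, polyFun n q x • (LineDeriv.lineDerivOp (stdVec i : E n) φ) x =
      -∫ x, polyFun n (MvPolynomial.pderiv i q) x • φ x := by
  have h := integral_bilinear_hasFDerivAt_right_eq_neg_left_of_integrable (μ := volume)
    (f := polyFun n q) (f' := fderiv ℝ (polyFun n q)) (g := φ) (g' := fderiv ℝ φ)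
    (v := (stdVec i : E n)) (B := ContinuousLinearMap.lsmul ℝ ℝ)
    (by simpa only [ContinuousLinearMap.lsmul_apply, fderiv_polyFun_stdVec] using
      integrable_polyFun_smul_schwartz (MvPolynomial.pderiv i q) φ)
    (by simpa only [ContinuousLinearMap.lsmul_apply, SchwartzMap.lineDerivOp_apply_eq_fderiv] using
      integrable_polyFun_smul_schwartz q (LineDeriv.lineDerivOp (stdVec i : E n) φ))
    (integrable_polyFun_smul_schwartz q φ)
    (fun x _ => (hasFDerivAt_polyFun q x).differentiableAt.hasFDerivAt)
    (fun x _ => φ.hasFDerivAt x)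
  simpa only [ContinuousLinearMap.lsmul_apply, fderiv_polyFun_stdVec,
    SchwartzMap.lineDerivOp_apply_eq_fderiv] using h

lemma integral_polyFun_smul_negLap {n : ℕ} (q : MvPolynomial (Fin n) ℝ) (φ : 𝓢(E n, ℂ)) :
    ∫ x, polyFun n q x • negLap n φ x = -∫ x, polyFun n (polyLap n q) x • φ x := by
  have h1 : ∀ x, polyFun n q x • negLap n φ x = -∑ i : Fin n, polyFun n q x •
      (LineDeriv.lineDerivOp (stdVec i : E n) (LineDeriv.lineDerivOp (stdVec i : E n) φ)) x := by
    intro x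
    have h2 : negLap n φ = -(Δ φ) := by
      rw [← SchwartzMap.laplacianCLM_eq ℂ]; rfl
    rw [h2, SchwartzMap.laplacian_eq_sum (EuclideanSpace.basisFun (Fin n) ℝ), _root_.neg_apply,
      smul_neg, _root_.sum_apply, Finset.smul_sum]
    rfl
  have h3 : ∀ x, polyFun n (polyLap n q) x • φ x = ∑ i : Fin n,
      polyFun n (MvPolynomial.pderiv i (MvPolynomial.pderiv i q)) x • φ x := fun x => by
    rw [polyLap_apply, polyFun_sum, Finset.sum_smul]
  simp only [h1, h3]
  rw [integral_neg, integral_finsetSum _ fun i _ => integrable_polyFun_smul_schwartz _ _,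
    integral_finsetSum _ fun i _ => integrable_polyFun_smul_schwartz _ _]
  congr 1
  refine Finset.sum_congr rfl fun i _ => ?_
  rw [integral_polyFun_smul_fderiv, integral_polyFun_smul_fderiv, neg_neg]

lemma integral_polyFun_smul_negLap_pow {n : ℕ} (m : ℕ) (q : MvPolynomial (Fin n) ℝ)
    (φ : 𝓢(E n, ℂ)) : ∫ x, polyFun n q x • (negLap n ^ m) φ x =
      (-1) ^ m * ∫ x, polyFun n ((polyLap n ^ m) q) x • φ x := by
  induction m generalizing q with
  | zero => simp
  | succ m ih =>
    have h1 : (negLap n ^ (m + 1)) φ = negLap n ((negLap n ^ m) φ) := by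
      rw [pow_succ']; rfl
    rw [h1, integral_polyFun_smul_negLap, ih, pow_succ (polyLap n), Module.End.mul_apply]
    ring

/-- A weakly polyharmonic polynomial is polyharmonic. -/
lemma polyLap_pow_eq_zero {n m : ℕ} {p : MvPolynomial (Fin n) ℝ}
    (h : ∀ φ : E n → ℝ, ContDiff ℝ ∞ φ → HasCompactSupport φ →
      ∫ x, polyFun n p x * negLaplacianPow n m φ x = 0) : (polyLap n ^ m) p = 0 := by
  set r := (polyLap n ^ m) p with hr
  have hz : ∀ᵐ x, polyFun n r x = 0 := by
    refine ae_eq_zero_of_integral_contDiff_smul_eq_zero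
      (continuous_polyFun r).locallyIntegrable fun φ h1 h2 => ?_
    have h3 := integral_polyFun_smul_negLap_pow m p (toComplexSchwartz h1 h2)
    have h4 : ∀ x, polyFun n p x • (negLap n ^ m) (toComplexSchwartz h1 h2) x =
        ((polyFun n p x * negLaplacianPow n m φ x : ℝ) : ℂ) := fun x => by
      rw [negLap_pow_toComplexSchwartz, Complex.real_smul, Complex.ofReal_mul]
    have h5 : ∀ x, polyFun n ((polyLap n ^ m) p) x • toComplexSchwartz h1 h2 x =
        ((φ x • polyFun n r x : ℝ) : ℂ) := fun x => by
      rw [toComplexSchwartz_apply, Complex.real_smul, smul_eq_mul, Complex.ofReal_mul, mul_comm]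
    simp only [h4, h5] at h3
    rw [integral_complex_ofReal, integral_complex_ofReal, h φ h1 h2, Complex.ofReal_zero] at h3
    have h6 := (mul_eq_zero.1 h3.symm).resolve_left (pow_ne_zero _ (by norm_num))
    exact_mod_cast h6
  have hz' : polyFun n r = fun _ => 0 :=
    (continuous_polyFun r).ae_eq_iff_eq volume continuous_const |>.1 hz
  refine MvPolynomial.funext fun x => ?_
  have := congrFun hz' (WithLp.toLp 2 x)
  simpa [polyFun] using this

lemma polyFun_smul_of_isHomogeneous {n k : ℕ} {q : MvPolynomial (Fin n) ℝ} (hq : q.IsHomogeneous k)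
    (t : ℝ) (x : E n) : polyFun n q (t • x) = t ^ k * polyFun n q x := by
  simp only [polyFun, MvPolynomial.eval_eq, Finset.mul_sum]
  refine Finset.sum_congr rfl fun m hm => ?_
  have h1 : ∑ i ∈ m.support, m i = k := by
    have := hq (MvPolynomial.mem_support_iff.1 hm)
    rw [← this, Finsupp.weight_apply, Finsupp.sum]
    simp
  have h2 : ∏ i ∈ m.support, (t • x) i ^ m i = t ^ k * ∏ i ∈ m.support, x i ^ m i := by
    rw [← h1, ← Finset.prod_pow_eq_pow_sum, ← Finset.prod_mul_distrib]
    exact Finset.prod_congr rfl fun i _ => by simp [mul_pow]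
  rw [h2]
  ring

/-- The leading part of a polynomial that is bounded above is nonpositive. -/
lemma homogeneousComponent_nonpos {n : ℕ} {p : MvPolynomial (Fin n) ℝ} (hd : 0 < p.totalDegree)
    (hb : BddAbove (range (polyFun n p))) (x : E n) :
    polyFun n (MvPolynomial.homogeneousComponent p.totalDegree p) x ≤ 0 := by
  by_contra! hpos
  set d := p.totalDegree with hd'
  let P : Polynomial ℝ := ∑ k ∈ Finset.range (d + 1),
    Polynomial.monomial k (polyFun n (MvPolynomial.homogeneousComponent k p) x)
  have heval : ∀ t : ℝ, P.eval t = polyFun n p (t • x) := by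
    intro t
    conv_rhs => rw [← MvPolynomial.sum_homogeneousComponent p]
    rw [polyFun_sum, Polynomial.eval_finsetSum]
    refine Finset.sum_congr rfl fun k _ => ?_
    rw [Polynomial.eval_monomial, polyFun_smul_of_isHomogeneous
      (MvPolynomial.homogeneousComponent_isHomogeneous k p), mul_comm]
  have hcoeff : P.coeff d = polyFun n (MvPolynomial.homogeneousComponent d p) x := by
    simp only [P, Polynomial.finsetSum_coeff, Polynomial.coeff_monomial]
    simp
  have hdeg : P.natDegree = d := by
    refine Polynomial.natDegree_eq_of_le_of_coeff_ne_zero ?_ (by rw [hcoeff]; exact hpos.ne')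
    refine Polynomial.natDegree_sum_le_of_forall_le _ _ fun k hk => ?_
    exact (Polynomial.natDegree_monomial_le _).trans
      (Nat.lt_succ_iff.1 (Finset.mem_range.1 hk))
  have htop := Polynomial.tendsto_atTop_of_leadingCoeff_nonneg P
    (Polynomial.natDegree_pos_iff_degree_pos.1 (by omega))
    (by rw [Polynomial.leadingCoeff, hdeg, hcoeff]; exact hpos.le)
  obtain ⟨T, hT⟩ := hb
  obtain ⟨t, ht⟩ := (htop.eventually_gt_atTop T).exists
  rw [heval] at ht
  exact absurd (hT ⟨_, rfl⟩) (not_le.2 ht)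

lemma exp_neg_norm_sq_le {n : ℕ} (N : ℕ) : ∃ C : ℝ, ∀ x : E n,
    ‖Real.exp (-‖x‖ ^ 2)‖ ≤ C * (1 + ‖x‖) ^ (-(N : ℝ)) := by
  refine ⟨N.factorial * Real.exp 2, fun x => ?_⟩
  have hX : 0 < 1 + ‖x‖ := by positivity
  have h1 := Real.pow_div_factorial_le_exp (1 + ‖x‖) hX.le N
  rw [div_le_iff₀ (by positivity)] at h1
  have h2 : Real.exp (-‖x‖ ^ 2) * Real.exp (1 + ‖x‖) ≤ Real.exp 2 := by
    rw [← Real.exp_add]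
    exact Real.exp_le_exp.2 (by nlinarith [sq_nonneg (‖x‖ - 1 / 2)])
  rw [Real.norm_of_nonneg (Real.exp_pos _).le, Real.rpow_neg hX.le, Real.rpow_natCast,
    ← div_eq_mul_inv, le_div_iff₀ (by positivity)]
  calc _ ≤ Real.exp (-‖x‖ ^ 2) * (Real.exp (1 + ‖x‖) * N.factorial) := by gcongr
    _ = Real.exp (-‖x‖ ^ 2) * Real.exp (1 + ‖x‖) * N.factorial := by ring
    _ ≤ Real.exp 2 * N.factorial := by gcongr
    _ = _ := mul_comm _ _

lemma integrable_polyFun_mul_gaussian {n : ℕ} (q : MvPolynomial (Fin n) ℝ) :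
    Integrable fun x : E n => polyFun n q x * Real.exp (-‖x‖ ^ 2) :=
  integrable_polyFun_smul q (by fun_prop) exp_neg_norm_sq_le

/-- Integration by parts against a Gaussian: on homogeneous polynomials the Laplacian acts as a
multiple of the identity under the integral, by Euler's identity. -/
lemma integral_polyLap_mul_gaussian {n k : ℕ} {q : MvPolynomial (Fin n) ℝ}
    (hq : q.IsHomogeneous k) :
    ∫ x : E n, polyFun n (polyLap n q) x * Real.exp (-‖x‖ ^ 2) =
      2 * k * ∫ x : E n, polyFun n q x * Real.exp (-‖x‖ ^ 2) := by
  have hG : ∀ x : E n, HasFDerivAt (fun x : E n => Real.exp (-‖x‖ ^ 2))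
      (Real.exp (-‖x‖ ^ 2) • (-((2 : ℝ) • innerSL ℝ x : E n →L[ℝ] ℝ))) x := fun x => by
    refine ((hasStrictFDerivAt_norm_sq x).hasFDerivAt.fun_neg).exp.congr_fderiv ?_
    rw [two_smul, two_smul]
  have hGv : ∀ (x : E n) (i : Fin n),
      (Real.exp (-‖x‖ ^ 2) • (-((2 : ℝ) • innerSL ℝ x : E n →L[ℝ] ℝ))) (stdVec i) =
        -2 * (x i * Real.exp (-‖x‖ ^ 2)) := by
    intro x i
    simp only [smul_apply, neg_apply, innerSL_apply_apply, inner_stdVec,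
      smul_eq_mul]
    ring
  have hmulX : ∀ (r : MvPolynomial (Fin n) ℝ) (i : Fin n) (x : E n),
      polyFun n (MvPolynomial.X i * r) x = x i * polyFun n r x := fun r i x => by simp [polyFun]
  have hparts : ∀ i : Fin n,
      ∫ x : E n, polyFun n (MvPolynomial.pderiv i (MvPolynomial.pderiv i q)) x *
        Real.exp (-‖x‖ ^ 2) =
      2 * ∫ x : E n, polyFun n (MvPolynomial.X i * MvPolynomial.pderiv i q) x *
        Real.exp (-‖x‖ ^ 2) := by
    intro i
    have h := integral_bilinear_hasFDerivAt_right_eq_neg_left_of_integrable (μ := volume)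
      (f := polyFun n (MvPolynomial.pderiv i q))
      (f' := fderiv ℝ (polyFun n (MvPolynomial.pderiv i q)))
      (g := fun x : E n => Real.exp (-‖x‖ ^ 2))
      (g' := fun x => Real.exp (-‖x‖ ^ 2) • (-((2 : ℝ) • innerSL ℝ x : E n →L[ℝ] ℝ)))
      (v := (stdVec i : E n)) (B := ContinuousLinearMap.lsmul ℝ ℝ)
      (by simpa only [ContinuousLinearMap.lsmul_apply, fderiv_polyFun_stdVec, smul_eq_mul] using
        integrable_polyFun_mul_gaussian _)
      (by
        refine ((integrable_polyFun_mul_gaussian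
          (MvPolynomial.X i * MvPolynomial.pderiv i q)).const_mul (-2)).congr
          (Eventually.of_forall fun x => ?_)
        simp only [ContinuousLinearMap.lsmul_apply, hGv, hmulX, smul_eq_mul]
        ring)
      (by simpa only [ContinuousLinearMap.lsmul_apply, smul_eq_mul] using
        integrable_polyFun_mul_gaussian _)
      (fun x _ => (hasFDerivAt_polyFun _ x).differentiableAt.hasFDerivAt)
      (fun x _ => hG x)
    simp only [ContinuousLinearMap.lsmul_apply, fderiv_polyFun_stdVec, hGv, smul_eq_mul] at h
    have h2 : ∫ x : E n, polyFun n (MvPolynomial.pderiv i q) x *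
        (-2 * (x i * Real.exp (-‖x‖ ^ 2))) =
        -2 * ∫ x : E n, polyFun n (MvPolynomial.X i * MvPolynomial.pderiv i q) x *
          Real.exp (-‖x‖ ^ 2) := by
      rw [← integral_const_mul]
      exact integral_congr_ae (Eventually.of_forall fun x => by simp only [hmulX]; ring)
    linarith
  have h1 : ∀ x : E n, polyFun n (polyLap n q) x * Real.exp (-‖x‖ ^ 2) = ∑ i : Fin n,
      polyFun n (MvPolynomial.pderiv i (MvPolynomial.pderiv i q)) x * Real.exp (-‖x‖ ^ 2) :=
    fun x => by rw [polyLap_apply, polyFun_sum, Finset.sum_mul]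
  simp only [h1]
  rw [integral_finsetSum _ fun i _ => integrable_polyFun_mul_gaussian _]
  simp only [hparts]
  rw [← Finset.mul_sum, ← integral_finsetSum _ fun i _ => integrable_polyFun_mul_gaussian _,
    mul_assoc, ← integral_const_mul (k : ℝ)]
  congr 1
  refine integral_congr_ae (Eventually.of_forall fun x => ?_)
  simp only
  rw [← Finset.sum_mul, ← polyFun_sum, hq.sum_X_mul_pderiv, ← mul_assoc]
  congr 1
  simp [polyFun]

lemma isHomogeneous_polyLap {n k : ℕ} {q : MvPolynomial (Fin n) ℝ} (hq : q.IsHomogeneous (k + 2)) :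
    (polyLap n q).IsHomogeneous k := by
  rw [polyLap_apply]
  exact MvPolynomial.IsHomogeneous.sum _ _ _ fun i _ => hq.pderiv.pderiv

lemma integral_mul_gaussian_eq_zero_of_polyLap_pow {n : ℕ} (m : ℕ) {k : ℕ}
    {q : MvPolynomial (Fin n) ℝ} (hq : q.IsHomogeneous (k + 2 * m)) (h : (polyLap n ^ m) q = 0) :
    ∫ x : E n, polyFun n q x * Real.exp (-‖x‖ ^ 2) = 0 := by
  induction m generalizing q with
  | zero =>
    have : q = 0 := by simpa using h
    simp [this, polyFun]
  | succ m ih =>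
    have h1 := integral_polyLap_mul_gaussian hq
    rw [ih (isHomogeneous_polyLap hq) (by
      rwa [pow_succ, Module.End.mul_apply] at h)] at h1
    have h2 : (2 : ℝ) * ((k + 2 * (m + 1) : ℕ) : ℝ) ≠ 0 := by positivity
    exact (mul_eq_zero.1 h1.symm).resolve_left h2

/-- A polynomial that is bounded above and satisfies `Δ^m p = 0` has degree less than `2m`: its
leading part is nonpositive with vanishing Gaussian mean. -/
theorem totalDegree_lt_of_bddAbove {n m : ℕ} (hm : 0 < m) {p : MvPolynomial (Fin n) ℝ}
    (hb : BddAbove (range (polyFun n p))) (h : (polyLap n ^ m) p = 0) :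
    p.totalDegree < 2 * m := by
  by_contra! hd
  set q := MvPolynomial.homogeneousComponent p.totalDegree p with hq
  have hqle := homogeneousComponent_nonpos (by omega) hb
  have hqh : q.IsHomogeneous (p.totalDegree - 2 * m + 2 * m) := by
    rw [Nat.sub_add_cancel hd]
    exact MvPolynomial.homogeneousComponent_isHomogeneous _ _
  have hqlap : (polyLap n ^ m) q = 0 := by
    have h1 := homogeneousComponent_polyLap_pow m p (p.totalDegree - 2 * m)
    rw [h, map_zero, Nat.sub_add_cancel hd] at h1
    exact h1.symm
  have hint := integral_mul_gaussian_eq_zero_of_polyLap_pow m hqh hqlap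
  have hcont : Continuous fun x : E n => -(polyFun n q x * Real.exp (-‖x‖ ^ 2)) := by
    have := continuous_polyFun q
    fun_prop
  have hzero : (fun x : E n => -(polyFun n q x * Real.exp (-‖x‖ ^ 2))) =ᵐ[volume] 0 := by
    rw [← integral_eq_zero_iff_of_nonneg_ae (Eventually.of_forall fun x => ?_)
      (integrable_polyFun_mul_gaussian q).fun_neg]
    · rw [integral_neg, hint, neg_zero]
    · have h1 := mul_nonpos_of_nonpos_of_nonneg (hqle x) (Real.exp_pos (-‖x‖ ^ 2)).le
      simp only [Pi.zero_apply]
      linarith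
  have hzero' := (hcont.ae_eq_iff_eq volume continuous_const).1 hzero
  have hq0 : q = 0 := by
    refine MvPolynomial.funext fun x => ?_
    have h1 := congrFun hzero' (WithLp.toLp 2 x)
    have h2 : polyFun n q (WithLp.toLp 2 x) = 0 := by
      have h3 := neg_eq_zero.1 h1
      exact (mul_eq_zero.1 h3).resolve_right (Real.exp_pos _).ne'
    simpa [polyFun] using h2
  have hp0 : p ≠ 0 := by
    rintro rfl
    simp at hd
    omega
  obtain ⟨s, hs, hsd⟩ := Finset.exists_mem_eq_sup p.support
    (MvPolynomial.support_nonempty.2 hp0) (fun s => s.sum fun _ e => e)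
  have h1 := congrArg (MvPolynomial.coeff s) hq0
  rw [hq, MvPolynomial.coeff_homogeneousComponent, if_pos, MvPolynomial.coeff_zero] at h1
  · exact MvPolynomial.mem_support_iff.1 hs h1
  · rw [MvPolynomial.totalDegree, hsd]
    rfl

/-! ### The polynomial part of a solution -/

lemma density_nonneg {n : ℕ} (α : ℝ) (u : E n → ℝ) (x : E n) : 0 ≤ density n α u x := by
  unfold density; positivity

lemma density_pos {n : ℕ} (α : ℝ) (u : E n → ℝ) {x : E n} (hx : x ≠ 0) :
    0 < density n α u x := by
  have := norm_pos_iff.2 hx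
  unfold density
  positivity

lemma log_density {n : ℕ} (α : ℝ) (u : E n → ℝ) {x : E n} (hx : x ≠ 0) :
    Real.log (density n α u x) = n * α * Real.log ‖x‖ + n * u x := by
  have := norm_pos_iff.2 hx
  rw [density, Real.log_mul (by positivity) (Real.exp_pos _).ne', Real.log_rpow this,
    Real.log_exp]

lemma logPotential_eq {n : ℕ} (α : ℝ) (u : E n → ℝ) (x : E n) :
    logPotential n α u x = 1 / gammaConst n * pot (density n α u) x := rfl

lemma ae_ne_zero {n : ℕ} (hn : 0 < n) : ∀ᵐ x : E n, x ≠ 0 := by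
  have : Nonempty (Fin n) := ⟨⟨0, hn⟩⟩
  have : (volume : Measure (E n)) {0} = 0 := measure_singleton 0
  exact compl_mem_ae_iff.2 this

lemma continuous_one_add_norm_rpow (n : ℕ) (r : ℝ) : Continuous fun x : E n => (1 + ‖x‖) ^ r :=
  (continuous_const.add continuous_norm).rpow_const fun x =>
    Or.inl (show 1 + ‖x‖ ≠ 0 by positivity)

lemma neg_log_mul_le_pot {n : ℕ} {f : E n → ℝ} (hf0 : ∀ x, 0 ≤ f x) (hf : Integrable f) {x : E n}
    (hx : 1 ≤ ‖x‖) (hint : Integrable fun y => logKernel x y * f y) :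
    -Real.log ‖x‖ * ∫ y, f y ≤ pot f x := by
  rw [← integral_const_mul]
  refine integral_mono (hf.const_mul _) hint fun y => ?_
  exact mul_le_mul_of_nonneg_right (neg_log_norm_le_logKernel hx y) (hf0 y)

lemma abs_log_norm_le {n : ℕ} (x : E n) : |Real.log ‖x‖| ≤ logSing x + ‖x‖ := by
  have h1 := logSing_nonneg x
  have h2 : -Real.log ‖x‖ ≤ logSing x := le_max_right _ _
  have h3 := Real.log_le_self (norm_nonneg x)
  exact abs_le.2 ⟨by linarith [norm_nonneg x], by linarith⟩

/-- For even `n`, the growth of `u - v` in the mean: its positive part is controlled through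
`n u ≤ f + |n α log |x||`, its negative part through polyharmonicity. -/
lemma exists_tempered_of_even {n : ℕ} (hn : 0 < n) (he : Even n) {α : ℝ} {u : E n → ℝ}
    (hu : SolvesP0 n α u) :
    ∃ N : ℕ, Integrable fun x =>
      |u x - 1 / gammaConst n * pot (density n α u) x| * (1 + ‖x‖) ^ (-(N : ℝ)) := by
  obtain ⟨hf, hsol⟩ := hu
  set f := density n α u with hfdef
  have hγ := gammaConst_pos hn
  have hn' : (0 : ℝ) < n := by exact_mod_cast hn
  have hul := (hsol.1 he).1
  have hwl : LocallyIntegrable fun x => u x - 1 / gammaConst n * pot f x :=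
    hul.sub ((locallyIntegrable_pot hn hf).smul (1 / gammaConst n))
  set G : E n → ℝ := fun x => f x / n + |α| * |Real.log ‖x‖| + 1 / gammaConst n * |pot f x|
    with hG
  have hle : ∀ᵐ x : E n, max (u x - 1 / gammaConst n * pot f x) 0 ≤ G x := by
    filter_upwards [ae_ne_zero hn] with x hx
    have hfx := density_nonneg α u x
    have h0 : 0 ≤ G x := by
      have : 0 ≤ f x := hfx
      positivity
    refine max_le ?_ h0
    have h1 := log_density α u hx
    have h2 : Real.log (f x) ≤ f x := Real.log_le_self hfx
    have h3 : -(|α| * |Real.log ‖x‖|) ≤ α * Real.log ‖x‖ := by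
      rw [← abs_mul]
      exact neg_abs_le _
    have h4 : u x ≤ f x / n + |α| * |Real.log ‖x‖| := by
      rw [← sub_le_iff_le_add, le_div_iff₀ hn']
      nlinarith
    have h5 : -(1 / gammaConst n * |pot f x|) ≤ 1 / gammaConst n * pot f x := by
      rw [← mul_neg]
      gcongr
      exact neg_abs_le _
    simp only [hG]
    linarith
  have hGint : Integrable fun x => G x * (1 + ‖x‖) ^ (-((n + 2 : ℕ) : ℝ)) := by
    have hw1 : ∀ x : E n, (1 + ‖x‖) ^ (-((n + 2 : ℕ) : ℝ)) ≤ 1 := fun x =>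
      Real.rpow_le_one_of_one_le_of_nonpos (by simp) (neg_nonpos.2 (Nat.cast_nonneg _))
    have i1 : Integrable fun x => f x / n * (1 + ‖x‖) ^ (-((n + 2 : ℕ) : ℝ)) :=
      (hf.div_const _).mul_bdd (c := 1) (continuous_one_add_norm_rpow n _).aestronglyMeasurable
        (Eventually.of_forall fun x => by
          rw [Real.norm_of_nonneg (by positivity)]
          exact hw1 x)
    have i2 : Integrable fun x : E n =>
        |α| * |Real.log ‖x‖| * (1 + ‖x‖) ^ (-((n + 2 : ℕ) : ℝ)) := by
      have h1 : Integrable fun x : E n => |α| * (logSing x + (1 + ‖x‖) ^ (-((n + 1 : ℕ) : ℝ))) :=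
        ((integrable_logSing hn).add (integrable_one_add_norm (by simp))).const_mul _
      refine h1.mono' ?_ (Eventually.of_forall fun x => ?_)
      · refine AEStronglyMeasurable.mul (Measurable.aestronglyMeasurable (by fun_prop))
          (continuous_one_add_norm_rpow n _).aestronglyMeasurable
      · rw [Real.norm_of_nonneg (by positivity), mul_assoc]
        refine mul_le_mul_of_nonneg_left ?_ (abs_nonneg _)
        have h2 : (1 + ‖x‖) * (1 + ‖x‖) ^ (-((n + 2 : ℕ) : ℝ)) =
            (1 + ‖x‖) ^ (-((n + 1 : ℕ) : ℝ)) := by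
          rw [← Real.rpow_one_add' (by positivity) (by push_cast; linarith)]
          congr 1
          push_cast
          ring
        rw [← h2]
        have h3 := abs_log_norm_le x
        have h4 := logSing_nonneg x
        have h5 : 0 ≤ (1 + ‖x‖) ^ (-((n + 2 : ℕ) : ℝ)) := by positivity
        have h6 := hw1 x
        calc _ ≤ (logSing x + (1 + ‖x‖)) * (1 + ‖x‖) ^ (-((n + 2 : ℕ) : ℝ)) := by
              gcongr
              linarith
          _ ≤ _ := by
              rw [add_mul]
              gcongr
              exact mul_le_of_le_one_right h4 h6
    have i3 : Integrable fun x : E n =>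
        1 / gammaConst n * |pot f x| * (1 + ‖x‖) ^ (-((n + 2 : ℕ) : ℝ)) := by
      simp only [mul_assoc]
      exact (integrable_pot_mul_natPow hn hf (by omega)).const_mul _
    refine ((i1.add i2).add i3).congr (Eventually.of_forall fun x => ?_)
    simp only [Pi.add_apply, hG]
    ring
  set I := ∫ x, G x * (1 + ‖x‖) ^ (-((n + 2 : ℕ) : ℝ)) with hI
  have hG0 : ∀ x, 0 ≤ G x := fun x => by
    have : 0 ≤ f x := density_nonneg α u x
    positivity
  have hI0 : 0 ≤ I := integral_nonneg fun x => mul_nonneg (hG0 x) (by positivity)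
  refine polyharmonic_tempered hwl (fun φ h1 h2 =>
    integral_sub_pot_mul_negLaplacianPow hn he hf hsol h1 h2) (B := I * 2 ^ (n + 2)) (d := n + 2)
    (by positivity) fun ρ hρ => ?_
  calc ∫ x in ball (0 : E n) ρ, max (u x - 1 / gammaConst n * pot f x) 0
      ≤ ∫ x in ball (0 : E n) ρ, G x * (1 + ‖x‖) ^ (-((n + 2 : ℕ) : ℝ)) * (2 * ρ) ^ (n + 2) := by
        refine integral_mono_of_nonneg (Eventually.of_forall fun x => le_max_right _ _)
          (hGint.mul_const _).integrableOn ?_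
        filter_upwards [ae_restrict_of_ae hle, ae_restrict_mem measurableSet_ball] with x hx hxb
        refine hx.trans ?_
        rw [mul_assoc]
        refine le_mul_of_one_le_right (hG0 x) ?_
        rw [Real.rpow_neg (by positivity), Real.rpow_natCast, ← div_eq_inv_mul,
          one_le_div (by positivity)]
        rw [mem_ball_zero_iff] at hxb
        exact pow_le_pow_left₀ (by positivity) (by linarith) _
    _ ≤ ∫ x, G x * (1 + ‖x‖) ^ (-((n + 2 : ℕ) : ℝ)) * (2 * ρ) ^ (n + 2) :=
        setIntegral_le_integral (hGint.mul_const _) (Eventually.of_forall fun x =>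
          mul_nonneg (mul_nonneg (hG0 x) (by positivity)) (by positivity))
    _ = I * 2 ^ (n + 2) * ρ ^ (n + 2) := by
        rw [integral_mul_const, mul_pow, mul_assoc]

/-- The lower bound `v ≥ -(Λ/γ_n) log |x|` turns into an upper bound for `e^(n (u - v))`. -/
lemma exp_mul_sub_pot_le {n : ℕ} (hn : 0 < n) {α : ℝ} {u : E n → ℝ}
    (hf : Integrable (density n α u)) {x : E n} (hx : 1 ≤ ‖x‖)
    (hxi : Integrable fun y => logKernel x y * density n α u y) {N : ℕ}
    (hN : n * (|α| + 1 / gammaConst n * ∫ y, density n α u y) ≤ N) :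
    Real.exp (n * (u x - 1 / gammaConst n * pot (density n α u) x)) ≤
      density n α u x * (1 + ‖x‖) ^ N := by
  have hγ := gammaConst_pos hn
  have hx0 : x ≠ 0 := norm_pos_iff.1 (by linarith)
  have h4 := log_density α u hx0
  have h12 := density_pos α u hx0
  have h3 := neg_log_mul_le_pot (density_nonneg α u) hf hx hxi
  have h5 : 0 ≤ Real.log ‖x‖ := Real.log_nonneg hx
  have h6 : Real.log ‖x‖ ≤ Real.log (1 + ‖x‖) := Real.log_le_log (by linarith) (by linarith)
  generalize density n α u x = F at *
  generalize ∫ y, density n α u y = L at *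
  generalize pot (density n α u) x = v at *
  have h7 : n * (u x - 1 / gammaConst n * v) ≤ Real.log F + N * Real.log (1 + ‖x‖) := by
    have h8 : 1 / gammaConst n * (-Real.log ‖x‖ * L) ≤ 1 / gammaConst n * v :=
      mul_le_mul_of_nonneg_left h3 (by positivity)
    have h9 : -|α| * Real.log ‖x‖ ≤ α * Real.log ‖x‖ :=
      mul_le_mul_of_nonneg_right (neg_abs_le α) h5
    have h10 := mul_le_mul hN h6 h5 (Nat.cast_nonneg N)
    have h11 := mul_le_mul_of_nonneg_left h8 (Nat.cast_nonneg (α := ℝ) n)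
    have h13 := mul_le_mul_of_nonneg_left h9 (Nat.cast_nonneg (α := ℝ) n)
    linarith
  calc _ ≤ Real.exp (Real.log F + N * Real.log (1 + ‖x‖)) := Real.exp_le_exp.2 h7
    _ = _ := by rw [Real.exp_add, Real.exp_log h12, ← Real.log_pow, Real.exp_log (by positivity)]

/-- Integrability of `f` and the lower bound for `v` make `e^(n p)` integrable with a power weight,
so that `p` grows at most logarithmically, hence is bounded above. -/
lemma bddAbove_poly_of_solution {n : ℕ} (hn : 0 < n) {α : ℝ} {u : E n → ℝ}
    (hf : Integrable (density n α u)) {p : MvPolynomial (Fin n) ℝ}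
    (hp : ∀ᵐ x, u x - 1 / gammaConst n * pot (density n α u) x = polyFun n p x) :
    BddAbove (range (polyFun n p)) := by
  set f := density n α u with hfdef
  have hγ := gammaConst_pos hn
  have hn' : (0 : ℝ) < n := by exact_mod_cast hn
  set L := ∫ y, f y with hL
  have hL0 : 0 ≤ L := integral_nonneg (density_nonneg α u)
  set N := ⌈n * (|α| + 1 / gammaConst n * L)⌉₊ with hN
  have hNle : n * (|α| + 1 / gammaConst n * L) ≤ N := Nat.le_ceil _
  have hcp := continuous_polyFun p
  have hint : Integrable fun x => Real.exp (n * polyFun n p x) * (1 + ‖x‖) ^ (-(N : ℝ)) := by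
    have hloc : Integrable ((closedBall (0 : E n) 1).indicator
        fun x => Real.exp (n * polyFun n p x)) := by
      rw [integrable_indicator_iff measurableSet_closedBall]
      exact ContinuousOn.integrableOn_compact (isCompact_closedBall _ _) (by fun_prop)
    refine (hf.add hloc).mono' ?_ ?_
    · exact (Continuous.mul (by fun_prop)
        (continuous_one_add_norm_rpow n _)).aestronglyMeasurable
    · filter_upwards [hp, ae_ne_zero hn, ae_integrable_logKernel hn hf] with x hx hx0 hxi
      have hfx : 0 ≤ f x := density_nonneg α u x
      rw [Real.norm_of_nonneg (by positivity), Pi.add_apply]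
      rcases le_total ‖x‖ 1 with h1 | h1
      · rw [indicator_of_mem (by simpa using h1)]
        have h2 : (1 + ‖x‖) ^ (-(N : ℝ)) ≤ 1 :=
          Real.rpow_le_one_of_one_le_of_nonpos (by simp) (by simp)
        have h3 := mul_le_of_le_one_right (Real.exp_pos (n * polyFun n p x)).le h2
        linarith
      · have h2 : 0 ≤ (closedBall (0 : E n) 1).indicator
            (fun x => Real.exp (n * polyFun n p x)) x :=
          indicator_nonneg (fun _ _ => (Real.exp_pos _).le) x
        have h11 := exp_mul_sub_pot_le hn hf h1 hxi hNle
        rw [hx] at h11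
        rw [Real.rpow_neg (by positivity), Real.rpow_natCast, ← div_eq_mul_inv]
        have h13 : Real.exp (n * polyFun n p x) / (1 + ‖x‖) ^ N ≤ f x := by
          rwa [div_le_iff₀ (by positivity)]
        linarith
  obtain ⟨A, B, hB, hle⟩ := polyFun_le_log p hn' N hint
  exact bddAbove_of_le_log hn p hB hle

/-- A solution is the sum of its logarithmic potential and a polynomial of degree at most `n - 1`
that is bounded above. -/
theorem exists_poly_of_solution {n : ℕ} (hn : 0 < n) {α : ℝ} {u : E n → ℝ}
    (hu : SolvesP0 n α u) : ∃ p : MvPolynomial (Fin n) ℝ, p.totalDegree ≤ n - 1 ∧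
      BddAbove (range (polyFun n p)) ∧
      ∀ᵐ x, u x - 1 / gammaConst n * pot (density n α u) x = polyFun n p x := by
  rcases Nat.even_or_odd n with he | ho
  · obtain ⟨N, hN⟩ := exists_tempered_of_even hn he hu
    have hharm := fun φ h1 h2 =>
      integral_sub_pot_mul_negLaplacianPow hn he hu.1 hu.2 (φ := φ) h1 h2
    obtain ⟨p, hp⟩ := exists_poly_of_tempered he
      (w := fun x => u x - 1 / gammaConst n * pot (density n α u) x)
      ((hu.2.1 he).1.sub ((locallyIntegrable_pot hn hu.1).smul (1 / gammaConst n))) hN hharm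
    have hb := bddAbove_poly_of_solution hn hu.1 hp
    refine ⟨p, ?_, hb, hp⟩
    have hlap : (polyLap n ^ (n / 2)) p = 0 := polyLap_pow_eq_zero fun φ h1 h2 => by
      rw [← hharm φ h1 h2]
      refine integral_congr_ae ?_
      filter_upwards [hp] with x hx
      rw [hx]
    have h2 := Nat.two_mul_div_two_of_even he
    have := totalDegree_lt_of_bddAbove (by omega) hb hlap
    omega
  · obtain ⟨p, hd, hp⟩ := exists_poly_of_odd hn ho hu.1 hu.2
    exact ⟨p, hd, bddAbove_poly_of_solution hn hu.1 hp, hp⟩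

/-! ### Local integrability of the density -/

lemma lintegral_norm_sub_rpow_le {n : ℕ} (hn : 0 < n) {c : ℝ} (hc : 0 ≤ c) (hcn : c < n) :
    ∃ C : ENNReal, C ≠ ⊤ ∧ ∀ x w : E n,
      ∫⁻ y in ball x 1, ENNReal.ofReal (‖y - w‖ ^ (-c)) ≤ C := by
  set g : E n → ENNReal := (ball (0 : E n) 1).indicator fun y => ENNReal.ofReal (‖y‖ ^ (-c)) with hg
  have hgm : Measurable g :=
    (Measurable.ennreal_ofReal (measurable_norm.pow_const _)).indicator measurableSet_ball
  have hgfin : ∫⁻ y, g y ≠ ⊤ := by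
    rw [hg, lintegral_indicator measurableSet_ball]
    have hi : IntegrableOn (fun y : E n => ‖y‖ ^ (-c)) (ball 0 1) := by
      refine integrableOn_ball_of_norm_le_rpow (C := 1) (α := c) ?_ ?_ ?_ ?_
      · simpa using Nat.one_le_iff_ne_zero.mpr hn.ne'
      · simpa using hcn
      · filter_upwards with y
        rw [Real.norm_of_nonneg (by positivity), one_mul]
      · exact (measurable_norm.pow_const _).aestronglyMeasurable
    rw [← ofReal_integral_eq_lintegral_ofReal hi (Eventually.of_forall fun y => by positivity)]
    exact ENNReal.ofReal_ne_top
  refine ⟨(∫⁻ y, g y) + volume (ball (0 : E n) 1), ENNReal.add_ne_top.2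
    ⟨hgfin, measure_ball_lt_top.ne⟩, fun x w => ?_⟩
  have hle : ∀ y : E n, ENNReal.ofReal (‖y - w‖ ^ (-c)) ≤ g (y - w) + 1 := by
    intro y
    by_cases h : y - w ∈ ball (0 : E n) 1
    · simp only [hg]
      rw [indicator_of_mem h]
      exact le_self_add
    · rw [mem_ball_zero_iff, not_lt] at h
      refine le_add_left (ENNReal.ofReal_le_one.2 ?_)
      exact Real.rpow_le_one_of_one_le_of_nonpos h (by linarith)
  calc _ ≤ ∫⁻ y in ball x 1, (g (y - w) + 1) := lintegral_mono fun y => hle y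
    _ = (∫⁻ y in ball x 1, g (y - w)) + volume (ball x 1) := by
        rw [lintegral_add_right _ measurable_const, setLIntegral_one]
    _ ≤ (∫⁻ y, g (y - w)) + volume (ball (0 : E n) 1) := by
        rw [Measure.addHaar_ball_center]
        exact add_le_add_left (setLIntegral_le_lintegral _ _) _
    _ = _ := by rw [lintegral_sub_right_eq_self]

/-- A product of three power singularities is bounded by the sum of the singularities with the total
exponent: the smallest base dominates. -/
lemma rpow_mul_rpow_mul_rpow_le {a b b' t s r : ℝ} (ha : 0 ≤ a) (hb : 0 ≤ b) (hb' : 0 ≤ b')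
    (ht : 0 < t) (hs : 0 < s) (hr : 0 < r) : t ^ (-a) * s ^ (-b) * r ^ (-b') ≤
      t ^ (-(a + b + b')) + s ^ (-(a + b + b')) + r ^ (-(a + b + b')) := by
  set μ := min t (min s r) with hμ
  have hμ0 : 0 < μ := lt_min ht (lt_min hs hr)
  have h1 : t ^ (-a) ≤ μ ^ (-a) :=
    Real.rpow_le_rpow_of_nonpos hμ0 (min_le_left _ _) (by linarith)
  have h2 : s ^ (-b) ≤ μ ^ (-b) :=
    Real.rpow_le_rpow_of_nonpos hμ0 ((min_le_right _ _).trans (min_le_left _ _)) (by linarith)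
  have h3 : r ^ (-b') ≤ μ ^ (-b') :=
    Real.rpow_le_rpow_of_nonpos hμ0 ((min_le_right _ _).trans (min_le_right _ _)) (by linarith)
  have h4 : t ^ (-a) * s ^ (-b) * r ^ (-b') ≤ μ ^ (-(a + b + b')) := by
    calc _ ≤ μ ^ (-a) * μ ^ (-b) * μ ^ (-b') := by gcongr
      _ = _ := by
        rw [← Real.rpow_add hμ0, ← Real.rpow_add hμ0]
        congr 1
        ring
  have p1 : 0 < t ^ (-(a + b + b')) := by positivity
  have p2 : 0 < s ^ (-(a + b + b')) := by positivity
  have p3 : 0 < r ^ (-(a + b + b')) := by positivity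
  have h5 : μ = t ∨ μ = s ∨ μ = r := by
    rcases min_choice t (min s r) with h | h
    · exact Or.inl (hμ.trans h)
    · rcases min_choice s r with h' | h'
      · exact Or.inr (Or.inl (hμ.trans (h.trans h')))
      · exact Or.inr (Or.inr (hμ.trans (h.trans h')))
  rcases h5 with h | h | h <;> rw [h] at h4 <;> linarith

lemma logSing_le_abs_logKernel {n : ℕ} (y z : E n) : logSing (y - z) ≤ |logKernel y z| := by
  refine max_le (abs_nonneg _) ?_
  rcases eq_or_ne y z with rfl | h
  · simp
  · have h1 : 0 < ‖y - z‖ := norm_pos_iff.2 (sub_ne_zero.2 h)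
    have h2 := Real.log_nonneg (show 1 ≤ 1 + ‖z‖ by simp)
    refine le_trans ?_ (le_abs_self _)
    rw [logKernel, Real.log_div (by positivity) h1.ne']
    linarith

lemma integrable_logSing_mul_of_logKernel {n : ℕ} {f : E n → ℝ} (hf : Integrable f) {y : E n}
    (h : Integrable fun z => logKernel y z * f z) : Integrable fun z => logSing (y - z) * f z := by
  refine h.mono
    ((measurable_logSing.comp (measurable_const.sub measurable_id)).aestronglyMeasurable.mul
    hf.aestronglyMeasurable) (Eventually.of_forall fun z => ?_)
  rw [norm_mul, norm_mul, Real.norm_of_nonneg (logSing_nonneg _), Real.norm_eq_abs]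
  gcongr
  exact logSing_le_abs_logKernel y z

lemma logSing_le_log_two_div {n : ℕ} {ρ : ℝ} (hρ : 0 < ρ) (hρ2 : ρ ≤ 2) {z : E n}
    (hz : ρ / 2 ≤ ‖z‖) : logSing z ≤ Real.log (2 / ρ) := by
  refine max_le (Real.log_nonneg (by rwa [one_le_div hρ])) ?_
  rw [← Real.log_inv]
  refine Real.log_le_log (by have : 0 < ‖z‖ := by linarith
                             positivity) ?_
  rw [← inv_div]
  exact inv_anti₀ (by positivity) hz

/-- Splitting of the potential into its local singular part and a logarithmic remainder. -/
lemma pot_le_of_mem_ball {n : ℕ} {f : E n → ℝ} (hf0 : ∀ x, 0 ≤ f x) (hf : Integrable f)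
    {x y : E n} {ρ : ℝ} (hρ : 0 < ρ) (hρ2 : ρ ≤ 2) (hy : y ∈ ball x (ρ / 2))
    (hyi : Integrable fun z => logKernel y z * f z) :
    pot f y ≤ (Real.log (4 * (1 + ‖x‖)) + Real.log (2 / ρ)) * (∫ z, f z) +
      ∫ z in ball x ρ, logSing (y - z) * f z := by
  have hyn : ‖y‖ ≤ 1 + ‖x‖ := by
    have h1 := norm_le_norm_add_norm_sub' y x
    rw [mem_ball, dist_eq_norm] at hy
    linarith
  have hsi := integrable_logSing_mul_of_logKernel hf hyi
  have hind : Integrable ((ball x ρ).indicator fun z => logSing (y - z) * f z) :=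
    hsi.indicator measurableSet_ball
  rw [← integral_indicator measurableSet_ball, ← integral_const_mul, ← integral_add
    (hf.const_mul _) hind]
  refine integral_mono hyi ((hf.const_mul _).add hind) fun z => ?_
  have h1 := logKernel_le y z
  have h2 : Real.log (2 + 2 * ‖y‖) ≤ Real.log (4 * (1 + ‖x‖)) :=
    Real.log_le_log (by positivity) (by linarith [norm_nonneg x])
  have h3 : 0 ≤ Real.log (2 / ρ) := Real.log_nonneg (by rwa [one_le_div hρ])
  have hfz := hf0 z
  by_cases hz : z ∈ ball x ρ
  · rw [indicator_of_mem hz, ← add_mul]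
    exact mul_le_mul_of_nonneg_right (by linarith) hfz
  · rw [indicator_of_notMem hz, add_zero]
    refine mul_le_mul_of_nonneg_right ?_ hfz
    have h4 : ρ / 2 ≤ ‖y - z‖ := by
      rw [mem_ball, dist_eq_norm, not_lt] at hz
      rw [mem_ball, dist_eq_norm] at hy
      have := norm_sub_le_norm_sub_add_norm_sub z y x
      rw [norm_sub_rev z y] at this
      linarith
    have h5 : logSing (y - z) ≤ Real.log (2 / ρ) := logSing_le_log_two_div hρ hρ2 h4
    linarith

/-- Jensen's inequality for the exponential of a logarithmic potential of a small mass, in the form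
`m e^(κI) ≤ ∫ e^(κ m log (4/|y-z|)) f(z) dz` with `κ m ≤ b`. Where the right-hand side is finite it
is integrated from the tangent line inequality for the exponential. -/
lemma exp_integral_logSing_le {n : ℕ} (hn : 0 < n) {f : E n → ℝ} (hf0 : ∀ x, 0 ≤ f x)
    (hf : Integrable f) {κ b : ℝ} (hb : 0 < b) {x y : E n} {ρ : ℝ}
    (hρ2 : ρ ≤ 2) (hy : y ∈ ball x (ρ / 2)) (hm : κ * ∫ z in ball x ρ, f z ≤ b)
    (hyi : Integrable fun z => logSing (y - z) * f z) :
    ENNReal.ofReal (∫ z in ball x ρ, f z) *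
      ENNReal.ofReal (Real.exp (κ * ∫ z in ball x ρ, logSing (y - z) * f z)) ≤
      ∫⁻ z in ball x ρ, ENNReal.ofReal (f z) * ENNReal.ofReal ((‖y - z‖ / 4) ^ (-b)) := by
  set m := ∫ z in ball x ρ, f z with hmdef
  set I := ∫ z in ball x ρ, logSing (y - z) * f z with hI
  set h : E n → ℝ := fun z => f z * (‖y - z‖ / 4) ^ (-b) with hh
  have hm0 : 0 ≤ m := integral_nonneg fun z => hf0 z
  have hh0 : ∀ z, 0 ≤ h z := fun z => mul_nonneg (hf0 z) (by positivity)
  have hmeas : AEStronglyMeasurable h (volume.restrict (ball x ρ)) :=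
    hf.aestronglyMeasurable.restrict.mul
      (Measurable.aestronglyMeasurable (by fun_prop))
  have heq : (fun z => ENNReal.ofReal (f z) * ENNReal.ofReal ((‖y - z‖ / 4) ^ (-b))) =
      fun z => ENNReal.ofReal (h z) := funext fun z => (ENNReal.ofReal_mul (hf0 z)).symm
  rw [heq, ← ENNReal.ofReal_mul hm0]
  by_cases hint : IntegrableOn h (ball x ρ)
  · rw [← ofReal_integral_eq_lintegral_ofReal hint (Eventually.of_forall hh0)]
    refine ENNReal.ofReal_le_ofReal ?_
    have hpt : ∀ᵐ z ∂(volume.restrict (ball x ρ)),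
        Real.exp (κ * I) * (1 - κ * I) * f z + Real.exp (κ * I) * κ * m * (logSing (y - z) * f z) ≤
          h z := by
      have hne : ∀ᵐ z : E n, z ≠ y := by
        have : Nonempty (Fin n) := ⟨⟨0, hn⟩⟩
        exact compl_mem_ae_iff.2 (measure_singleton y)
      filter_upwards [ae_restrict_of_ae hne, ae_restrict_mem measurableSet_ball] with z hzy hz
      have hr0 : 0 < ‖y - z‖ := norm_pos_iff.2 (sub_ne_zero.2 hzy.symm)
      have hr4 : ‖y - z‖ ≤ 4 := by
        rw [mem_ball, dist_eq_norm] at hz hy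
        have := norm_sub_le_norm_sub_add_norm_sub y x z
        rw [norm_sub_rev x z] at this
        linarith
      have h1 : Real.exp (κ * I) * (1 + κ * (m * logSing (y - z) - I)) ≤
          Real.exp (κ * m * logSing (y - z)) := by
        have h2 := Real.add_one_le_exp (κ * (m * logSing (y - z) - I))
        calc _ ≤ Real.exp (κ * I) * Real.exp (κ * (m * logSing (y - z) - I)) := by
              gcongr
              linarith
          _ = _ := by
              rw [← Real.exp_add]
              congr 1
              ring
      have h3 : Real.exp (κ * m * logSing (y - z)) ≤ (‖y - z‖ / 4) ^ (-b) := by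
        have hq : 0 < ‖y - z‖ / 4 := by positivity
        rw [Real.rpow_def_of_pos hq]
        refine Real.exp_le_exp.2 ?_
        have h4 : logSing (y - z) ≤ -Real.log (‖y - z‖ / 4) := by
          refine max_le ?_ ?_
          · rw [Left.nonneg_neg_iff]
            exact Real.log_nonpos hq.le (by linarith)
          · exact neg_le_neg (Real.log_le_log hq (by linarith))
        have h5 := logSing_nonneg (y - z)
        nlinarith
      have h6 := mul_le_mul_of_nonneg_left (h1.trans h3) (hf0 z)
      simp only [hh]
      linarith
    have hi1 : IntegrableOn f (ball x ρ) := hf.integrableOn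
    have hi2 : IntegrableOn (fun z => logSing (y - z) * f z) (ball x ρ) := hyi.integrableOn
    have := integral_mono_ae ((hi1.const_mul _).add (hi2.const_mul _)) hint hpt
    simp only [Pi.add_apply] at this
    rw [integral_add (hi1.const_mul _) (hi2.const_mul _), integral_const_mul,
      integral_const_mul] at this
    refine le_trans (le_of_eq ?_) this
    ring
  · have : ∫⁻ z in ball x ρ, ENNReal.ofReal (h z) = ⊤ := by
      by_contra hne
      refine hint ⟨hmeas, ?_⟩
      rw [hasFiniteIntegral_iff_ofReal (Eventually.of_forall hh0)]
      exact lt_top_iff_ne_top.2 hne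
    rw [this]
    exact le_top

/-- Local integrability of the density against a power singularity, on balls of small mass and
with explicit dependence on the center and the radius. The density is bounded by the exponential of
its own potential; Jensen's inequality and Tonelli's theorem reduce the claim to the integrability
of a product of three power singularities, whose total exponent is less than `n`. -/
theorem exists_lintegral_density_mul_rpow_le {n : ℕ} (hn : 0 < n) {f : E n → ℝ}
    (hf0 : ∀ x, 0 ≤ f x) (hf : Integrable f) {α κ D : ℝ} (hα : -1 < α) (hκ : 0 ≤ κ) (hD : 0 ≤ D)
    (hub : ∀ᵐ y, f y ≤ D * ‖y‖ ^ (n * α) * Real.exp (κ * pot f y)) :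
    ∃ b : ℝ, 0 < b ∧ ∃ C : ENNReal, C ≠ ⊤ ∧ ∃ k : ℝ, 0 ≤ k ∧ ∀ (x : E n) (ρ : ℝ), 0 < ρ → ρ ≤ 2 →
      κ * ∫ z in ball x ρ, f z ≤ b →
      ∫⁻ y in ball x (ρ / 2), ENNReal.ofReal (f y * ‖x - y‖ ^ (-b)) ≤
        ENNReal.ofReal ((4 * (1 + ‖x‖)) ^ k * (2 / ρ) ^ k) * C := by
  have hn' : (0 : ℝ) < n := by exact_mod_cast hn
  set L := ∫ z, f z with hL
  have hL0 : 0 ≤ L := integral_nonneg hf0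
  -- `|y|^(nα)` is split into its singular part `|y|^(-a)` and its growing part `|y|^a'`.
  set a := n * max (-α) 0 with ha
  set a' := n * max α 0 with ha'
  have ha0 : 0 ≤ a := by positivity
  have ha'0 : 0 ≤ a' := by positivity
  have han : a < n := by
    have : max (-α) 0 < 1 := max_lt (by linarith) one_pos
    rw [ha]
    nlinarith
  have haa : n * α = -a + a' := by
    rw [ha, ha']
    rcases le_total α 0 with h | h
    · rw [max_eq_left (by linarith), max_eq_right h]; ring
    · rw [max_eq_right (by linarith), max_eq_left h]; ring
  -- This choice makes `a + 2b < n`.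
  set b := (n - a) / 3 with hb
  have hb0 : 0 < b := by rw [hb]; linarith
  set c := a + b + b with hc
  have hcn : c < n := by rw [hc, hb]; linarith
  have hc0 : 0 ≤ c := by positivity
  obtain ⟨C, hC, hCb⟩ := lintegral_norm_sub_rpow_le hn hc0 hcn
  set k := a' + κ * L with hk
  have hk0 : 0 ≤ k := by positivity
  refine ⟨b, hb0, ENNReal.ofReal D * (ENNReal.ofReal (4 ^ b) * (C + C + C)), ?_, k, hk0,
    fun x ρ hρ hρ2 hm => ?_⟩
  · refine ENNReal.mul_ne_top ENNReal.ofReal_ne_top (ENNReal.mul_ne_top ENNReal.ofReal_ne_top ?_)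
    simp [hC]
  set m := ∫ z in ball x ρ, f z with hmdef
  have hm0 : 0 ≤ m := integral_nonneg fun z => hf0 z
  have hne : ∀ w : E n, ∀ᵐ y : E n, y ≠ w := fun w => by
    have : Nonempty (Fin n) := ⟨⟨0, hn⟩⟩
    exact compl_mem_ae_iff.2 (measure_singleton w)
  have hsub : ball x (ρ / 2) ⊆ ball x ρ := ball_subset_ball (by linarith)
  rcases hm0.eq_or_lt with hmz | hmpos
  · -- No mass: the density vanishes on the ball.
    have h1 := (setIntegral_eq_zero_iff_of_nonneg_ae (Eventually.of_forall fun z => hf0 z)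
      hf.integrableOn).1 hmz.symm
    have h2 : ∫⁻ y in ball x (ρ / 2), ENNReal.ofReal (f y * ‖x - y‖ ^ (-b)) = 0 := by
      rw [← lintegral_zero (μ := volume.restrict (ball x (ρ / 2)))]
      refine lintegral_congr_ae ?_
      filter_upwards [ae_restrict_of_ae_restrict_of_subset hsub h1] with y hy
      rw [hy]
      simp
    rw [h2]
    exact zero_le
  set W := ENNReal.ofReal (D * (4 * (1 + ‖x‖)) ^ k * (2 / ρ) ^ k) with hW
  have hX : 1 ≤ 4 * (1 + ‖x‖) := by linarith [norm_nonneg x]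
  have hR : 1 ≤ 2 / ρ := by rwa [one_le_div hρ]
  -- The pointwise bound, after Jensen's inequality.
  have hpt : ∀ᵐ y ∂(volume.restrict (ball x (ρ / 2))),
      ENNReal.ofReal m * ENNReal.ofReal (f y * ‖x - y‖ ^ (-b)) ≤
      W * ∫⁻ z in ball x ρ, ENNReal.ofReal (f z) *
        ENNReal.ofReal (‖y‖ ^ (-a) * ‖x - y‖ ^ (-b) * (‖y - z‖ / 4) ^ (-b)) := by
    filter_upwards [ae_restrict_of_ae hub, ae_restrict_of_ae (hne 0),
      ae_restrict_of_ae (ae_integrable_logKernel hn hf), ae_restrict_mem measurableSet_ball]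
      with y hyub hy0 hyi hy
    have hyp : 0 < ‖y‖ := norm_pos_iff.2 hy0
    have hyn : ‖y‖ ≤ 4 * (1 + ‖x‖) := by
      have h1 := norm_le_norm_add_norm_sub' y x
      rw [mem_ball, dist_eq_norm] at hy
      linarith [norm_nonneg x]
    have h1 := pot_le_of_mem_ball hf0 hf hρ hρ2 hy hyi
    have h2 := exp_integral_logSing_le hn hf0 hf hb0 hρ2 hy hm
      (integrable_logSing_mul_of_logKernel hf hyi)
    set I := ∫ z in ball x ρ, logSing (y - z) * f z with hI
    have h3 : Real.exp (κ * pot f y) ≤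
        (4 * (1 + ‖x‖)) ^ (κ * L) * (2 / ρ) ^ (κ * L) * Real.exp (κ * I) := by
      rw [Real.rpow_def_of_pos (by positivity), Real.rpow_def_of_pos (by positivity),
        ← Real.exp_add, ← Real.exp_add]
      refine Real.exp_le_exp.2 ?_
      have := mul_le_mul_of_nonneg_left h1 hκ
      linarith
    have h4 : ‖y‖ ^ (n * α) ≤ ‖y‖ ^ (-a) * (4 * (1 + ‖x‖)) ^ a' := by
      rw [haa, Real.rpow_add hyp]
      gcongr
    have h5 : (2 / ρ) ^ (κ * L) ≤ (2 / ρ) ^ k :=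
      Real.rpow_le_rpow_of_exponent_le hR (by linarith)
    have h6 : f y * ‖x - y‖ ^ (-b) ≤ D * (4 * (1 + ‖x‖)) ^ k * (2 / ρ) ^ k *
        (‖y‖ ^ (-a) * ‖x - y‖ ^ (-b)) * Real.exp (κ * I) := by
      calc _ ≤ D * (‖y‖ ^ (-a) * (4 * (1 + ‖x‖)) ^ a') *
            ((4 * (1 + ‖x‖)) ^ (κ * L) * (2 / ρ) ^ k * Real.exp (κ * I)) * ‖x - y‖ ^ (-b) := by
            refine mul_le_mul_of_nonneg_right (hyub.trans ?_) (by positivity)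
            refine mul_le_mul (mul_le_mul_of_nonneg_left h4 hD) (h3.trans ?_)
              (Real.exp_pos _).le (by positivity)
            gcongr
        _ = _ := by
            have hX' : (4 * (1 + ‖x‖)) ^ k =
                (4 * (1 + ‖x‖)) ^ a' * (4 * (1 + ‖x‖)) ^ (κ * L) := by
              rw [hk, Real.rpow_add (by positivity) a']
            rw [hX']
            ring
    calc _ ≤ ENNReal.ofReal m * (W * ENNReal.ofReal (‖y‖ ^ (-a) * ‖x - y‖ ^ (-b)) *
          ENNReal.ofReal (Real.exp (κ * I))) := by
          rw [hW, ← ENNReal.ofReal_mul (p := _ * (4 * (1 + ‖x‖)) ^ k * _) (by positivity),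
            ← ENNReal.ofReal_mul (q := Real.exp (κ * I)) (by positivity)]
          exact mul_le_mul' le_rfl (ENNReal.ofReal_le_ofReal h6)
      _ = W * (ENNReal.ofReal (‖y‖ ^ (-a) * ‖x - y‖ ^ (-b)) *
          (ENNReal.ofReal m * ENNReal.ofReal (Real.exp (κ * I)))) := by ring
      _ ≤ W * (ENNReal.ofReal (‖y‖ ^ (-a) * ‖x - y‖ ^ (-b)) *
          ∫⁻ z in ball x ρ, ENNReal.ofReal (f z) * ENNReal.ofReal ((‖y - z‖ / 4) ^ (-b))) := by
          gcongr
      _ = _ := by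
          rw [← lintegral_const_mul' _ _ ENNReal.ofReal_ne_top]
          congr 1
          refine lintegral_congr fun z => ?_
          rw [ENNReal.ofReal_mul (by positivity) (q := (‖y - z‖ / 4) ^ (-b))]
          ring
  have hinner : ∀ z : E n, ∫⁻ y in ball x 1,
      ENNReal.ofReal (‖y‖ ^ (-a) * ‖x - y‖ ^ (-b) * (‖y - z‖ / 4) ^ (-b)) ≤
      ENNReal.ofReal (4 ^ b) * (C + C + C) := by
    intro z
    have h1 : ∀ᵐ y ∂(volume.restrict (ball x 1)),
        ENNReal.ofReal (‖y‖ ^ (-a) * ‖x - y‖ ^ (-b) * (‖y - z‖ / 4) ^ (-b)) ≤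
        ENNReal.ofReal (4 ^ b) * (ENNReal.ofReal (‖y - 0‖ ^ (-c)) +
          ENNReal.ofReal (‖y - x‖ ^ (-c)) + ENNReal.ofReal (‖y - z‖ ^ (-c))) := by
      filter_upwards [ae_restrict_of_ae (hne 0), ae_restrict_of_ae (hne x),
        ae_restrict_of_ae (hne z)] with y h0 hx hz
      have t0 : 0 < ‖y‖ := norm_pos_iff.2 h0
      have tx : 0 < ‖x - y‖ := norm_pos_iff.2 (sub_ne_zero.2 hx.symm)
      have tz : 0 < ‖y - z‖ := norm_pos_iff.2 (sub_ne_zero.2 hz)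
      have h2 := rpow_mul_rpow_mul_rpow_le ha0 hb0.le hb0.le t0 tx tz
      rw [sub_zero, norm_sub_rev y x, ← ENNReal.ofReal_add (by positivity) (by positivity),
        ← ENNReal.ofReal_add (by positivity) (by positivity),
        ← ENNReal.ofReal_mul (by positivity)]
      refine ENNReal.ofReal_le_ofReal ?_
      have h3 : (‖y - z‖ / 4) ^ (-b) = 4 ^ b * ‖y - z‖ ^ (-b) := by
        rw [Real.div_rpow tz.le (by norm_num), Real.rpow_neg (by norm_num : (0 : ℝ) ≤ 4),
          div_inv_eq_mul, mul_comm]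
      calc _ = 4 ^ b * (‖y‖ ^ (-a) * ‖x - y‖ ^ (-b) * ‖y - z‖ ^ (-b)) := by
            rw [h3]
            ring
        _ ≤ _ := by gcongr
    have hmeasc : ∀ w : E n, Measurable fun y : E n => ENNReal.ofReal (‖y - w‖ ^ (-c)) :=
      fun w => by fun_prop
    have hmeas2 : Measurable fun y : E n =>
        ENNReal.ofReal (‖y - 0‖ ^ (-c)) + ENNReal.ofReal (‖y - x‖ ^ (-c)) :=
      (hmeasc 0).add (hmeasc x)
    refine (lintegral_mono_ae h1).trans ?_
    rw [lintegral_const_mul' _ _ ENNReal.ofReal_ne_top,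
      lintegral_add_left hmeas2, lintegral_add_left (hmeasc 0)]
    gcongr <;> exact hCb _ _
  have hfm : AEMeasurable (fun z => ENNReal.ofReal (f z)) (volume.restrict (ball x ρ)) :=
    hf.aestronglyMeasurable.aemeasurable.ennreal_ofReal.restrict
  have htotal : ENNReal.ofReal m *
      ∫⁻ y in ball x (ρ / 2), ENNReal.ofReal (f y * ‖x - y‖ ^ (-b)) ≤
      ENNReal.ofReal m * (W * (ENNReal.ofReal (4 ^ b) * (C + C + C))) := by
    rw [← lintegral_const_mul' _ _ ENNReal.ofReal_ne_top]
    calc _ ≤ ∫⁻ y in ball x (ρ / 2), W * ∫⁻ z in ball x ρ, ENNReal.ofReal (f z) *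
          ENNReal.ofReal (‖y‖ ^ (-a) * ‖x - y‖ ^ (-b) * (‖y - z‖ / 4) ^ (-b)) :=
          lintegral_mono_ae hpt
      _ ≤ ∫⁻ y in ball x 1, W * ∫⁻ z in ball x ρ, ENNReal.ofReal (f z) *
          ENNReal.ofReal (‖y‖ ^ (-a) * ‖x - y‖ ^ (-b) * (‖y - z‖ / 4) ^ (-b)) :=
          lintegral_mono_set (ball_subset_ball (by linarith))
      _ = W * ∫⁻ z in ball x ρ, ENNReal.ofReal (f z) * ∫⁻ y in ball x 1,
          ENNReal.ofReal (‖y‖ ^ (-a) * ‖x - y‖ ^ (-b) * (‖y - z‖ / 4) ^ (-b)) := by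
          rw [lintegral_const_mul' _ _ ENNReal.ofReal_ne_top, lintegral_lintegral_swap]
          · congr 1
            refine lintegral_congr fun z => ?_
            rw [lintegral_const_mul' _ _ ENNReal.ofReal_ne_top]
          · change AEMeasurable (fun p : E n × E n => ENNReal.ofReal (f p.2) *
              ENNReal.ofReal (‖p.1‖ ^ (-a) * ‖x - p.1‖ ^ (-b) * (‖p.1 - p.2‖ / 4) ^ (-b))) _
            exact hfm.comp_snd.mul (Measurable.aemeasurable (by fun_prop))
      _ ≤ W * ∫⁻ z in ball x ρ, ENNReal.ofReal (f z) *
          (ENNReal.ofReal (4 ^ b) * (C + C + C)) := by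
          gcongr
          exact hinner _
      _ = _ := by
          rw [lintegral_mul_const'' _ hfm, ← ofReal_integral_eq_lintegral_ofReal hf.integrableOn
            (Eventually.of_forall fun z => hf0 z)]
          ring
  have hfin := (ENNReal.mul_le_mul_iff_right (ENNReal.ofReal_pos.2 hmpos).ne'
    ENNReal.ofReal_ne_top).1 htotal
  refine hfin.trans (le_of_eq ?_)
  rw [hW, mul_assoc D, ENNReal.ofReal_mul hD]
  ring

/-! ### Convergence and asymptotics of the potential -/

/-- Absolute continuity of the integral, uniformly over all balls of a given radius. -/
lemma exists_radius_setIntegral_le {n : ℕ} (hn : 0 < n) {f : E n → ℝ} (hf0 : ∀ x, 0 ≤ f x)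
    (hf : Integrable f) {ε : ℝ} (hε : 0 < ε) :
    ∃ ρ : ℝ, 0 < ρ ∧ ρ ≤ 2 ∧ ∀ x : E n, ∫ y in ball x ρ, f y ≤ ε := by
  have hfin : ∫⁻ y, ENNReal.ofReal (f y) ≠ ⊤ := by
    rw [← ofReal_integral_eq_lintegral_ofReal hf (Eventually.of_forall hf0)]
    exact ENNReal.ofReal_ne_top
  obtain ⟨δ, hδ, hs⟩ := exists_pos_setLIntegral_lt_of_measure_lt hfin
    (ENNReal.ofReal_pos.2 hε).ne'
  have ht : Tendsto (fun ρ : ℝ => ENNReal.ofReal (ρ ^ n) * volume (ball (0 : E n) 1)) (𝓝[>] 0)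
      (𝓝 0) := by
    have h1 : Tendsto (fun ρ : ℝ => ENNReal.ofReal (ρ ^ n)) (𝓝 0) (𝓝 0) := by
      have : Continuous fun ρ : ℝ => ENNReal.ofReal (ρ ^ n) :=
        ENNReal.continuous_ofReal.comp (continuous_pow n)
      simpa [hn.ne'] using this.tendsto 0
    have h2 := ENNReal.Tendsto.mul_const (b := volume (ball (0 : E n) 1)) h1
      (Or.inr measure_ball_lt_top.ne)
    rw [zero_mul] at h2
    exact h2.mono_left nhdsWithin_le_nhds
  have h2 : ∀ᶠ ρ : ℝ in 𝓝[>] 0, ρ ≤ 2 :=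
    nhdsWithin_le_nhds (Iic_mem_nhds (by norm_num))
  obtain ⟨ρ, h1, h3, h4⟩ := ((ht.eventually_lt_const hδ).and (h2.and self_mem_nhdsWithin)).exists
  refine ⟨ρ, h4, h3, fun x => ?_⟩
  have h5 : volume (ball x ρ) < δ := by
    rw [Measure.addHaar_ball_of_pos _ _ h4]
    simpa using h1
  have h6 := hs _ h5
  rw [← ofReal_integral_eq_lintegral_ofReal hf.integrableOn (Eventually.of_forall hf0)] at h6
  exact ((ENNReal.ofReal_lt_ofReal_iff hε).1 h6).le

/-- The logarithm is at most `M`, except where it is dominated by a power with a coefficient that is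
exponentially small in `M`. -/
lemma logSing_le_add_rpow {n : ℕ} {b M : ℝ} (hb : 0 < b) (hM : 0 ≤ M) (z : E n) :
    logSing z ≤ M + 2 / b * Real.exp (-(M * b / 2)) * ‖z‖ ^ (-b) := by
  have h0 : 0 ≤ 2 / b * Real.exp (-(M * b / 2)) * ‖z‖ ^ (-b) := by positivity
  rcases eq_or_ne z 0 with rfl | hz
  · simp only [logSing, norm_zero, Real.log_zero, neg_zero, max_self] at h0 ⊢
    linarith
  have hz : 0 < ‖z‖ := norm_pos_iff.2 hz
  refine max_le (by linarith) ?_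
  rcases le_or_gt (-Real.log ‖z‖) M with h | h
  · linarith
  · have h1 : -Real.log ‖z‖ ≤ 2 / b * Real.exp (-Real.log ‖z‖ * b / 2) := by
      have := Real.add_one_le_exp (-Real.log ‖z‖ * b / 2)
      calc -Real.log ‖z‖ = 2 / b * (-Real.log ‖z‖ * b / 2) := by field_simp
        _ ≤ _ := by gcongr; linarith
    have h2 : Real.exp (-Real.log ‖z‖ * b / 2) ≤ Real.exp (-(M * b / 2)) * ‖z‖ ^ (-b) := by
      rw [Real.rpow_def_of_pos hz, ← Real.exp_add]
      refine Real.exp_le_exp.2 ?_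
      nlinarith
    calc _ ≤ _ := h1
      _ ≤ 2 / b * (Real.exp (-(M * b / 2)) * ‖z‖ ^ (-b)) := by gcongr
      _ ≤ _ := by linarith

/-- The singular part of the potential converges everywhere, and is bounded by the mass near the
point times the logarithm of the distance to the origin. -/
theorem exists_integral_logSing_mul_le {n : ℕ} (hn : 0 < n) {f : E n → ℝ}
    (hf0 : ∀ x, 0 ≤ f x) (hf : Integrable f) {α κ D : ℝ} (hα : -1 < α) (hκ : 0 ≤ κ) (hD : 0 ≤ D)
    (hub : ∀ᵐ y, f y ≤ D * ‖y‖ ^ (n * α) * Real.exp (κ * pot f y)) :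
    ∃ C : ℝ, 0 ≤ C ∧ ∀ x : E n, Integrable (fun y => logSing (x - y) * f y) ∧
      ∫ y, logSing (x - y) * f y ≤ C * (1 + Real.log (1 + ‖x‖) * ∫ y in ball x 1, f y) := by
  obtain ⟨b, hb, C, hC, k, hk, hbound⟩ :=
    exists_lintegral_density_mul_rpow_le hn hf0 hf hα hκ hD hub
  obtain ⟨ρ, hρ, hρ2, hmass⟩ := exists_radius_setIntegral_le hn hf0 hf
    (show 0 < b / (κ + 1) by positivity)
  set L := ∫ y, f y with hL
  have hL0 : 0 ≤ L := integral_nonneg hf0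
  set C₁ := (2 / ρ) ^ k * C.toReal with hC₁
  have hC₁0 : 0 ≤ C₁ := by positivity
  have hlogρ : 0 ≤ Real.log (2 / ρ) := Real.log_nonneg (by rwa [one_le_div hρ])
  have hlog4 : 0 ≤ Real.log 4 := Real.log_nonneg (by norm_num)
  refine ⟨(Real.log (2 / ρ) + 2 * k / b * Real.log 4) * L + 2 / b * C₁ + 2 * k / b, by positivity,
    fun x => ?_⟩
  set g : E n → ℝ := (ball x (ρ / 2)).indicator fun y => f y * ‖x - y‖ ^ (-b) with hg
  have hg0 : ∀ y, 0 ≤ g y := fun y =>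
    indicator_nonneg (fun y _ => mul_nonneg (hf0 y) (by positivity)) y
  have hgl : ∫⁻ y in ball x (ρ / 2), ENNReal.ofReal (f y * ‖x - y‖ ^ (-b)) ≤
      ENNReal.ofReal ((4 * (1 + ‖x‖)) ^ k * C₁) := by
    refine (hbound x ρ hρ hρ2 ?_).trans (le_of_eq ?_)
    · calc κ * ∫ z in ball x ρ, f z ≤ κ * (b / (κ + 1)) := by gcongr; exact hmass x
        _ ≤ b := by rw [mul_div_assoc', div_le_iff₀ (by positivity)]; nlinarith
    · rw [hC₁, ← mul_assoc, ENNReal.ofReal_mul (p := (4 * (1 + ‖x‖)) ^ k * (2 / ρ) ^ k)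
        (by positivity), ENNReal.ofReal_toReal hC]
  have hgon : IntegrableOn (fun y => f y * ‖x - y‖ ^ (-b)) (ball x (ρ / 2)) := by
    refine ⟨hf.aestronglyMeasurable.restrict.mul (Measurable.aestronglyMeasurable (by fun_prop)),
      ?_⟩
    rw [hasFiniteIntegral_iff_ofReal
      (Eventually.of_forall fun y => mul_nonneg (hf0 y) (by positivity))]
    exact hgl.trans_lt ENNReal.ofReal_lt_top
  have hgi : Integrable g := hgon.integrable_indicator measurableSet_ball
  have hgint : ∫ y, g y ≤ (4 * (1 + ‖x‖)) ^ k * C₁ := by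
    rw [hg, integral_indicator measurableSet_ball]
    rw [← ofReal_integral_eq_lintegral_ofReal hgon
      (Eventually.of_forall fun y => mul_nonneg (hf0 y) (by positivity))] at hgl
    exact (ENNReal.ofReal_le_ofReal_iff (by positivity)).1 hgl
  -- With this `M`, the factor `e^(-Mb/2)` compensates the growth `(4 (1 + |x|))^k` exactly.
  set M := 2 * k / b * Real.log (4 * (1 + ‖x‖)) with hM
  have hX : 1 ≤ 4 * (1 + ‖x‖) := by linarith [norm_nonneg x]
  have hlogX : 0 ≤ Real.log (4 * (1 + ‖x‖)) := Real.log_nonneg hX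
  have hM0 : 0 ≤ M := by positivity
  set q := 2 / b * Real.exp (-(M * b / 2)) with hq
  have hq0 : 0 ≤ q := by positivity
  set F : E n → ℝ := fun y => (Real.log (2 / ρ) + M) * (ball x 1).indicator f y + q * g y with hF
  have hi1 : Integrable ((ball x 1).indicator f) := hf.indicator measurableSet_ball
  have hFi : Integrable F := (hi1.const_mul _).add (hgi.const_mul _)
  have hpt : ∀ y, logSing (x - y) * f y ≤ F y := by
    intro y
    have hfy := hf0 y
    have hind : 0 ≤ (ball x 1).indicator f y := indicator_nonneg (fun y _ => hf0 y) y
    have hgy := hg0 y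
    simp only [hF]
    by_cases h1 : y ∈ ball x 1
    · rw [indicator_of_mem h1]
      by_cases h2 : y ∈ ball x (ρ / 2)
      · have h3 := logSing_le_add_rpow hb hM0 (x - y)
        have h4 : g y = f y * ‖x - y‖ ^ (-b) := by rw [hg, indicator_of_mem h2]
        rw [h4]
        have h5 := mul_le_mul_of_nonneg_right h3 hfy
        have h6 := mul_nonneg hlogρ hfy
        rw [hq]
        linarith
      · have h3 : logSing (x - y) ≤ Real.log (2 / ρ) := by
          refine logSing_le_log_two_div hρ hρ2 ?_
          rw [mem_ball, dist_eq_norm, not_lt, norm_sub_rev] at h2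
          exact h2
        have h4 := mul_le_mul_of_nonneg_right h3 hfy
        have h5 := mul_nonneg hM0 hfy
        have h6 := mul_nonneg hq0 hgy
        linarith
    · have h3 : logSing (x - y) = 0 := by
        refine logSing_eq_zero ?_
        rw [mem_ball, dist_eq_norm, not_lt, norm_sub_rev] at h1
        exact h1
      rw [h3, zero_mul]
      positivity
  have hN : Integrable fun y => logSing (x - y) * f y := by
    refine hFi.mono' ((measurable_logSing.comp
      (measurable_const.sub measurable_id)).aestronglyMeasurable.mul hf.aestronglyMeasurable)
      (Eventually.of_forall fun y => ?_)
    rw [Real.norm_of_nonneg (mul_nonneg (logSing_nonneg _) (hf0 y))]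
    exact hpt y
  refine ⟨hN, (integral_mono hN hFi hpt).trans ?_⟩
  rw [hF, integral_add (hi1.const_mul _) (hgi.const_mul _), integral_const_mul,
    integral_const_mul, integral_indicator measurableSet_ball]
  set m := ∫ y in ball x 1, f y with hm
  have hm0 : 0 ≤ m := integral_nonneg fun y => hf0 y
  have hmL : m ≤ L := setIntegral_le_integral hf (Eventually.of_forall hf0)
  have h1 : q * ∫ y, g y ≤ 2 / b * C₁ := by
    calc q * ∫ y, g y ≤ q * ((4 * (1 + ‖x‖)) ^ k * C₁) := by gcongr
      _ = 2 / b * (Real.exp (-(M * b / 2)) * (4 * (1 + ‖x‖)) ^ k) * C₁ := by rw [hq]; ring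
      _ = _ := by
        rw [Real.rpow_def_of_pos (by positivity), ← Real.exp_add, hM]
        have : -(2 * k / b * Real.log (4 * (1 + ‖x‖)) * b / 2) +
            Real.log (4 * (1 + ‖x‖)) * k = 0 := by
          field_simp
          ring
        rw [this, Real.exp_zero, mul_one]
  have hlx : 0 ≤ Real.log (1 + ‖x‖) := Real.log_nonneg (by simp)
  have h2 : Real.log (4 * (1 + ‖x‖)) = Real.log 4 + Real.log (1 + ‖x‖) :=
    Real.log_mul (by norm_num) (by positivity)
  have h3 : (Real.log (2 / ρ) + M) * m ≤
      (Real.log (2 / ρ) + 2 * k / b * Real.log 4) * L + 2 * k / b * (Real.log (1 + ‖x‖) * m) := by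
    have h4 : (Real.log (2 / ρ) + 2 * k / b * Real.log 4) * m ≤
      (Real.log (2 / ρ) + 2 * k / b * Real.log 4) * L := by gcongr
    rw [hM, h2]
    linarith
  have h5 : 0 ≤ ((Real.log (2 / ρ) + 2 * k / b * Real.log 4) * L + 2 / b * C₁) *
    (Real.log (1 + ‖x‖) * m) := by positivity
  have h6 : 0 ≤ 2 * k / b := by positivity
  linarith

lemma integrable_logKernel_mul_of_logSing {n : ℕ} {f : E n → ℝ} (hf0 : ∀ x, 0 ≤ f x)
    (hf : Integrable f) {x : E n} (h : Integrable fun y => logSing (x - y) * f y) :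
    Integrable fun y => logKernel x y * f y := by
  refine ((hf.const_mul (Real.log (2 + 2 * ‖x‖))).add h).mono'
    ((measurable_logKernel_right x).aestronglyMeasurable.mul hf.aestronglyMeasurable)
    (Eventually.of_forall fun y => ?_)
  rw [norm_mul, Real.norm_of_nonneg (hf0 y), Real.norm_eq_abs]
  change _ ≤ Real.log (2 + 2 * ‖x‖) * f y + logSing (x - y) * f y
  rw [← add_mul]
  exact mul_le_mul_of_nonneg_right (abs_logKernel_le x y) (hf0 y)

lemma isCountablyGenerated_cobounded (n : ℕ) :
    (Bornology.cobounded (E n)).IsCountablyGenerated := by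
  rw [← comap_norm_atTop]
  infer_instance

lemma tendsto_setIntegral_ball_cobounded {n : ℕ} {f : E n → ℝ} (hf : Integrable f) (r : ℝ) :
    Tendsto (fun x : E n => ∫ y in ball x r, f y) (Bornology.cobounded (E n)) (𝓝 0) := by
  have := isCountablyGenerated_cobounded n
  have h : Tendsto (fun x : E n => ∫ y, (ball x r).indicator f y) (Bornology.cobounded (E n))
      (𝓝 (∫ _ : E n, (0 : ℝ))) := by
    refine tendsto_integral_filter_of_dominated_convergence (fun y => ‖f y‖)
      (Eventually.of_forall fun x => (hf.indicator measurableSet_ball).aestronglyMeasurable)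
      (Eventually.of_forall fun x => Eventually.of_forall fun y => norm_indicator_le_norm_self f y)
      hf.norm (Eventually.of_forall fun y => ?_)
    refine tendsto_const_nhds.congr' ?_
    filter_upwards [tendsto_norm_cobounded_atTop.eventually_ge_atTop (‖y‖ + r)] with x hx
    rw [indicator_of_notMem]
    rw [mem_ball, dist_eq_norm, not_lt]
    have := norm_le_norm_add_norm_sub y x
    linarith
  rw [integral_zero] at h
  simpa only [integral_indicator measurableSet_ball] using h

lemma tendsto_log_norm_cobounded (n : ℕ) :
    Tendsto (fun x : E n => Real.log ‖x‖) (Bornology.cobounded (E n)) atTop :=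
  Real.tendsto_log_atTop.comp tendsto_norm_cobounded_atTop

/-- The asymptotics of a logarithmic potential whose singular part is negligible. -/
theorem tendsto_pot_div_log {n : ℕ} {f : E n → ℝ} (hf0 : ∀ x, 0 ≤ f x)
    (hf : Integrable f) {C : ℝ} (hC : 0 ≤ C)
    (hN : ∀ x : E n, Integrable (fun y => logSing (x - y) * f y) ∧
      ∫ y, logSing (x - y) * f y ≤ C * (1 + Real.log (1 + ‖x‖) * ∫ y in ball x 1, f y)) :
    Tendsto (fun x => pot f x / Real.log ‖x‖) (Bornology.cobounded (E n)) (𝓝 (-∫ y, f y)) := by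
  have := isCountablyGenerated_cobounded n
  have hinv : Tendsto (fun x : E n => (Real.log ‖x‖)⁻¹) (Bornology.cobounded (E n)) (𝓝 0) :=
    tendsto_inv_atTop_zero.comp (tendsto_log_norm_cobounded n)
  have hlarge : ∀ᶠ x : E n in Bornology.cobounded (E n), 8 ≤ ‖x‖ :=
    tendsto_norm_cobounded_atTop.eventually_ge_atTop 8
  have hlog2 : ∀ x : E n, 8 ≤ ‖x‖ → 0 < Real.log ‖x‖ ∧ Real.log (1 + ‖x‖) ≤ 2 * Real.log ‖x‖ ∧
      Real.log (2 + 2 * ‖x‖) ≤ 2 * Real.log ‖x‖ := by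
    intro x hx
    refine ⟨Real.log_pos (by linarith), ?_, ?_⟩ <;>
    · rw [show 2 * Real.log ‖x‖ = Real.log (‖x‖ ^ 2) by rw [Real.log_pow]; norm_num]
      exact Real.log_le_log (by positivity) (by nlinarith)
  -- The singular part.
  have hsing : Tendsto (fun x => (∫ y, logSing (x - y) * f y) * (Real.log ‖x‖)⁻¹)
      (Bornology.cobounded (E n)) (𝓝 0) := by
    have hub : Tendsto (fun x : E n => C * ((Real.log ‖x‖)⁻¹ + 2 * ∫ y in ball x 1, f y))
        (Bornology.cobounded (E n)) (𝓝 0) := by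
      have := (hinv.add ((tendsto_setIntegral_ball_cobounded hf 1).const_mul 2)).const_mul C
      simpa using this
    refine squeeze_zero' ?_ ?_ hub
    · filter_upwards [hlarge] with x hx
      have := (hlog2 x hx).1
      exact mul_nonneg (integral_nonneg fun y => mul_nonneg (logSing_nonneg _) (hf0 y))
        (by positivity)
    · filter_upwards [hlarge] with x hx
      obtain ⟨h0, h1, -⟩ := hlog2 x hx
      have hm0 : 0 ≤ ∫ y in ball x 1, f y := integral_nonneg fun y => hf0 y
      calc _ ≤ (C * (1 + 2 * Real.log ‖x‖ * ∫ y in ball x 1, f y)) * (Real.log ‖x‖)⁻¹ := by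
            refine mul_le_mul_of_nonneg_right ((hN x).2.trans ?_) (by positivity)
            gcongr
        _ = _ := by field_simp
  -- The regular part, by dominated convergence.
  have hreg : Tendsto (fun x => ∫ y, (logKernel x y + Real.log ‖x‖ - logSing (x - y)) *
      (Real.log ‖x‖)⁻¹ * f y) (Bornology.cobounded (E n)) (𝓝 (∫ _ : E n, (0 : ℝ))) := by
    refine tendsto_integral_filter_of_dominated_convergence (fun y => 3 * f y)
      (Eventually.of_forall fun x => ?_) ?_ (hf.const_mul 3) (Eventually.of_forall fun y => ?_)
    · refine AEStronglyMeasurable.mul (Measurable.aestronglyMeasurable ?_) hf.aestronglyMeasurable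
      exact (((measurable_logKernel_right x).add_const _).sub
        (measurable_logSing.comp (measurable_const.sub measurable_id))).mul_const _
    · filter_upwards [hlarge] with x hx
      obtain ⟨h0, h1, h2⟩ := hlog2 x hx
      refine Eventually.of_forall fun y => ?_
      rw [norm_mul, Real.norm_of_nonneg (hf0 y)]
      refine mul_le_mul_of_nonneg_right ?_ (hf0 y)
      rw [norm_mul, norm_inv, Real.norm_of_nonneg h0.le, ← div_eq_mul_inv, div_le_iff₀ h0,
        Real.norm_eq_abs, abs_le]
      have h3 := logKernel_le x y
      have h4 : logSing (x - y) ≤ logKernel x y + Real.log (1 + ‖x‖) := by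
        refine max_le (by linarith [neg_log_one_add_le_logKernel x y]) ?_
        rcases eq_or_ne x y with rfl | hxy
        · rw [logKernel_self, sub_self, norm_zero, Real.log_zero]
          linarith [Real.log_nonneg (show 1 ≤ 1 + ‖x‖ by simp)]
        · rw [logKernel_eq hxy]
          linarith [Real.log_nonneg (show 1 ≤ 1 + ‖x‖ by simp),
            Real.log_nonneg (show 1 ≤ 1 + ‖y‖ by simp)]
      constructor <;> linarith
    · have hub : Tendsto (fun x : E n => (Real.log (1 + ‖y‖) + Real.log 2) * f y *
          (Real.log ‖x‖)⁻¹) (Bornology.cobounded (E n)) (𝓝 0) := by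
        simpa using hinv.const_mul ((Real.log (1 + ‖y‖) + Real.log 2) * f y)
      refine squeeze_zero_norm' ?_ hub
      filter_upwards [hlarge, tendsto_norm_cobounded_atTop.eventually_ge_atTop (2 * ‖y‖ + 1)]
        with x hx hxy
      obtain ⟨h0, -, -⟩ := hlog2 x hx
      have hyn := norm_nonneg y
      have hd1 : ‖x‖ ≤ 2 * ‖x - y‖ := by
        have := norm_le_norm_add_norm_sub y x
        rw [norm_sub_rev] at this
        linarith
      have hd2 : ‖x - y‖ ≤ 2 * ‖x‖ := by
        have := norm_sub_le x y
        linarith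
      have hd0 : 1 ≤ ‖x - y‖ := by linarith
      have hne : x ≠ y := by
        rintro rfl
        simp at hd0
        linarith
      have e1 : Real.log ‖x‖ ≤ Real.log 2 + Real.log ‖x - y‖ := by
        rw [← Real.log_mul (by norm_num) (by linarith)]
        exact Real.log_le_log (by linarith) hd1
      have e2 : Real.log ‖x - y‖ ≤ Real.log 2 + Real.log ‖x‖ := by
        rw [← Real.log_mul (by norm_num) (by linarith)]
        exact Real.log_le_log (by linarith) hd2
      have e3 := Real.log_nonneg (show 1 ≤ 1 + ‖y‖ by simp)
      rw [logSing_eq_zero hd0, logKernel_eq hne, norm_mul, norm_mul, norm_inv,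
        Real.norm_of_nonneg h0.le, Real.norm_of_nonneg (hf0 y), mul_right_comm]
      refine mul_le_mul_of_nonneg_right (mul_le_mul_of_nonneg_right ?_ (hf0 y)) (by positivity)
      rw [Real.norm_eq_abs, abs_le]
      constructor <;> linarith
  rw [integral_zero] at hreg
  have hsum := (hreg.add hsing).sub_const (∫ y, f y)
  rw [add_zero, zero_sub] at hsum
  refine hsum.congr' ?_
  filter_upwards [hlarge] with x hx
  obtain ⟨h0, -, -⟩ := hlog2 x hx
  have hK := integrable_logKernel_mul_of_logSing hf0 hf (hN x).1
  have hexp : ∫ y, (logKernel x y + Real.log ‖x‖ - logSing (x - y)) * (Real.log ‖x‖)⁻¹ * f y =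
      (pot f x + Real.log ‖x‖ * (∫ y, f y) - ∫ y, logSing (x - y) * f y) *
        (Real.log ‖x‖)⁻¹ := by
    have hKL : Integrable fun y => logKernel x y * f y + Real.log ‖x‖ * f y :=
      hK.add (hf.const_mul _)
    rw [pot, ← integral_const_mul, ← integral_add hK (hf.const_mul _),
      ← integral_sub hKL (hN x).1, ← integral_mul_const]
    refine integral_congr_ae (Eventually.of_forall fun y => ?_)
    ring
  rw [hexp]
  field_simp
  ring

/-! ### Decay of the density -/

lemma not_integrable_of_rpow_le {n : ℕ} (hn : 0 < n) {f : E n → ℝ} {D : ℝ} (hD : 0 < D)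
    (h : ∀ x : E n, 1 ≤ ‖x‖ → D * ‖x‖ ^ (-n : ℝ) ≤ f x) : ¬ Integrable f := by
  intro hf
  have : Nonempty (Fin n) := ⟨⟨0, hn⟩⟩
  set g : ℝ → ℝ := (Ici 1).indicator fun r => r ^ (-n : ℝ) with hg
  have hgm : Measurable g := (measurable_id.pow_const _).indicator measurableSet_Ici
  have hgi : Integrable fun x : E n => g ‖x‖ := by
    refine (hf.norm.const_mul D⁻¹).mono' (hgm.comp measurable_norm).aestronglyMeasurable
      (Eventually.of_forall fun x => ?_)
    by_cases hx : 1 ≤ ‖x‖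
    · rw [hg, indicator_of_mem (mem_Ici.2 hx), Real.norm_of_nonneg (by positivity),
        ← div_eq_inv_mul, le_div_iff₀ hD, mul_comm]
      exact (h x hx).trans (Real.le_norm_self _)
    · rw [hg, indicator_of_notMem (by simpa using hx), norm_zero]
      positivity
  rw [integrable_fun_norm_addHaar] at hgi
  have h1 : IntegrableOn (fun r : ℝ => r ^ (-1 : ℝ)) (Ioi 1) := by
    refine (hgi.mono_set (Ioi_subset_Ioi zero_le_one)).congr_fun (fun r hr => ?_)
      measurableSet_Ioi
    have hr0 : 0 < r := one_pos.trans hr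
    simp only [hg, finrank_euclideanSpace_fin, smul_eq_mul]
    rw [indicator_of_mem (mem_Ici.2 (le_of_lt hr)), ← Real.rpow_natCast, ← Real.rpow_add hr0,
      Nat.cast_sub hn]
    congr 1
    push_cast
    ring
  rw [integrableOn_Ioi_rpow_iff one_pos] at h1
  exact lt_irrefl _ h1

/-- The mass of a solution of `F = D |x|^(nα) exp(κ pot F)` exceeds the threshold below which
the right-hand side fails to be integrable at infinity. -/
lemma lt_mul_integral {n : ℕ} (hn : 0 < n) {F : E n → ℝ} (hF : Integrable F) {α κ D : ℝ}
    (hκ : 0 ≤ κ) (hD : 0 < D)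
    (hFeq : ∀ x, F x = D * ‖x‖ ^ (n * α) * Real.exp (κ * pot F x))
    (hK : ∀ x, Integrable fun y => logKernel x y * F y) :
    n * (1 + α) < κ * ∫ x, F x := by
  have hF0 : ∀ x, 0 ≤ F x := fun x => by rw [hFeq]; positivity
  by_contra! hle
  refine not_integrable_of_rpow_le hn hD (fun x hx => ?_) hF
  have hx0 : 0 < ‖x‖ := by linarith
  have h1 := mul_le_mul_of_nonneg_left (neg_log_mul_le_pot hF0 hF hx (hK x)) hκ
  have h2 := mul_le_mul_of_nonneg_right hle (Real.log_nonneg hx)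
  rw [hFeq, mul_assoc, Real.rpow_def_of_pos hx0, Real.rpow_def_of_pos hx0, ← Real.exp_add]
  gcongr
  linarith

/-- Decay at infinity, with a power to spare: `F` behaves like `|x|^(nα - κΛ)`, and `κΛ` is larger
than `n (1 + α)`. -/
lemma exists_decay {n : ℕ} {F : E n → ℝ} {α κ D : ℝ}
    (hκ : 0 < κ) (hD : 0 < D)
    (hFeq : ∀ x, F x = D * ‖x‖ ^ (n * α) * Real.exp (κ * pot F x))
    (hlt : n * (1 + α) < κ * ∫ x, F x)
    (hlim : Tendsto (fun x => pot F x / Real.log ‖x‖) (Bornology.cobounded (E n))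
      (𝓝 (-∫ y, F y))) :
    ∃ δ > 0, ∃ R ≥ 1, ∀ x : E n, R ≤ ‖x‖ → F x ≤ D * ‖x‖ ^ (-(n + δ) : ℝ) := by
  set Λ := ∫ x, F x with hΛ
  set δ := (κ * Λ - n * (1 + α)) / 2 with hδ
  have hδ0 : 0 < δ := by rw [hδ]; linarith
  have h1 : ∀ᶠ x : E n in Bornology.cobounded (E n), pot F x / Real.log ‖x‖ < -Λ + δ / κ :=
    hlim.eventually_lt_const (by linarith [div_pos hδ0 hκ])
  rw [← comap_norm_atTop, eventually_comap] at h1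
  obtain ⟨R, hR⟩ := eventually_atTop.1 h1
  refine ⟨δ, hδ0, max R 2, le_max_of_le_right (by norm_num), fun x hx => ?_⟩
  have hx2 : 2 ≤ ‖x‖ := (le_max_right _ _).trans hx
  have hx0 : 0 < ‖x‖ := by linarith
  have hlog : 0 < Real.log ‖x‖ := Real.log_pos (by linarith)
  have h2 := hR ‖x‖ ((le_max_left _ _).trans hx) x rfl
  rw [div_lt_iff₀ hlog] at h2
  have h3 := mul_le_mul_of_nonneg_left h2.le hκ.le
  have h4 : κ * ((-Λ + δ / κ) * Real.log ‖x‖) = (-(κ * Λ) + δ) * Real.log ‖x‖ := by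
    field_simp
  rw [h4] at h3
  rw [hFeq, mul_assoc, Real.rpow_def_of_pos hx0, Real.rpow_def_of_pos hx0, ← Real.exp_add]
  gcongr
  have h5 : κ * Λ = 2 * δ + n * (1 + α) := by rw [hδ]; ring
  rw [h5] at h3
  linarith

lemma pot_le_log_add {n : ℕ} {F : E n → ℝ} (hF0 : ∀ x, 0 ≤ F x) (hF : Integrable F) {x : E n}
    (hK : Integrable fun y => logKernel x y * F y)
    (hS : Integrable fun y => logSing (x - y) * F y) :
    pot F x ≤ Real.log (2 + 2 * ‖x‖) * (∫ y, F y) + ∫ y, logSing (x - y) * F y := by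
  rw [← integral_const_mul, ← integral_add (hF.const_mul _) hS]
  refine integral_mono hK ((hF.const_mul _).add hS) fun y => ?_
  change _ ≤ Real.log (2 + 2 * ‖x‖) * F y + logSing (x - y) * F y
  rw [← add_mul]
  exact mul_le_mul_of_nonneg_right (logKernel_le x y) (hF0 y)

/-- The scale invariant bound `F ≤ C |x|^(-n)`: at infinity by the decay, and elsewhere since the
potential is locally bounded and `nα > -n`. -/
lemma exists_le_norm_rpow_neg {n : ℕ} (hn : 0 < n) {F : E n → ℝ} (hF : Integrable F)
    {α κ D : ℝ} (hα : -1 < α) (hκ : 0 ≤ κ) (hD : 0 < D)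
    (hFeq : ∀ x, F x = D * ‖x‖ ^ (n * α) * Real.exp (κ * pot F x))
    (hK : ∀ x, Integrable fun y => logKernel x y * F y) {C : ℝ} (hC : 0 ≤ C)
    (hN : ∀ x : E n, Integrable (fun y => logSing (x - y) * F y) ∧
      ∫ y, logSing (x - y) * F y ≤ C * (1 + Real.log (1 + ‖x‖) * ∫ y in ball x 1, F y))
    {δ R : ℝ} (hδ : 0 < δ) (hR : 1 ≤ R)
    (hdec : ∀ x : E n, R ≤ ‖x‖ → F x ≤ D * ‖x‖ ^ (-(n + δ) : ℝ)) :
    ∃ C' : ℝ, 0 ≤ C' ∧ ∀ x : E n, x ≠ 0 → F x ≤ C' * ‖x‖ ^ (-n : ℝ) := by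
  have hF0 : ∀ x, 0 ≤ F x := fun x => by rw [hFeq]; positivity
  have hn' : (0 : ℝ) < n := by exact_mod_cast hn
  set Λ := ∫ x, F x with hΛ
  have hΛ0 : 0 ≤ Λ := integral_nonneg hF0
  set M := Real.log (2 + 2 * R) * Λ + C * (1 + Real.log (1 + R) * Λ) with hM
  have hR0 : 0 < R := by linarith
  refine ⟨D + D * R ^ (n * (1 + α)) * Real.exp (κ * M), by positivity, fun x hx => ?_⟩
  have hx0 : 0 < ‖x‖ := norm_pos_iff.2 hx
  have hpn : 0 < ‖x‖ ^ (-n : ℝ) := by positivity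
  rw [add_mul]
  rcases le_total R ‖x‖ with h | h
  · have h1 : ‖x‖ ^ (-(n + δ) : ℝ) ≤ ‖x‖ ^ (-n : ℝ) :=
      Real.rpow_le_rpow_of_exponent_le (hR.trans h) (by linarith)
    have h2 := mul_le_mul_of_nonneg_left h1 hD.le
    have h3 : 0 ≤ D * R ^ (n * (1 + α)) * Real.exp (κ * M) * ‖x‖ ^ (-n : ℝ) := by positivity
    linarith [hdec x h]
  · have h1 : pot F x ≤ M := by
      refine (pot_le_log_add hF0 hF (hK x) (hN x).1).trans ?_
      refine add_le_add ?_ ((hN x).2.trans ?_)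
      · refine mul_le_mul_of_nonneg_right (Real.log_le_log (by positivity) (by linarith)) hΛ0
      · have h2 : ∫ y in ball x 1, F y ≤ Λ :=
          setIntegral_le_integral hF (Eventually.of_forall hF0)
        have h3 : Real.log (1 + ‖x‖) ≤ Real.log (1 + R) :=
          Real.log_le_log (by positivity) (by linarith)
        have h4 : 0 ≤ Real.log (1 + R) := Real.log_nonneg (by linarith)
        have h5 : 0 ≤ ∫ y in ball x 1, F y := integral_nonneg fun y => hF0 y
        gcongr
    have h2 : ‖x‖ ^ (n * α) ≤ R ^ (n * (1 + α)) * ‖x‖ ^ (-n : ℝ) := by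
      rw [show n * α = n * (1 + α) + -n by ring, Real.rpow_add hx0]
      have : 0 < 1 + α := by linarith
      gcongr
    have h3 : 0 ≤ D * ‖x‖ ^ (-n : ℝ) := by positivity
    calc F x ≤ D * (R ^ (n * (1 + α)) * ‖x‖ ^ (-n : ℝ)) * Real.exp (κ * M) := by
          rw [hFeq]
          gcongr
      _ ≤ _ := by linarith

lemma integrable_log_mul_of_decay {n : ℕ} {F : E n → ℝ} (hF0 : ∀ x, 0 ≤ F x)
    (hF : Integrable F) {D δ R : ℝ} (hD : 0 ≤ D) (hδ : 0 < δ) (hR : 1 ≤ R)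
    (hdec : ∀ x : E n, R ≤ ‖x‖ → F x ≤ D * ‖x‖ ^ (-(n + δ) : ℝ)) :
    Integrable fun x => Real.log (2 + 2 * ‖x‖) * F x := by
  have hi := ((integrable_log_mul_one_add_rpow (n := n) (r := n + δ) (by linarith)).const_mul
    (D * 2 ^ (n + δ))).add (hF.const_mul (Real.log (2 + 2 * R)))
  refine hi.mono' ((Measurable.aestronglyMeasurable (by fun_prop)).mul hF.aestronglyMeasurable)
    (Eventually.of_forall fun x => ?_)
  have hx := norm_nonneg x
  have hl : 0 ≤ Real.log (2 + 2 * ‖x‖) := Real.log_nonneg (by linarith)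
  have hlR : 0 ≤ Real.log (2 + 2 * R) := Real.log_nonneg (by linarith)
  have hFx := hF0 x
  rw [Real.norm_of_nonneg (by positivity)]
  change _ ≤ D * 2 ^ (n + δ) * (Real.log (2 + 2 * ‖x‖) * (1 + ‖x‖) ^ (-(n + δ) : ℝ)) +
    Real.log (2 + 2 * R) * F x
  rcases le_total R ‖x‖ with h | h
  · have h1 : ‖x‖ ^ (-(n + δ) : ℝ) ≤ 2 ^ (n + δ) * (1 + ‖x‖) ^ (-(n + δ) : ℝ) := by
      have h0 : 0 < ‖x‖ := by linarith
      calc ‖x‖ ^ (-(n + δ) : ℝ) ≤ ((1 + ‖x‖) / 2) ^ (-(n + δ) : ℝ) :=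
            Real.rpow_le_rpow_of_nonpos (by positivity) (by linarith)
              (by have := (Nat.cast_nonneg n : (0 : ℝ) ≤ n); linarith)
        _ = _ := by
            rw [Real.div_rpow (by positivity) (by norm_num),
              Real.rpow_neg (by norm_num : (0 : ℝ) ≤ 2),
              div_inv_eq_mul, mul_comm]
    have h2 : 0 ≤ Real.log (2 + 2 * R) * F x := by positivity
    calc _ ≤ Real.log (2 + 2 * ‖x‖) * (D * (2 ^ (n + δ) * (1 + ‖x‖) ^ (-(n + δ) : ℝ))) := by
          refine mul_le_mul_of_nonneg_left ((hdec x h).trans ?_) hl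
          gcongr
      _ ≤ _ := by linarith
  · have h1 : Real.log (2 + 2 * ‖x‖) ≤ Real.log (2 + 2 * R) :=
      Real.log_le_log (by positivity) (by linarith)
    have h2 : 0 ≤ D * 2 ^ (n + δ) * (Real.log (2 + 2 * ‖x‖) * (1 + ‖x‖) ^ (-(n + δ) : ℝ)) := by
      positivity
    have h3 := mul_le_mul_of_nonneg_right h1 hFx
    linarith

/-! ### The logarithmic kernel under dilations -/

lemma setIntegral_ball_norm_sub_rpow {n : ℕ} (hn : 0 < n) {c : ℝ} (hc : c < n) (x : E n) {r : ℝ}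
    (hr : 0 < r) : IntegrableOn (fun y => ‖x - y‖ ^ (-c)) (ball x r) ∧
      ∫ y in ball x r, ‖x - y‖ ^ (-c) = r ^ (n - c) * ∫ z in ball (0 : E n) 1, ‖z‖ ^ (-c) := by
  set g : E n → ℝ := fun z => ‖z‖ ^ (-c) with hg
  have hgi : IntegrableOn g (ball 0 r) := by
    refine integrableOn_ball_of_norm_le_rpow (C := 1) (α := c) ?_ ?_ ?_ ?_
    · simpa using Nat.one_le_iff_ne_zero.mpr hn.ne'
    · simpa using hc
    · filter_upwards with y
      rw [Real.norm_of_nonneg (by positivity), one_mul]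
    · exact (measurable_norm.pow_const _).aestronglyMeasurable
  have hind : (ball x r).indicator (fun y => ‖x - y‖ ^ (-c)) =
      fun y => (ball (0 : E n) r).indicator g (x - y) := by
    ext y
    by_cases hy : y ∈ ball x r
    · have : x - y ∈ ball (0 : E n) r := by
        rwa [mem_ball_zero_iff, norm_sub_rev, ← dist_eq_norm]
      rw [indicator_of_mem hy, indicator_of_mem this]
    · have : x - y ∉ ball (0 : E n) r := by
        rwa [mem_ball_zero_iff, norm_sub_rev, ← dist_eq_norm]
      rw [indicator_of_notMem hy, indicator_of_notMem this]
  constructor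
  · rw [← integrable_indicator_iff measurableSet_ball, hind]
    exact (hgi.integrable_indicator measurableSet_ball).comp_sub_left x
  · rw [← integral_indicator measurableSet_ball, hind, integral_sub_left_eq_self
      (fun z => (ball (0 : E n) r).indicator g z), integral_indicator measurableSet_ball]
    have h1 := Measure.setIntegral_comp_smul_of_pos volume g (ball (0 : E n) 1) hr
    rw [smul_unitBall hr.ne', Real.norm_of_nonneg hr.le, finrank_euclideanSpace_fin,
      smul_eq_mul] at h1
    have h2 : ∫ z in ball (0 : E n) 1, g (r • z) = r ^ (-c) * ∫ z in ball (0 : E n) 1, g z := by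
      rw [← integral_const_mul]
      refine integral_congr_ae (Eventually.of_forall fun z => ?_)
      simp only [hg]
      rw [norm_smul, Real.norm_of_nonneg hr.le, Real.mul_rpow hr.le (norm_nonneg z)]
    rw [h2, inv_mul_eq_div, eq_div_iff (by positivity)] at h1
    rw [← h1, sub_eq_add_neg, Real.rpow_add hr, Real.rpow_natCast]
    ring

/-- The kernel `((|x|² + |y|²) / |x - y|²)^(3/4)`, which controls the second variation of
`log |x - y|` under dilations. The exponent exceeds `1/2`, so that the error terms are `o(log t)` as
`t → 1`, and it is below `1 ≤ n/2`, so that the kernel is locally integrable in every dimension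
`n ≥ 2`. -/
def dilationKernel {n : ℕ} (x y : E n) : ℝ :=
  ((‖x‖ ^ 2 + ‖y‖ ^ 2) / ‖x - y‖ ^ 2) ^ (3 / 4 : ℝ)

lemma dilationKernel_nonneg {n : ℕ} (x y : E n) : 0 ≤ dilationKernel x y := by
  unfold dilationKernel; positivity

lemma measurable_dilationKernel {n : ℕ} :
    Measurable fun z : E n × E n => dilationKernel z.1 z.2 := by
  unfold dilationKernel; fun_prop

lemma rpow_three_fourths_le {a : ℝ} (ha : 1 ≤ a) : a ^ (3 / 4 : ℝ) ≤ a := by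
  conv_rhs => rw [← Real.rpow_one a]
  exact Real.rpow_le_rpow_of_exponent_le ha (by norm_num)

lemma dilationKernel_le_of_far {n : ℕ} {x y : E n} (h : ‖x‖ / 2 ≤ ‖x - y‖) :
    dilationKernel x y ≤ 13 := by
  refine le_trans ?_ (rpow_three_fourths_le (by norm_num : (1 : ℝ) ≤ 13))
  refine Real.rpow_le_rpow (by positivity) (div_le_of_le_mul₀ (by positivity) (by norm_num) ?_)
    (by norm_num)
  have h1 := norm_le_norm_add_norm_sub x y
  have h2 := norm_nonneg x
  have h3 := norm_nonneg y
  have h4 := norm_nonneg (x - y)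
  have h5 : ‖x‖ ≤ 2 * ‖x - y‖ := by linarith
  have h6 : ‖y‖ ≤ 3 * ‖x - y‖ := by linarith
  have h7 : ‖x‖ ^ 2 ≤ (2 * ‖x - y‖) ^ 2 := by gcongr
  have h8 : ‖y‖ ^ 2 ≤ (3 * ‖x - y‖) ^ 2 := by gcongr
  linarith

lemma dilationKernel_le_of_near {n : ℕ} {x y : E n} (h : ‖x - y‖ ≤ ‖x‖ / 2) :
    dilationKernel x y ≤ 13 * (‖x‖ ^ (3 / 2 : ℝ) * ‖x - y‖ ^ (-(3 / 2) : ℝ)) := by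
  have h1 := norm_le_norm_add_norm_sub x y
  have h2 := norm_nonneg x
  have h3 := norm_nonneg y
  have h4 := norm_nonneg (x - y)
  have h6 : ‖y‖ ^ 2 ≤ (2 * ‖x‖) ^ 2 := by gcongr; linarith
  have h7 : dilationKernel x y ≤ (13 * (‖x‖ ^ 2 / ‖x - y‖ ^ 2)) ^ (3 / 4 : ℝ) := by
    refine Real.rpow_le_rpow (by positivity) ?_ (by norm_num)
    rw [mul_div_assoc']
    gcongr
    linarith [sq_nonneg ‖x‖]
  refine h7.trans ?_
  rw [Real.mul_rpow (by norm_num) (by positivity), Real.div_rpow (by positivity) (by positivity),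
    ← Real.rpow_natCast, ← Real.rpow_natCast, ← Real.rpow_mul h2, ← Real.rpow_mul h4,
    Real.rpow_neg h4, ← div_eq_mul_inv]
  norm_num
  gcongr
  exact rpow_three_fourths_le (by norm_num)

/-- The Schur bound for the kernel of the dilations against a density below `C |x|^(-n)`. -/
lemma exists_integral_mul_dilationKernel_le {n : ℕ} (hn : 2 ≤ n) {F : E n → ℝ}
    (hF0 : ∀ x, 0 ≤ F x) (hF : Integrable F) {C : ℝ} (hC : 0 ≤ C)
    (hle : ∀ x : E n, x ≠ 0 → F x ≤ C * ‖x‖ ^ (-n : ℝ)) :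
    ∃ C' : ℝ, ∀ x : E n, x ≠ 0 → Integrable (fun y => F y * dilationKernel x y) ∧
      ∫ y, F y * dilationKernel x y ≤ C' := by
  have hn0 : 0 < n := by omega
  have hn2 : (2 : ℝ) ≤ n := by exact_mod_cast hn
  have hc : (3 / 2 : ℝ) < n := by linarith
  set I := ∫ z in ball (0 : E n) 1, ‖z‖ ^ (-(3 / 2) : ℝ) with hI
  refine ⟨13 * (∫ y, F y) + 13 * C * 2 ^ (n : ℝ) * ((1 / 2) ^ (n - 3 / 2 : ℝ) * I),
    fun x hx => ?_⟩
  have hx0 : 0 < ‖x‖ := norm_pos_iff.2 hx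
  have hr : 0 < ‖x‖ / 2 := by linarith
  obtain ⟨h1, h2⟩ := setIntegral_ball_norm_sub_rpow hn0 hc x hr
  set q := 13 * C * 2 ^ (n : ℝ) * (‖x‖ ^ (-n : ℝ) * ‖x‖ ^ (3 / 2 : ℝ)) with hq
  have hq0 : 0 ≤ q := by positivity
  set g : E n → ℝ := (ball x (‖x‖ / 2)).indicator fun y => ‖x - y‖ ^ (-(3 / 2) : ℝ) with hg
  have hgi : Integrable g := h1.integrable_indicator measurableSet_ball
  set G : E n → ℝ := fun y => 13 * F y + q * g y with hG
  have hGi : Integrable G := (hF.const_mul _).add (hgi.const_mul _)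
  have hpt : ∀ y, F y * dilationKernel x y ≤ G y := by
    intro y
    have hFy := hF0 y
    simp only [hG]
    by_cases hy : y ∈ ball x (‖x‖ / 2)
    · have hxy : ‖x - y‖ < ‖x‖ / 2 := by
        rwa [norm_sub_rev, ← dist_eq_norm]
      have hgy : g y = ‖x - y‖ ^ (-(3 / 2) : ℝ) := by rw [hg, indicator_of_mem hy]
      have hyx : ‖x‖ / 2 ≤ ‖y‖ := by
        have := norm_le_norm_add_norm_sub y x
        rw [norm_sub_rev] at this
        linarith
      have hy0 : y ≠ 0 := norm_pos_iff.1 (by linarith)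
      have h3 : F y ≤ C * (2 ^ (n : ℝ) * ‖x‖ ^ (-n : ℝ)) := by
        refine (hle y hy0).trans (mul_le_mul_of_nonneg_left ?_ hC)
        calc ‖y‖ ^ (-n : ℝ) ≤ (‖x‖ / 2) ^ (-n : ℝ) :=
              Real.rpow_le_rpow_of_nonpos hr hyx (by linarith)
          _ = _ := by
              rw [Real.div_rpow hx0.le (by norm_num), Real.rpow_neg (by norm_num : (0 : ℝ) ≤ 2),
                div_inv_eq_mul, mul_comm]
      have h4 := mul_le_mul h3 (dilationKernel_le_of_near hxy.le) (dilationKernel_nonneg x y)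
        (by positivity)
      rw [hgy, hq]
      linarith
    · have hxy : ‖x‖ / 2 ≤ ‖x - y‖ := by
        rwa [mem_ball, dist_eq_norm, not_lt, norm_sub_rev] at hy
      have hgy : g y = 0 := by rw [hg, indicator_of_notMem hy]
      rw [hgy, mul_zero, add_zero, mul_comm 13]
      exact mul_le_mul_of_nonneg_left (dilationKernel_le_of_far hxy) hFy
  have hi : Integrable fun y => F y * dilationKernel x y := by
    refine hGi.mono' (hF.aestronglyMeasurable.mul
      (measurable_dilationKernel.comp measurable_prodMk_left).aestronglyMeasurable)
      (Eventually.of_forall fun y => ?_)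
    rw [Real.norm_of_nonneg (mul_nonneg (hF0 y) (dilationKernel_nonneg x y))]
    exact hpt y
  refine ⟨hi, (integral_mono hi hGi hpt).trans (le_of_eq ?_)⟩
  rw [hG, integral_add (hF.const_mul _) (hgi.const_mul _), integral_const_mul,
    integral_const_mul, hg, integral_indicator measurableSet_ball, h2, hq]
  have h3 : ‖x‖ ^ (-n : ℝ) * ‖x‖ ^ (3 / 2 : ℝ) * (‖x‖ / 2) ^ (n - 3 / 2 : ℝ) =
      (1 / 2) ^ (n - 3 / 2 : ℝ) := by
    rw [div_eq_mul_one_div ‖x‖, Real.mul_rpow hx0.le (by norm_num), ← mul_assoc,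
      ← Real.rpow_add hx0, ← Real.rpow_add hx0]
    rw [show -(n : ℝ) + 3 / 2 + (n - 3 / 2) = 0 by ring, Real.rpow_zero, one_mul]
  rw [← h3]
  ring

lemma integrable_prod_dilationKernel {n : ℕ} (hn : 2 ≤ n) {F : E n → ℝ}
    (hF0 : ∀ x, 0 ≤ F x) (hF : Integrable F) {C : ℝ} (hC : 0 ≤ C)
    (hle : ∀ x : E n, x ≠ 0 → F x ≤ C * ‖x‖ ^ (-n : ℝ)) :
    Integrable (fun z : E n × E n => F z.1 * F z.2 * dilationKernel z.1 z.2)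
      (volume.prod volume) := by
  have hn0 : 0 < n := by omega
  obtain ⟨C', hC'⟩ := exists_integral_mul_dilationKernel_le hn hF0 hF hC hle
  have hm : AEStronglyMeasurable (fun z : E n × E n => F z.1 * F z.2 * dilationKernel z.1 z.2)
      (volume.prod volume) :=
    (hF.1.comp_fst.mul hF.1.comp_snd).mul measurable_dilationKernel.aestronglyMeasurable
  refine (integrable_prod_iff hm).2 ⟨?_, ?_⟩
  · filter_upwards [ae_ne_zero hn0] with x hx
    simpa only [mul_assoc] using (hC' x hx).1.const_mul (F x)
  · refine (hF.const_mul C').mono' hm.norm.integral_prod_right' ?_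
    filter_upwards [ae_ne_zero hn0] with x hx
    rw [Real.norm_of_nonneg (integral_nonneg fun y => norm_nonneg _)]
    have h1 : ∫ y, ‖F x * F y * dilationKernel x y‖ =
        F x * ∫ y, F y * dilationKernel x y := by
      rw [← integral_const_mul]
      refine integral_congr_ae (Eventually.of_forall fun y => ?_)
      have := mul_nonneg (mul_nonneg (hF0 x) (hF0 y)) (dilationKernel_nonneg x y)
      change ‖F x * F y * dilationKernel x y‖ = F x * (F y * dilationKernel x y)
      rw [Real.norm_of_nonneg this, mul_assoc]
    change ∫ y, ‖F x * F y * dilationKernel x y‖ ≤ _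
    rw [h1, mul_comm]
    exact mul_le_mul_of_nonneg_right (hC' x hx).2 (hF0 x)

lemma log_one_add_le_rpow {X : ℝ} (hX : 0 ≤ X) : Real.log (1 + X) ≤ 4 / 3 * X ^ (3 / 4 : ℝ) := by
  have h1 : (1 + X) ^ (3 / 4 : ℝ) ≤ 1 + X ^ (3 / 4 : ℝ) := by
    have := Real.rpow_add_le_add_rpow zero_le_one hX (by norm_num : (0 : ℝ) ≤ 3 / 4) (by norm_num)
    simpa using this
  have h2 : Real.log ((1 + X) ^ (3 / 4 : ℝ)) = 3 / 4 * Real.log (1 + X) :=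
    Real.log_rpow (by positivity) _
  have h3 := Real.log_le_sub_one_of_pos (show 0 < (1 + X) ^ (3 / 4 : ℝ) by positivity)
  linarith

/-- The symmetrized change of `log |x - y|` under a dilation of one of the two points is
`log t` up to a term of order `|log t|^(3/2)`: the mean of the squared distances is
`|x - y|²` times `1 + (t + 1/t - 2)/2 * (|x|² + |y|²) / |x - y|²`, after division by `t`. -/
lemma log_norm_smul_sub_le {n : ℕ} {t : ℝ} (ht : 0 < t) {x y : E n} (hxy : x ≠ y)
    (h1 : t • x ≠ y) (h2 : t • y ≠ x) :
    Real.log ‖t • x - y‖ + Real.log ‖t • y - x‖ - 2 * Real.log ‖x - y‖ ≤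
      Real.log t + 4 / 3 * ((t + t⁻¹ - 2) / 2) ^ (3 / 4 : ℝ) * dilationKernel x y := by
  have ha : 0 < ‖t • x - y‖ := norm_pos_iff.2 (sub_ne_zero.2 h1)
  have hb : 0 < ‖t • y - x‖ := norm_pos_iff.2 (sub_ne_zero.2 h2)
  have hr : 0 < ‖x - y‖ := norm_pos_iff.2 (sub_ne_zero.2 hxy)
  have hτ : 0 ≤ (t + t⁻¹ - 2) / 2 := by
    have : t + t⁻¹ - 2 = (t - 1) ^ 2 / t := by field_simp; ring
    rw [this]
    positivity
  set S := (‖x‖ ^ 2 + ‖y‖ ^ 2) / ‖x - y‖ ^ 2 with hS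
  have hS0 : 0 ≤ S := by positivity
  set P := ‖t • x - y‖ ^ 2 / t with hP
  set Q := ‖t • y - x‖ ^ 2 / t with hQ
  have hP0 : 0 < P := by positivity
  have hQ0 : 0 < Q := by positivity
  have hsum : (P + Q) / 2 = ‖x - y‖ ^ 2 * (1 + (t + t⁻¹ - 2) / 2 * S) := by
    have e1 : ‖x - y‖ ^ 2 * S = ‖x‖ ^ 2 + ‖y‖ ^ 2 := by rw [hS]; field_simp
    have e2 : ‖x - y‖ ^ 2 * (1 + (t + t⁻¹ - 2) / 2 * S) =
        ‖x - y‖ ^ 2 + (t + t⁻¹ - 2) / 2 * (‖x‖ ^ 2 + ‖y‖ ^ 2) := by rw [← e1]; ring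
    rw [e2, hP, hQ, norm_sub_sq_real, norm_sub_sq_real, norm_sub_sq_real, norm_smul, norm_smul,
      real_inner_smul_left, real_inner_smul_left, real_inner_comm x y, Real.norm_of_nonneg ht.le]
    field_simp
    ring
  have hlogP : Real.log P = 2 * Real.log ‖t • x - y‖ - Real.log t := by
    rw [hP, Real.log_div (by positivity) ht.ne', Real.log_pow]; norm_num
  have hlogQ : Real.log Q = 2 * Real.log ‖t • y - x‖ - Real.log t := by
    rw [hQ, Real.log_div (by positivity) ht.ne', Real.log_pow]; norm_num
  have hX : 0 ≤ (t + t⁻¹ - 2) / 2 * S := by positivity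
  have hPQ : Real.log P + Real.log Q ≤
      2 * (2 * Real.log ‖x - y‖ + Real.log (1 + (t + t⁻¹ - 2) / 2 * S)) := by
    have e1 : Real.log ((P + Q) / 2) =
        2 * Real.log ‖x - y‖ + Real.log (1 + (t + t⁻¹ - 2) / 2 * S) := by
      rw [hsum, Real.log_mul (by positivity) (by positivity), Real.log_pow]; norm_num
    rw [← e1, ← Real.log_mul hP0.ne' hQ0.ne',
      show 2 * Real.log ((P + Q) / 2) = Real.log (((P + Q) / 2) ^ 2) by
        rw [Real.log_pow]; norm_num]
    refine Real.log_le_log (by positivity) ?_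
    nlinarith [sq_nonneg (P - Q)]
  have h3 := log_one_add_le_rpow hX
  rw [Real.mul_rpow hτ hS0] at h3
  rw [dilationKernel, ← hS]
  linarith

/-! ### The Pohozaev identity -/

lemma integrable_prod_logKernel_smul {n : ℕ} {F : E n → ℝ}
    (hF0 : ∀ x, 0 ≤ F x) (hF : Integrable F) {C : ℝ} (hC : 0 ≤ C)
    (hN : ∀ x : E n, Integrable (fun y => logSing (x - y) * F y) ∧
      ∫ y, logSing (x - y) * F y ≤ C * (1 + Real.log (1 + ‖x‖) * ∫ y in ball x 1, F y))
    (hlog : Integrable fun x => Real.log (2 + 2 * ‖x‖) * F x) {t : ℝ} (ht : 0 < t) :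
    Integrable (fun z : E n × E n => F z.1 * F z.2 * logKernel (t • z.1) z.2)
      (volume.prod volume) := by
  have hmK : Measurable fun z : E n × E n => logKernel (t • z.1) z.2 :=
    measurable_logKernel.comp ((measurable_fst.const_smul t).prodMk measurable_snd)
  have hm : AEStronglyMeasurable (fun z : E n × E n => F z.1 * F z.2 * logKernel (t • z.1) z.2)
      (volume.prod volume) := (hF.1.comp_fst.mul hF.1.comp_snd).mul hmK.aestronglyMeasurable
  set Λ := ∫ y, F y with hΛ
  have hΛ0 : 0 ≤ Λ := integral_nonneg hF0
  have hK : ∀ x, Integrable fun y => logKernel x y * F y := fun x =>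
    integrable_logKernel_mul_of_logSing hF0 hF (hN x).1
  refine (integrable_prod_iff hm).2 ⟨Eventually.of_forall fun x => ?_, ?_⟩
  · refine ((hK (t • x)).const_mul (F x)).congr (Eventually.of_forall fun y => ?_)
    change F x * (logKernel (t • x) y * F y) = F x * F y * logKernel (t • x) y
    ring
  · refine ((hlog.const_mul (Λ + C * Λ)).add (hF.const_mul ((Λ + C * Λ) * Real.log (1 + t) + C))
      ).mono' hm.norm.integral_prod_right' (Eventually.of_forall fun x => ?_)
    rw [Real.norm_of_nonneg (integral_nonneg fun y => norm_nonneg _)]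
    change ∫ y, ‖F x * F y * logKernel (t • x) y‖ ≤ (Λ + C * Λ) * (Real.log (2 + 2 * ‖x‖) * F x) +
      ((Λ + C * Λ) * Real.log (1 + t) + C) * F x
    have hFx := hF0 x
    have hxn := norm_nonneg x
    set w := t • x with hw
    have hwn : ‖w‖ = t * ‖x‖ := by rw [hw, norm_smul, Real.norm_of_nonneg ht.le]
    set l := Real.log (1 + t) + Real.log (2 + 2 * ‖x‖) with hl
    have hl' : l = Real.log ((1 + t) * (2 + 2 * ‖x‖)) :=
      (Real.log_mul (by positivity) (by positivity)).symm
    have hl1 : Real.log (2 + 2 * ‖w‖) ≤ l := by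
      rw [hl', hwn]
      exact Real.log_le_log (by positivity) (by nlinarith)
    have hl2 : Real.log (1 + ‖w‖) ≤ l := by
      refine le_trans (Real.log_le_log (by positivity) ?_) hl1
      linarith [norm_nonneg w]
    have hl0 : 0 ≤ l := (Real.log_nonneg (by linarith [norm_nonneg w])).trans hl2
    have h1 : ∫ y, ‖F x * F y * logKernel w y‖ ≤
        F x * (Real.log (2 + 2 * ‖w‖) * Λ + ∫ y, logSing (w - y) * F y) := by
      rw [hΛ, ← integral_const_mul, ← integral_add (hF.const_mul _) (hN w).1,
        ← integral_const_mul]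
      refine integral_mono_of_nonneg (Eventually.of_forall fun y => norm_nonneg _)
        (((hF.const_mul _).add (hN w).1).const_mul _) (Eventually.of_forall fun y => ?_)
      change ‖F x * F y * logKernel w y‖ ≤
        F x * (Real.log (2 + 2 * ‖w‖) * F y + logSing (w - y) * F y)
      rw [norm_mul, Real.norm_of_nonneg (mul_nonneg hFx (hF0 y)), Real.norm_eq_abs, mul_assoc,
        ← add_mul, mul_comm (F y)]
      refine mul_le_mul_of_nonneg_left ?_ hFx
      exact mul_le_mul_of_nonneg_right (abs_logKernel_le w y) (hF0 y)
    have h2 : ∫ y, logSing (w - y) * F y ≤ C * (1 + l * Λ) := by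
      refine (hN w).2.trans ?_
      have h3 : ∫ y in ball w 1, F y ≤ Λ :=
        setIntegral_le_integral hF (Eventually.of_forall hF0)
      have h5 : 0 ≤ ∫ y in ball w 1, F y := integral_nonneg fun y => hF0 y
      gcongr
    have h3 : Real.log (2 + 2 * ‖w‖) * Λ ≤ l * Λ := mul_le_mul_of_nonneg_right hl1 hΛ0
    refine h1.trans ((mul_le_mul_of_nonneg_left (add_le_add h3 h2) hFx).trans (le_of_eq ?_))
    rw [hl]
    ring

lemma ae_prod_ne_smul {n : ℕ} (hn : 0 < n) (t : ℝ) :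
    ∀ᵐ z : E n × E n ∂(volume.prod volume), t • z.1 ≠ z.2 := by
  have : Nonempty (Fin n) := ⟨⟨0, hn⟩⟩
  have hm : MeasurableSet {z : E n × E n | t • z.1 ≠ z.2} :=
    (measurableSet_eq_fun (measurable_fst.const_smul t) measurable_snd).compl
  refine (Measure.ae_prod_iff_ae_ae hm).2 (Eventually.of_forall fun x => ?_)
  have h : ∀ᵐ y : E n, y ≠ t • x := compl_mem_ae_iff.2 (measure_singleton _)
  exact h.mono fun y hy => hy.symm

/-- Under dilation by `t` of one variable, the logarithmic interaction energy of a density decreases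
by at most half the square of the mass times `log t`, up to a term of order `|log t|^(3/2)`. -/
lemma le_integral_prod_dilation {n : ℕ} (hn : 0 < n) {F : E n → ℝ}
    (hF0 : ∀ x, 0 ≤ F x) (hF : Integrable F)
    (hlk : ∀ t : ℝ, 0 < t → Integrable (fun z : E n × E n => F z.1 * F z.2 *
      logKernel (t • z.1) z.2) (volume.prod volume))
    (hdk : Integrable (fun z : E n × E n => F z.1 * F z.2 * dilationKernel z.1 z.2)
      (volume.prod volume)) {t : ℝ} (ht : 0 < t) :
    -(Real.log t * (∫ x, F x) ^ 2 + 4 / 3 * ((t + t⁻¹ - 2) / 2) ^ (3 / 4 : ℝ) *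
      ∫ z : E n × E n, F z.1 * F z.2 * dilationKernel z.1 z.2 ∂(volume.prod volume)) ≤
    2 * ∫ x, F x * (pot F (t • x) - pot F x) := by
  set c := 4 / 3 * ((t + t⁻¹ - 2) / 2) ^ (3 / 4 : ℝ) with hc
  set B := ∫ z : E n × E n, F z.1 * F z.2 * dilationKernel z.1 z.2 ∂(volume.prod volume) with hB
  set J : E n × E n → ℝ := fun z => F z.1 * F z.2 * logKernel (t • z.1) z.2 -
    F z.1 * F z.2 * logKernel z.1 z.2 with hJ
  have hlk1 := hlk 1 one_pos
  simp only [one_smul] at hlk1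
  have hJi : Integrable J (volume.prod volume) := (hlk t ht).sub hlk1
  have hJ1 : ∫ z, J z ∂(volume.prod volume) = ∫ x, F x * (pot F (t • x) - pot F x) := by
    have e : ∀ w x : E n, ∫ y, F x * F y * logKernel w y = F x * pot F w := by
      intro w x
      rw [pot, ← integral_const_mul]
      refine integral_congr_ae (Eventually.of_forall fun y => ?_)
      change F x * F y * logKernel w y = F x * (logKernel w y * F y)
      ring
    have i1 := (hlk t ht).integral_prod_left
    have i2 := hlk1.integral_prod_left
    simp only [e] at i1 i2
    rw [hJ, integral_sub (hlk t ht) hlk1, integral_prod _ (hlk t ht), integral_prod _ hlk1]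
    simp only [e]
    rw [← integral_sub i1 i2]
    refine integral_congr_ae (Eventually.of_forall fun x => ?_)
    change F x * pot F (t • x) - F x * pot F x = F x * (pot F (t • x) - pot F x)
    ring
  have hJ2 : ∫ z, J z.swap ∂(volume.prod volume) = ∫ z, J z ∂(volume.prod volume) :=
    integral_prod_swap J
  have hFF : Integrable (fun z : E n × E n => F z.1 * F z.2) (volume.prod volume) :=
    hF.mul_prod hF
  have hFFint : ∫ z : E n × E n, F z.1 * F z.2 ∂(volume.prod volume) = (∫ x, F x) ^ 2 := by
    rw [integral_prod_mul, sq]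
  have hsw : Integrable (fun z => J z.swap) (volume.prod volume) := hJi.swap
  have hmono : ∫ z : E n × E n, -(Real.log t * (F z.1 * F z.2) +
      c * (F z.1 * F z.2 * dilationKernel z.1 z.2)) ∂(volume.prod volume) ≤
      ∫ z, (J z + J z.swap) ∂(volume.prod volume) := by
    refine integral_mono_ae (((hFF.const_mul _).add (hdk.const_mul _)).fun_neg) (hJi.add hsw) ?_
    have hne1 := ae_prod_ne_smul hn 1
    have hne2 := ae_prod_ne_smul hn t
    have hne3 := ae_prod_ne_smul hn t⁻¹
    filter_upwards [hne1, hne2, hne3] with z h1 h2 h3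
    rw [one_smul] at h1
    have h3' : t • z.2 ≠ z.1 := by
      rintro h
      apply h3
      rw [← h, smul_smul, inv_mul_cancel₀ ht.ne', one_smul]
    have hmain := log_norm_smul_sub_le ht h1 h2 h3'
    have hnn : 0 ≤ F z.1 * F z.2 := mul_nonneg (hF0 _) (hF0 _)
    have h4 := mul_le_mul_of_nonneg_left hmain hnn
    change -(Real.log t * (F z.1 * F z.2) + c * (F z.1 * F z.2 * dilationKernel z.1 z.2)) ≤
      (F z.1 * F z.2 * logKernel (t • z.1) z.2 - F z.1 * F z.2 * logKernel z.1 z.2) +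
      (F z.2 * F z.1 * logKernel (t • z.2) z.1 - F z.2 * F z.1 * logKernel z.2 z.1)
    rw [logKernel_eq h2, logKernel_eq h1, logKernel_eq h3', logKernel_eq h1.symm,
      norm_sub_rev z.2 z.1]
    rw [← hc] at h4
    linarith
  rw [integral_neg, integral_add (hFF.const_mul _) (hdk.const_mul _), integral_const_mul,
    integral_const_mul, hFFint, integral_add hJi hsw, hJ2, hJ1] at hmono
  linarith

/-- The dilation inequality: the mass is invariant under `F ↦ t^n F(t ·)`, and the equation together
with `1 + x ≤ e^x` bounds `t^n F(t ·) - F` from below. -/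
lemma scaling_inequality {n : ℕ} (hn : 0 < n) {F : E n → ℝ} (hF : Integrable F) {α κ D : ℝ}
    (hD : 0 ≤ D)
    (hFeq : ∀ x, F x = D * ‖x‖ ^ (n * α) * Real.exp (κ * pot F x))
    {t : ℝ} (ht : 0 < t) (hi : Integrable fun x => F x * (pot F (t • x) - pot F x)) :
    n * (1 + α) * Real.log t * (∫ x, F x) + κ * ∫ x, F x * (pot F (t • x) - pot F x) ≤ 0 := by
  have hF0 : ∀ x, 0 ≤ F x := fun x => by rw [hFeq]; positivity
  have hsi : Integrable fun x => t ^ n * F (t • x) := (hF.comp_smul ht.ne').const_mul _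
  have hsc : ∫ x, t ^ n * F (t • x) = ∫ x, F x := by
    rw [integral_const_mul, Measure.integral_comp_smul_of_nonneg volume F t (hR := ht.le),
      finrank_euclideanSpace_fin, smul_eq_mul]
    field_simp
  have hpt : ∀ᵐ x : E n, F x + (n * (1 + α) * Real.log t * F x +
      κ * (F x * (pot F (t • x) - pot F x))) ≤ t ^ n * F (t • x) := by
    filter_upwards [ae_ne_zero hn] with x hx
    have hx0 : 0 < ‖x‖ := norm_pos_iff.2 hx
    have h1 : t ^ n * F (t • x) = F x *
        Real.exp (n * (1 + α) * Real.log t + κ * (pot F (t • x) - pot F x)) := by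
      rw [hFeq (t • x), hFeq x, norm_smul, Real.norm_of_nonneg ht.le,
        Real.mul_rpow ht.le hx0.le, ← Real.rpow_natCast, Real.rpow_def_of_pos ht,
        Real.rpow_def_of_pos ht, mul_assoc (D * ‖x‖ ^ (n * α)), ← Real.exp_add]
      rw [show κ * pot F x + (n * (1 + α) * Real.log t + κ * (pot F (t • x) - pot F x)) =
        Real.log t * n + Real.log t * (n * α) + κ * pot F (t • x) by ring, Real.exp_add,
        Real.exp_add]
      ring
    rw [h1]
    have h2 := Real.add_one_le_exp (n * (1 + α) * Real.log t + κ * (pot F (t • x) - pot F x))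
    have h3 := mul_le_mul_of_nonneg_left h2 (hF0 x)
    linarith
  have hi2 : Integrable fun x => n * (1 + α) * Real.log t * F x +
      κ * (F x * (pot F (t • x) - pot F x)) := (hF.const_mul _).add (hi.const_mul _)
  have h := integral_mono_ae (hF.add hi2) hsi hpt
  rw [hsc, integral_add' hF hi2, integral_add (hF.const_mul _) (hi.const_mul _),
    integral_const_mul, integral_const_mul] at h
  linarith

lemma half_sub_rpow_le {s : ℝ} (hs : |s| ≤ 1) :
    ((Real.exp s + (Real.exp s)⁻¹ - 2) / 2) ^ (3 / 4 : ℝ) ≤ |s| ^ (3 / 2 : ℝ) := by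
  have h1 : (Real.exp s + (Real.exp s)⁻¹ - 2) / 2 = Real.cosh s - 1 := by
    rw [← Real.exp_neg, Real.cosh_eq]
    ring
  have h2 : Real.cosh s - 1 ≤ |s| ^ 2 := by
    have h3 := Real.cosh_le_exp_half_sq s
    have h4 : s ^ 2 ≤ 1 := by rw [← sq_abs]; exact pow_le_one₀ (abs_nonneg _) hs
    have h5 := Real.exp_bound_div_one_sub_of_interval (x := s ^ 2 / 2) (by positivity)
      (by linarith)
    have h6 : 1 / (1 - s ^ 2 / 2) ≤ 1 + s ^ 2 := by
      rw [div_le_iff₀ (by linarith)]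
      nlinarith [sq_nonneg s]
    rw [sq_abs]
    linarith
  rw [h1]
  calc _ ≤ (|s| ^ 2) ^ (3 / 4 : ℝ) :=
        Real.rpow_le_rpow (by linarith [Real.one_le_cosh s]) h2 (by norm_num)
    _ = _ := by
        rw [← Real.rpow_natCast, ← Real.rpow_mul (abs_nonneg _)]
        norm_num

lemma nonpos_of_mul_le_rpow {X C : ℝ}
    (h : ∀ s : ℝ, 0 < s → s ≤ 1 → X * s ≤ C * s ^ (3 / 2 : ℝ)) : X ≤ 0 := by
  have hlim : Tendsto (fun s : ℝ => C * s ^ (1 / 2 : ℝ)) (𝓝[>] 0) (𝓝 0) := by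
    have h1 : Continuous fun s : ℝ => C * s ^ (1 / 2 : ℝ) :=
      continuous_const.mul (Real.continuous_rpow_const (by norm_num))
    have h2 := h1.tendsto 0
    rw [Real.zero_rpow (by norm_num), mul_zero] at h2
    exact h2.mono_left nhdsWithin_le_nhds
  refine ge_of_tendsto hlim ?_
  filter_upwards [Ioc_mem_nhdsGT (zero_lt_one' ℝ)] with s hs
  have h1 := h s hs.1 hs.2
  rw [show (3 / 2 : ℝ) = 1 / 2 + 1 by norm_num, Real.rpow_add_one hs.1.ne', ← mul_assoc] at h1
  exact le_of_mul_le_mul_right h1 hs.1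

/-- The Pohozaev identity for solutions of `F = D |x|^(nα) exp(κ pot F)`. Its usual proof multiplies
the equation by `x · ∇F`; here the derivative along dilations is replaced by difference quotients
from both sides, which needs no regularity of `F`. -/
theorem mul_integral_eq_of_solution {n : ℕ} (hn : 2 ≤ n) {F : E n → ℝ} (hF : Integrable F)
    {α κ D : ℝ} (hα : -1 < α) (hκ : 0 < κ) (hD : 0 < D)
    (hFeq : ∀ x, F x = D * ‖x‖ ^ (n * α) * Real.exp (κ * pot F x)) :
    κ * ∫ x, F x = 2 * (n * (1 + α)) := by
  have hn0 : 0 < n := by omega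
  have hn' : (0 : ℝ) < n := by exact_mod_cast hn0
  have hF0 : ∀ x, 0 ≤ F x := fun x => by rw [hFeq]; positivity
  obtain ⟨C, hC, hN⟩ := exists_integral_logSing_mul_le hn0 hF0 hF hα hκ.le hD.le
    (Eventually.of_forall fun x => (hFeq x).le)
  have hK : ∀ x, Integrable fun y => logKernel x y * F y := fun x =>
    integrable_logKernel_mul_of_logSing hF0 hF (hN x).1
  have hlt := lt_mul_integral hn0 hF hκ.le hD hFeq hK
  obtain ⟨δ, hδ, R, hR, hdec⟩ := exists_decay hκ hD hFeq hlt (tendsto_pot_div_log hF0 hF hC hN)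
  obtain ⟨C', hC', hle⟩ := exists_le_norm_rpow_neg hn0 hF hα hκ.le hD hFeq hK hC hN hδ hR hdec
  have hlog := integrable_log_mul_of_decay hF0 hF hD.le hδ hR hdec
  have hlk : ∀ t : ℝ, 0 < t → Integrable (fun z : E n × E n => F z.1 * F z.2 *
      logKernel (t • z.1) z.2) (volume.prod volume) := fun t ht =>
    integrable_prod_logKernel_smul hF0 hF hC hN hlog ht
  have hdk := integrable_prod_dilationKernel hn hF0 hF hC' hle
  set Λ := ∫ x, F x with hΛ
  set B := ∫ z : E n × E n, F z.1 * F z.2 * dilationKernel z.1 z.2 ∂(volume.prod volume) with hB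
  have hB0 : 0 ≤ B := integral_nonneg fun z =>
    mul_nonneg (mul_nonneg (hF0 _) (hF0 _)) (dilationKernel_nonneg _ _)
  have hpotF : ∀ t : ℝ, 0 < t → Integrable fun x => F x * pot F (t • x) := by
    intro t ht
    refine (hlk t ht).integral_prod_left.congr (Eventually.of_forall fun x => ?_)
    change ∫ y, F x * F y * logKernel (t • x) y = F x * pot F (t • x)
    rw [pot, ← integral_const_mul]
    refine integral_congr_ae (Eventually.of_forall fun y => ?_)
    change F x * F y * logKernel (t • x) y = F x * (logKernel (t • x) y * F y)
    ring
  have hpot1 := hpotF 1 one_pos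
  simp only [one_smul] at hpot1
  set X := n * (1 + α) * Λ - κ / 2 * Λ ^ 2 with hX
  have hkey : ∀ s : ℝ, |s| ≤ 1 → X * s ≤ κ / 2 * (4 / 3 * B) * |s| ^ (3 / 2 : ℝ) := by
    intro s hs
    have ht := Real.exp_pos s
    have hi : Integrable fun x => F x * (pot F (Real.exp s • x) - pot F x) := by
      simp only [mul_sub]
      exact (hpotF _ ht).sub hpot1
    have h1 := scaling_inequality hn0 hF hD.le hFeq ht hi
    have h2 := le_integral_prod_dilation hn0 hF0 hF hlk hdk ht
    rw [Real.log_exp] at h1 h2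
    have h3 := half_sub_rpow_le hs
    have h4 := mul_le_mul_of_nonneg_left h3 hB0
    have h5 := mul_le_mul_of_nonneg_left h2 (by positivity : 0 ≤ κ / 2)
    have h6 := mul_le_mul_of_nonneg_left h4 (by positivity : 0 ≤ κ / 2 * (4 / 3))
    rw [hX]
    linarith
  -- Both signs of `s` are allowed, so the coefficient of `s` vanishes.
  have hX1 : X ≤ 0 := by
    refine nonpos_of_mul_le_rpow (C := κ / 2 * (4 / 3 * B)) fun s hs hs1 => ?_
    have := hkey s (by rwa [abs_of_pos hs])
    rwa [abs_of_pos hs] at this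
  have hX2 : -X ≤ 0 := by
    refine nonpos_of_mul_le_rpow (C := κ / 2 * (4 / 3 * B)) fun s hs hs1 => ?_
    have := hkey (-s) (by rwa [abs_neg, abs_of_pos hs])
    rw [abs_neg, abs_of_pos hs] at this
    linarith
  -- `X = 0` is the identity multiplied by the mass.
  have hX0 : Λ * (κ * Λ - 2 * (n * (1 + α))) = 0 := by
    have : X = 0 := le_antisymm hX1 (by linarith)
    rw [hX] at this
    linarith
  have hΛ0 : Λ ≠ 0 := by
    intro h
    rw [h, mul_zero] at hlt
    have : 0 < n * (1 + α) := mul_pos hn' (by linarith)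
    linarith
  rcases mul_eq_zero.1 hX0 with h | h
  · exact absurd h hΛ0
  · linarith

/-! ### The potential and the mass of a solution -/

lemma density_eq_of_eq_add {n : ℕ} (α : ℝ) {u : E n → ℝ} {x : E n} {q : ℝ}
    (h : u x - 1 / gammaConst n * pot (density n α u) x = q) :
    density n α u x = Real.exp (n * q) * ‖x‖ ^ (n * α) *
      Real.exp (n / gammaConst n * pot (density n α u) x) := by
  have h1 : u x = q + 1 / gammaConst n * pot (density n α u) x := by linarith
  conv_lhs => rw [density, h1, mul_add, Real.exp_add]
  rw [show (n : ℝ) * (1 / gammaConst n * pot (density n α u) x) =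
    n / gammaConst n * pot (density n α u) x by ring]
  ring

/-- The potential of a solution converges at every point, not only almost everywhere, with the
bound on its singular part that governs the behaviour at infinity. -/
lemma exists_integral_logSing_density_le {n : ℕ} (hn : 0 < n) {α : ℝ} (hα : -1 < α)
    {u : E n → ℝ} (hf : Integrable (density n α u)) {p : MvPolynomial (Fin n) ℝ}
    (hp : BddAbove (range (polyFun n p)))
    (hup : ∀ᵐ x, u x - 1 / gammaConst n * pot (density n α u) x = polyFun n p x) :
    ∃ C : ℝ, 0 ≤ C ∧ ∀ x : E n, Integrable (fun y => logSing (x - y) * density n α u y) ∧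
      ∫ y, logSing (x - y) * density n α u y ≤
        C * (1 + Real.log (1 + ‖x‖) * ∫ y in ball x 1, density n α u y) := by
  obtain ⟨P, hP⟩ := hp
  have hγ := gammaConst_pos hn
  refine exists_integral_logSing_mul_le hn (density_nonneg α u) hf hα
    (κ := n / gammaConst n) (D := Real.exp (n * P)) (by positivity) (Real.exp_pos _).le ?_
  filter_upwards [hup] with y hy
  rw [density_eq_of_eq_add α hy]
  gcongr
  exact hP ⟨y, rfl⟩

/-- If the polynomial part is constant, the mass is determined by the Pohozaev identity. -/
lemma totalQ_eq_of_const {n : ℕ} (hn : 2 ≤ n) {α : ℝ} (hα : -1 < α)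
    {u : E n → ℝ} (hf : Integrable (density n α u)) {c : ℝ}
    (hup : ∀ᵐ x, u x - 1 / gammaConst n * pot (density n α u) x = c) :
    totalQ n α u = lambdaOne n * (1 + α) := by
  have hn0 : 0 < n := by omega
  have hn' : (0 : ℝ) < n := by exact_mod_cast hn0
  have hγ := gammaConst_pos hn0
  -- Changing `f` on a null set does not change its potential, so that `f = e^(nc) |x|^(nα) e^(nv)`
  -- may be assumed everywhere.
  set F : E n → ℝ := fun x => Real.exp (n * c) * ‖x‖ ^ (n * α) *
    Real.exp (n / gammaConst n * pot (density n α u) x) with hF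
  have hfF : density n α u =ᵐ[volume] F := hup.mono fun x hx => density_eq_of_eq_add α hx
  have hpot : pot F = pot (density n α u) := by
    funext x
    refine integral_congr_ae (hfF.mono fun y hy => ?_)
    change logKernel x y * F y = logKernel x y * density n α u y
    rw [hy]
  have h := mul_integral_eq_of_solution hn (hf.congr hfF) hα (κ := n / gammaConst n)
    (by positivity) (Real.exp_pos (n * c)) (fun x => by rw [hpot])
  rw [totalQ, integral_congr_ae hfF]
  have hl : lambdaOne n = 2 * gammaConst n := by
    rw [lambdaOne, gammaConst]
    ring
  rw [hl]
  field_simp at h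
  linarith

end QCurv

end

theorem theorem1p1 (n : ℕ) (hn : 2 ≤ n) (α : ℝ) (hα : -1 < α)
    (u : QCurv.E n → ℝ) (hu : QCurv.SolvesP0 n α u) :
    (∀ x : QCurv.E n, MeasureTheory.Integrable (QCurv.potentialIntegrand n α u x)) ∧
    (∃ p : MvPolynomial (Fin n) ℝ,
      p.totalDegree ≤ n - 1 ∧
      BddAbove (Set.range (QCurv.polyFun n p)) ∧
      (∀ᵐ x : QCurv.E n, u x = QCurv.logPotential n α u x + QCurv.polyFun n p x) ∧
      ((∃ c : ℝ, p = MvPolynomial.C c) →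
        QCurv.totalQ n α u = QCurv.lambdaOne n * (1 + α))) ∧
    Filter.Tendsto (fun x : QCurv.E n => QCurv.logPotential n α u x / Real.log ‖x‖)
      (Bornology.cobounded (QCurv.E n))
      (nhds (-(QCurv.totalQ n α u / QCurv.gammaConst n))) := by
  have hn0 : 0 < n := by omega
  obtain ⟨p, hdeg, hbdd, hup⟩ := QCurv.exists_poly_of_solution hn0 hu
  obtain ⟨C, hC, hN⟩ := QCurv.exists_integral_logSing_density_le hn0 hα hu.1 hbdd hup
  refine ⟨fun x => QCurv.integrable_logKernel_mul_of_logSing (QCurv.density_nonneg α u) hu.1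
    (hN x).1, ⟨p, hdeg, hbdd, ?_, ?_⟩, ?_⟩
  · filter_upwards [hup] with x hx
    rw [QCurv.logPotential_eq]
    linarith
  · rintro ⟨c, rfl⟩
    refine QCurv.totalQ_eq_of_const hn hα hu.1 (c := c) ?_
    filter_upwards [hup] with x hx
    rw [hx, QCurv.polyFun, MvPolynomial.eval_C]
  · have h := (QCurv.tendsto_pot_div_log (QCurv.density_nonneg α u) hu.1 hC hN).const_mul
      (1 / QCurv.gammaConst n)
    rw [show -(QCurv.totalQ n α u / QCurv.gammaConst n) =
      1 / QCurv.gammaConst n * -∫ y, QCurv.density n α u y by rw [QCurv.totalQ]; ring]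
    refine h.congr fun x => ?_
    rw [QCurv.logPotential_eq]
    ring
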